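/- Let $K$ be a (finite-dimensional, real) Lie group with Lie algebra $\mathfrak k$, and let $\langle\cdot,\cdot\rangle$ be an inner product on $\mathfrak k$ that is invariant under the adjoint representation $\mathrm{ad}$ of $K$ (such an inner product exists whenever $K$ is compact). Let $\pi:P\to M$ be a smooth $K$-principal bundle (right action) with a connection $A$, with connection form $\omega_A$, horizontal projection $\pi_A:TP\to\ker\omega_A$, covariant exterior derivative $d_A=\pi_A^*d$ and curvature $F_A=d\omega_A+\frac12[\omega_A\wedge\omega_A]$, where $[\eta\wedge\zeta](\xi_1,\xi_2)=[\eta(\xi_1),\zeta(\xi_2)]-[\eta(\xi_2),\zeta(\xi_1)]$ for $\mathfrak k$-valued one-forms. Let $\alpha$ be a smooth $\mathfrak k$-valued one-form on $P$ that vanishes on vertical vectors, satisfies $R_g^*\alpha=\mathrm{ad}_{g^{-1}}\alpha$ for all $g\in K$, and restricts for each $p\in P$ to an isomorphism from the horizontal space $\ker(\omega_A)_p$ onto $\mathfrak k$. Write $\mathrm{ad}(P)=P\times_{\mathrm{ad}}\mathfrak k$ for the adjoint bundle, $[p;X]$ for the class of $(p,X)$, $\tilde u_p$ for the horizontal lift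 to $p$ of a tangent vector $u$ of $M$ at $\pi(p)$, and ${}^\vee\alpha:TM\to\mathrm{ad}(P)$, $u\mapsto[p;\alpha(\tilde u_p)]$, for the bundle isomorphism induced by $\alpha$. Let $g_\alpha$ be the Riemannian metric on $M$ obtained by pulling back along ${}^\vee\alpha$ the fibre metric on $\mathrm{ad}(P)$ induced by $\langle\cdot,\cdot\rangle$. Let $\nabla^A$ be the linear connection on $\mathrm{ad}(P)$ induced by $A$ (it sends a section $\sigma$, seen as an equivariant function $f:P\to\mathfrak k$, to $\nabla^A_u\sigma=[p;df_p(\tilde u_p)]$), and let $\nabla=({}^\vee\alpha)^{-1}\circ\nabla^A\circ{}^\vee\alpha$ be its pull-back to $TM$. Suppose that the integrability equations $$d_A\alpha=0,\qquad F_A=\tfrac12[\alpha\wedge\alpha]$$ hold. Then $\nabla$ is a linear connection on $TM$, it is the Levi-Civita connection of $(M,g_\alpha)$, and its curvature $R_\nabla$, where $R_\nabla(U,V)W=\nabla_U\nabla_VW-\nabla_V\nabla_UW-\nabla_{[U,V]}W$, is given for all $p\in P$ and all tangent vectors $u,v,w$ of $M$ at $\pi(p)$ by $$R_\nabla(u,v)w=({}^\vee\alpha)^{-1}\bigl(\bigl[p;[[\alpha(\tilde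 u_p),\alpha(\tilde v_p)],\alpha(\tilde w_p)]\bigr]\bigr).$$ For $g_\alpha$-orthonormal $u,v$ at $\pi(p)$ the sectional curvature of $g_\alpha$ on the plane spanned by $u$ and $v$ equals $$-\bigl|[\alpha(\tilde u_p),\alpha(\tilde v_p)]\bigr|^2.$$ In particular the sectional curvature of $g_\alpha$ on every tangent plane is non-positive. If moreover $K$ is compact and its maximal torus has dimension $1$, then the sectional curvature of $g_\alpha$ on every tangent plane is strictly negative. -/

import Mathlib

open Set
open scoped Manifold ContDiff Topology

noncomputable section

namespace AdBundleGeometry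

/-! ### The Lie group `K`: adjoint representation, invariant inner products, maximal tori

The Lie algebra of `K` is `GroupLieAlgebra 𝓘(ℝ, EK) K`, the tangent space at the identity with the
bracket of left-invariant vector fields.  As every tangent space in Mathlib it is a type synonym of
the model space `EK`; that identification is used to differentiate functions with values in it. -/

section LieGroups

variable {EK : Type*} [NormedAddCommGroup EK] [NormedSpace ℝ EK]
  {K : Type*} [TopologicalSpace K] [ChartedSpace EK K] [Group K]

/-- The adjoint representation: `Ad g` is the derivative at `1` of the conjugation
`x ↦ g * x * g⁻¹`. -/
def Ad (g : K) : GroupLieAlgebra 𝓘(ℝ, EK) K →L[ℝ] GroupLieAlgebra 𝓘(ℝ, EK) K :=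
  mfderiv 𝓘(ℝ, EK) 𝓘(ℝ, EK) (fun x : K => g * x * g⁻¹) (1 : K)

/-- An `Ad`-invariant inner product on the Lie algebra of `K`. -/
structure IsAdInvariantInner (B : LinearMap.BilinForm ℝ (GroupLieAlgebra 𝓘(ℝ, EK) K)) : Prop where
  symm : ∀ X Y, B X Y = B Y X
  pos : ∀ X, X ≠ 0 → 0 < B X X
  invariant : ∀ (g : K) (X Y : GroupLieAlgebra 𝓘(ℝ, EK) K), B (Ad g X) (Ad g Y) = B X Y

/-- A torus in a Lie group: a compact connected abelian subgroup. -/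
def IsTorus {K : Type*} [TopologicalSpace K] [Group K] (T : Subgroup K) : Prop :=
  IsCompact (T : Set K) ∧ IsConnected (T : Set K) ∧ ∀ a ∈ T, ∀ b ∈ T, a * b = b * a

/-- A maximal torus: a torus which is not properly contained in another torus. -/
def IsMaximalTorus {K : Type*} [TopologicalSpace K] [Group K] (T : Subgroup K) : Prop :=
  Maximal IsTorus T

variable (EK) in
/-- The subgroup `T` is a torus of dimension `n`: it is the image of an injective smooth
homomorphism from `ℝⁿ / ℤⁿ`. -/
def HasTorusDim (T : Subgroup K) (n : ℕ) : Prop :=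
  ∃ f : (Fin n → ℝ) → K,
    ContMDiff 𝓘(ℝ, Fin n → ℝ) 𝓘(ℝ, EK) ∞ f ∧
    (∀ s t, f (s + t) = f s * f t) ∧
    Set.range f = (T : Set K) ∧
    ∀ t, f t = 1 ↔ ∀ i, ∃ m : ℤ, t i = m

end LieGroups

/-! ### Linear connections on the tangent bundle: Riemannian notions -/

section Riemannian

variable {EM : Type*} [NormedAddCommGroup EM] [NormedSpace ℝ EM]
  {M : Type*} [TopologicalSpace M] [ChartedSpace EM M] [IsManifold 𝓘(ℝ, EM) ∞ M]

/-- `cov` is torsion free and compatible with the metric `g`, i.e. it is the Levi-Civita connection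
of `g`.  (`cov W x (U x)` is `∇_U W` at `x`.) -/
structure IsLeviCivita
    (cov : CovariantDerivative 𝓘(ℝ, EM) EM (TangentSpace 𝓘(ℝ, EM) : M → Type _))
    (g : ∀ x : M, TangentSpace 𝓘(ℝ, EM) x → TangentSpace 𝓘(ℝ, EM) x → ℝ) : Prop where
  torsion_free : ∀ (U V : Π x : M, TangentSpace 𝓘(ℝ, EM) x) (x : M),
    MDiffAt (T% U) x → MDiffAt (T% V) x →
      cov V x (U x) - cov U x (V x) = VectorField.mlieBracket 𝓘(ℝ, EM) U V x
  metric : ∀ (V W : Π x : M, TangentSpace 𝓘(ℝ, EM) x) (x : M) (u : TangentSpace 𝓘(ℝ, EM) x),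
    MDiffAt (T% V) x → MDiffAt (T% W) x →
      MDiffAt (fun y => g y (V y) (W y)) x ∧
      (mfderiv 𝓘(ℝ, EM) 𝓘(ℝ, ℝ) (fun y => g y (V y) (W y)) x u : ℝ) =
        g x (cov V x u) (W x) + g x (V x) (cov W x u)

/-- `∇_U ∇_V W - ∇_V ∇_U W - ∇_[U,V] W` at the point `x`. -/
def curvatureOfFields
    (cov : CovariantDerivative 𝓘(ℝ, EM) EM (TangentSpace 𝓘(ℝ, EM) : M → Type _))
    (U V W : Π x : M, TangentSpace 𝓘(ℝ, EM) x) (x : M) : TangentSpace 𝓘(ℝ, EM) x :=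
  cov (fun y => cov W y (V y)) x (U x) - cov (fun y => cov W y (U y)) x (V x)
    - cov W x (VectorField.mlieBracket 𝓘(ℝ, EM) U V x)

/-- The Riemannian curvature `R(u, v) w` at `x`, computed with the standard extensions (constant in
a trivialization of `TM` around `x`) of the three tangent vectors. -/
def curvature
    (cov : CovariantDerivative 𝓘(ℝ, EM) EM (TangentSpace 𝓘(ℝ, EM) : M → Type _))
    (x : M) (u v w : TangentSpace 𝓘(ℝ, EM) x) : TangentSpace 𝓘(ℝ, EM) x :=
  curvatureOfFields cov (FiberBundle.extend EM u) (FiberBundle.extend EM v)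
    (FiberBundle.extend EM w) x

/-- The sectional curvature at `x` of the plane spanned by the linearly independent vectors
`u, v`. -/
def sectionalCurvature
    (cov : CovariantDerivative 𝓘(ℝ, EM) EM (TangentSpace 𝓘(ℝ, EM) : M → Type _))
    (g : ∀ x : M, TangentSpace 𝓘(ℝ, EM) x → TangentSpace 𝓘(ℝ, EM) x → ℝ)
    (x : M) (u v : TangentSpace 𝓘(ℝ, EM) x) : ℝ :=
  g x u (curvature cov x u v v) / (g x u u * g x v v - g x u v ^ 2)

end Riemannian

/-! ### Principal bundles -/

/-- A smooth principal fibre bundle `proj : P → M` with structure group `K`: a smooth right action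
of `K` on `P`, and equivariant local trivializations `π⁻¹(U) ≅ U × K` over `M`. -/
structure PrincipalBundle
    (EK : Type*) [NormedAddCommGroup EK] [NormedSpace ℝ EK]
    (K : Type*) [TopologicalSpace K] [ChartedSpace EK K] [Group K]
    (EP : Type*) [NormedAddCommGroup EP] [NormedSpace ℝ EP]
    (P : Type*) [TopologicalSpace P] [ChartedSpace EP P]
    (EM : Type*) [NormedAddCommGroup EM] [NormedSpace ℝ EM]
    (M : Type*) [TopologicalSpace M] [ChartedSpace EM M] where
  proj : P → M
  act : P → K → P
  contMDiff_proj : ContMDiff 𝓘(ℝ, EP) 𝓘(ℝ, EM) ∞ proj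
  contMDiff_act : ContMDiff (𝓘(ℝ, EP).prod 𝓘(ℝ, EK)) 𝓘(ℝ, EP) ∞ (fun q : P × K => act q.1 q.2)
  act_one : ∀ p, act p 1 = p
  act_mul : ∀ p g h, act p (g * h) = act (act p g) h
  proj_act : ∀ p g, proj (act p g) = proj p
  exists_trivialization : ∀ x : M, ∃ (U : Set M) (e : OpenPartialHomeomorph P (M × K)),
    IsOpen U ∧ x ∈ U ∧ e.source = proj ⁻¹' U ∧ e.target = U ×ˢ Set.univ ∧
    ContMDiffOn 𝓘(ℝ, EP) (𝓘(ℝ, EM).prod 𝓘(ℝ, EK)) ∞ e e.source ∧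
    ContMDiffOn (𝓘(ℝ, EM).prod 𝓘(ℝ, EK)) 𝓘(ℝ, EP) ∞ e.symm e.target ∧
    (∀ p ∈ e.source, (e p).1 = proj p) ∧
    ∀ p ∈ e.source, ∀ g, e (act p g) = (proj p, (e p).2 * g)

section Forms

variable {EK : Type*} [NormedAddCommGroup EK] [NormedSpace ℝ EK]
  {K : Type*} [TopologicalSpace K] [ChartedSpace EK K] [Group K]
  {EP : Type*} [NormedAddCommGroup EP] [NormedSpace ℝ EP]
  {P : Type*} [TopologicalSpace P] [ChartedSpace EP P]
  {EM : Type*} [NormedAddCommGroup EM] [NormedSpace ℝ EM]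
  {M : Type*} [TopologicalSpace M] [ChartedSpace EM M]

variable (EK K EP P) in
/-- Differential one-forms on `P` with values in the Lie algebra of `K` (no smoothness yet). -/
abbrev OneForm : Type _ :=
  ∀ p : P, TangentSpace 𝓘(ℝ, EP) p →L[ℝ] GroupLieAlgebra 𝓘(ℝ, EK) K

variable (EK K EP P) in
/-- Differential two-forms on `P` with values in the Lie algebra of `K`, as functions of a point
and two tangent vectors. -/
abbrev TwoForm : Type _ :=
  ∀ p : P, TangentSpace 𝓘(ℝ, EP) p → TangentSpace 𝓘(ℝ, EP) p → GroupLieAlgebra 𝓘(ℝ, EK) K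

/-- Smoothness of a one-form, as a function on the tangent bundle. -/
def OneForm.IsSmooth [IsManifold 𝓘(ℝ, EP) ∞ P] (η : OneForm EK K EP P) : Prop :=
  ContMDiff 𝓘(ℝ, EP).tangent 𝓘(ℝ, EK) ∞ (M' := EK)
    (fun v : TangentBundle 𝓘(ℝ, EP) P => η v.proj v.snd)

/-- The pull-back of the one-form `η` to the model space by the inverse of the preferred chart at
`p`. -/
def OneForm.inChart (η : OneForm EK K EP P) (p : P) (y : EP) : EP →L[ℝ] EK :=
  (η ((extChartAt 𝓘(ℝ, EP) p).symm y)).comp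
    (mfderiv 𝓘(ℝ, EP) 𝓘(ℝ, EP) (extChartAt 𝓘(ℝ, EP) p).symm y)

/-- The exterior derivative of a one-form, computed in the preferred chart at `p`; normalised by
`dη(X, Y) = X (η Y) - Y (η X) - η [X, Y]`. -/
def OneForm.d (η : OneForm EK K EP P) : TwoForm EK K EP P := fun p u v =>
  let y := extChartAt 𝓘(ℝ, EP) p p
  let u' : EP := mfderiv 𝓘(ℝ, EP) 𝓘(ℝ, EP) (extChartAt 𝓘(ℝ, EP) p) p u
  let v' : EP := mfderiv 𝓘(ℝ, EP) 𝓘(ℝ, EP) (extChartAt 𝓘(ℝ, EP) p) p v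
  (fderiv ℝ (η.inChart p) y u' v' - fderiv ℝ (η.inChart p) y v' u' : EK)

/-- The form `[η ∧ ζ]`: wedge product of one-forms combined with the Lie bracket on the values. -/
def OneForm.bracketWedge (η ζ : OneForm EK K EP P) : TwoForm EK K EP P := fun p u v =>
  ⁅η p u, ζ p v⁆ - ⁅η p v, ζ p u⁆

namespace PrincipalBundle

/-- The fundamental vector field `X^#`: the derivative at `1` of `g ↦ p g`, applied to `X`. -/
def fundamental (Q : PrincipalBundle EK K EP P EM M) (p : P) :
    GroupLieAlgebra 𝓘(ℝ, EK) K →L[ℝ] TangentSpace 𝓘(ℝ, EP) p :=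
  mfderiv 𝓘(ℝ, EK) 𝓘(ℝ, EP) (fun g : K => Q.act p g) (1 : K)

/-- The derivative at `p` of the right translation `R_g : p ↦ p g`. -/
def translate (Q : PrincipalBundle EK K EP P EM M) (g : K) (p : P) :
    TangentSpace 𝓘(ℝ, EP) p →L[ℝ] TangentSpace 𝓘(ℝ, EP) (Q.act p g) :=
  mfderiv 𝓘(ℝ, EP) 𝓘(ℝ, EP) (fun q : P => Q.act q g) p

/-- The derivative of the bundle projection. -/
def dproj (Q : PrincipalBundle EK K EP P EM M) (p : P) :
    TangentSpace 𝓘(ℝ, EP) p →L[ℝ] TangentSpace 𝓘(ℝ, EM) (Q.proj p) :=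
  mfderiv 𝓘(ℝ, EP) 𝓘(ℝ, EM) Q.proj p

lemma exists_proj_eq (Q : PrincipalBundle EK K EP P EM M) (x : M) : ∃ p, Q.proj p = x := by
  obtain ⟨U, e, -, hx, -, ht, -, -, h1, -⟩ := Q.exists_trivialization x
  have hm : (x, (1 : K)) ∈ e.target := by rw [ht]; exact ⟨hx, mem_univ _⟩
  refine ⟨e.symm (x, 1), ?_⟩
  rw [← h1 _ (e.map_target hm), e.right_inv hm]

/-- A chosen point of the fibre over `x`. -/
def pt (Q : PrincipalBundle EK K EP P EM M) (x : M) : P := (Q.exists_proj_eq x).choose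

lemma proj_pt (Q : PrincipalBundle EK K EP P EM M) (x : M) : Q.proj (Q.pt x) = x :=
  (Q.exists_proj_eq x).choose_spec

/-- A tensorial one-form of type `ad`: smooth, zero on vertical vectors, and equivariant. -/
structure IsTensorial [IsManifold 𝓘(ℝ, EP) ∞ P] (Q : PrincipalBundle EK K EP P EM M)
    (η : OneForm EK K EP P) : Prop where
  smooth : η.IsSmooth
  vertical : ∀ p (v : TangentSpace 𝓘(ℝ, EP) p), Q.dproj p v = 0 → η p v = 0
  equivariant : ∀ p (g : K) (v : TangentSpace 𝓘(ℝ, EP) p),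
    η (Q.act p g) (Q.translate g p v) = Ad g⁻¹ (η p v)

/-- A connection on the principal bundle, given by its connection one-form. -/
structure Connection [IsManifold 𝓘(ℝ, EP) ∞ P] (Q : PrincipalBundle EK K EP P EM M) where
  form : OneForm EK K EP P
  smooth : form.IsSmooth
  form_fundamental : ∀ p X, form p (Q.fundamental p X) = X
  equivariant : ∀ p (g : K) (v : TangentSpace 𝓘(ℝ, EP) p),
    form (Q.act p g) (Q.translate g p v) = Ad g⁻¹ (form p v)

/-- The relation `(p, X) ∼ (p g, Ad g⁻¹ X)` on `P × 𝔨`. -/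
def adRel (Q : PrincipalBundle EK K EP P EM M) (a b : P × GroupLieAlgebra 𝓘(ℝ, EK) K) : Prop :=
  ∃ g : K, b = (Q.act a.1 g, Ad g⁻¹ a.2)

/-- The adjoint bundle `ad(P) = P ×_ad 𝔨`. -/
def AdBundle (Q : PrincipalBundle EK K EP P EM M) : Type _ := Quot Q.adRel

/-- The class `[p; X]` in the adjoint bundle. -/
def cls (Q : PrincipalBundle EK K EP P EM M) (p : P) (X : GroupLieAlgebra 𝓘(ℝ, EK) K) :
    Q.AdBundle :=
  Quot.mk _ (p, X)

/-- The bundle projection `ad(P) → M`, `[p; X] ↦ π p`. -/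
def adProj (Q : PrincipalBundle EK K EP P EM M) : Q.AdBundle → M :=
  Quot.lift (fun a => Q.proj a.1) (by rintro a b ⟨g, rfl⟩; exact (Q.proj_act a.1 g).symm)

/-- For `a` in the fibre of `ad(P)` over `π p`, the unique `X` with `[p; X] = a`. -/
def coord (Q : PrincipalBundle EK K EP P EM M) (p : P) (a : Q.AdBundle) :
    GroupLieAlgebra 𝓘(ℝ, EK) K :=
  Function.invFun (Q.cls p) a

/-- The map `^` on sections: the equivariant function on `P` that belongs to a section `σ` of
`ad(P)`, determined by `[p; (^σ)(p)] = σ (π p)`. -/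
def hatSection (Q : PrincipalBundle EK K EP P EM M) (σ : M → Q.AdBundle) (p : P) :
    GroupLieAlgebra 𝓘(ℝ, EK) K :=
  Q.coord p (σ (Q.proj p))

/-- The fibre metric `h` on `ad(P)` induced by an `Ad`-invariant inner product: if `a = [p; X]` and
`b = [p; Y]` then `h(a, b) = B X Y`. -/
def adMetric (Q : PrincipalBundle EK K EP P EM M)
    (B : LinearMap.BilinForm ℝ (GroupLieAlgebra 𝓘(ℝ, EK) K)) (a b : Q.AdBundle) : ℝ :=
  B (Q.coord (Q.pt (Q.adProj a)) a) (Q.coord (Q.pt (Q.adProj a)) b)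

namespace Connection

variable [IsManifold 𝓘(ℝ, EP) ∞ P] {Q : PrincipalBundle EK K EP P EM M}

/-- The projection `π_A` of `T_pP` onto the horizontal space, along the vertical space. -/
def hor (A : Q.Connection) (p : P) : TangentSpace 𝓘(ℝ, EP) p →L[ℝ] TangentSpace 𝓘(ℝ, EP) p :=
  ContinuousLinearMap.id ℝ _ - (Q.fundamental p).comp (A.form p)

/-- The covariant exterior derivative `d_A = π_A^* d` on one-forms. -/
def dA (A : Q.Connection) (η : OneForm EK K EP P) : TwoForm EK K EP P := fun p u v =>
  η.d p (A.hor p u) (A.hor p v)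

/-- The covariant derivative `d_A = π_A^* d` on functions with values in the Lie algebra. -/
def dAFun (A : Q.Connection) (f : P → GroupLieAlgebra 𝓘(ℝ, EK) K) : OneForm EK K EP P := fun p =>
  ContinuousLinearMap.comp
    (mfderiv 𝓘(ℝ, EP) 𝓘(ℝ, EK) (M' := EK) f p :
      TangentSpace 𝓘(ℝ, EP) p →L[ℝ] GroupLieAlgebra 𝓘(ℝ, EK) K)
    (A.hor p)

/-- The curvature `F_A = dω_A + ½ [ω_A ∧ ω_A]`. -/
def curvatureForm (A : Q.Connection) : TwoForm EK K EP P := fun p u v =>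
  A.form.d p u v + (1 / 2 : ℝ) • A.form.bracketWedge A.form p u v

/-- The horizontal lift to `p` of a vector tangent to `M` at `π p`: the unique `w` with
`dπ w = u` and `ω_A w = 0`. -/
def lift (A : Q.Connection) (p : P) :
    TangentSpace 𝓘(ℝ, EM) (Q.proj p) →L[ℝ] TangentSpace 𝓘(ℝ, EP) p :=
  ((Q.dproj p).prod (A.form p)).inverse.comp (ContinuousLinearMap.inl ℝ _ _)

/-- The horizontal lift to `p` of a vector tangent to `M` at `x`, where `π p = x`. -/
def liftAt (A : Q.Connection) : (p : P) → {x : M} → Q.proj p = x →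
    (TangentSpace 𝓘(ℝ, EM) x →L[ℝ] TangentSpace 𝓘(ℝ, EP) p)
  | p, _, rfl => A.lift p

/-- The map `ˇ` on one-forms: `(ˇβ)_x(u) = [p; β_p(ũ)]` with `p` over `x` and `ũ` the horizontal
lift of `u` to `p`. -/
def check (A : Q.Connection) (β : OneForm EK K EP P) (x : M) (u : TangentSpace 𝓘(ℝ, EM) x) :
    Q.AdBundle :=
  Q.cls (Q.pt x) (β (Q.pt x) (A.liftAt (Q.pt x) (Q.proj_pt x) u))

/-- The connection `∇^A = ˇ ∘ d_A ∘ ^` on the adjoint bundle: `nablaAd A σ x u = ∇^A_u σ`. -/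
def nablaAd (A : Q.Connection) (σ : M → Q.AdBundle) (x : M) (u : TangentSpace 𝓘(ℝ, EM) x) :
    Q.AdBundle :=
  A.check (A.dAFun (Q.hatSection σ)) x u

/-- The inverse of `ˇα : T_xM → ad(P)_x`. -/
def checkInv (A : Q.Connection) (α : OneForm EK K EP P) (x : M) (a : Q.AdBundle) :
    TangentSpace 𝓘(ℝ, EM) x :=
  Function.invFun (A.check α x) a

/-- The connection `∇ = (ˇα)⁻¹ ∘ ∇^A ∘ ˇα` on the tangent bundle of `M`:
`nabla A α W x u = ∇_u W`. -/
def nabla (A : Q.Connection) (α : OneForm EK K EP P) (W : Π x : M, TangentSpace 𝓘(ℝ, EM) x)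
    (x : M) (u : TangentSpace 𝓘(ℝ, EM) x) : TangentSpace 𝓘(ℝ, EM) x :=
  A.checkInv α x (A.nablaAd (fun y => A.check α y (W y)) x u)

/-- The metric `g_α` on `M`, the pull-back by `ˇα` of the fibre metric on `ad(P)`. -/
def gMetric (A : Q.Connection) (α : OneForm EK K EP P)
    (B : LinearMap.BilinForm ℝ (GroupLieAlgebra 𝓘(ℝ, EK) K)) (x : M)
    (u v : TangentSpace 𝓘(ℝ, EM) x) : ℝ :=
  Q.adMetric B (A.check α x u) (A.check α x v)

end Connection

end PrincipalBundle

end Forms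

end AdBundleGeometry

end

noncomputable section

namespace AdBundleGeometry

set_option linter.unusedSectionVars false

open VectorField

/-! A vector field `W` on `M` is encoded by the equivariant function `fieldFun`, `f_W(p) = α(W̃_p)`,
and `∇` becomes differentiation of `f_W` along horizontal lifts. Along a local section `σ`, put `a =
σ^*ω_A`, `β = σ^*α` and `w = f_W ∘ σ = β(W)`. The vertical part of `dσ` contributes a bracket,
because the derivative of `Ad` is `ad` (`mfd_AdE`), so `∇_u W` corresponds to `dw(u) + [a(u), w]`
(`isoE_covE`).

Every local claim is checked with a section that is horizontal at one point `p`
(`exists_horizontal_section`). There `a = 0` while `da` need not vanish, and `dσ(u)` is the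
horizontal lift of `u`. Since exterior derivatives commute with pull-back (`OneForm.fderiv_pull`),
the equation `d_A α = 0` says that `dβ = 0` at the centre, and `F_A = ½[α ∧ α]` says that `da(u, v)
= [α(ũ), α(ṽ)]` there.

Additivity and the Leibniz rule of `∇` are then those of an ordinary derivative. Torsion is `dβ`
(`covE_torsion`). By `Ad`-invariance the metric along `σ` is `B` applied to the functions `w`, so
compatibility is the product rule (`gMetric_covE`). In the curvature the symmetric second
derivatives of `w` cancel, the first-order terms cancel against `∇_[U,V]`, and `[da(U, V), w]`
remains (`isoE_curvature`). Skewness of `ad` turns the numerator of the sectional curvature into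
`-|[X, Y]|²`, over a positive Gram determinant.

Strict negativity needs commuting elements of the Lie algebra to be dependent
(`br_ne_zero_of_torusDim_one`). Let `H` generate the one-dimensional maximal torus. Maximising
`B(Ad_g X, H)` over the compact group conjugates `X` into the centraliser of `H`
(`exists_br_AdE_eq_zero`). By maximality of the torus this centraliser is the line of `H`
(`mem_span_of_br_eq_zero`). If `[X, Y] = 0` with `X ≠ 0`, the same conjugation puts `Y` on that line
too. -/

/-! ### Derivatives with values in the model spaces -/

section ModelDerivative

variable {E : Type*} [NormedAddCommGroup E] [NormedSpace ℝ E]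
  {M : Type*} [TopologicalSpace M] [ChartedSpace E M]
  {E' : Type*} [NormedAddCommGroup E'] [NormedSpace ℝ E']
  {M' : Type*} [TopologicalSpace M'] [ChartedSpace E' M']
  {E'' : Type*} [NormedAddCommGroup E''] [NormedSpace ℝ E'']
  {M'' : Type*} [TopologicalSpace M''] [ChartedSpace E'' M'']

/-- The manifold derivative, as a continuous linear map between the model spaces. -/
def mfd (f : M → M') (x : M) : E →L[ℝ] E' := mfderiv 𝓘(ℝ, E) 𝓘(ℝ, E') f x

lemma mfd_comp {g : M' → M''} {f : M → M'} (x : M)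
    (hg : MDifferentiableAt 𝓘(ℝ, E') 𝓘(ℝ, E'') g (f x))
    (hf : MDifferentiableAt 𝓘(ℝ, E) 𝓘(ℝ, E') f x) :
    mfd (fun y => g (f y)) x = (mfd g (f x) : E' →L[ℝ] E'').comp (mfd f x : E →L[ℝ] E') :=
  mfderiv_comp x hg hf

lemma mfd_comp_apply {g : M' → M''} {f : M → M'} (x : M)
    (hg : MDifferentiableAt 𝓘(ℝ, E') 𝓘(ℝ, E'') g (f x))
    (hf : MDifferentiableAt 𝓘(ℝ, E) 𝓘(ℝ, E') f x) (v : E) :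
    (mfd (fun y => g (f y)) x : E →L[ℝ] E'') v
      = (mfd g (f x) : E' →L[ℝ] E'') ((mfd f x : E →L[ℝ] E') v) := by
  rw [mfd_comp x hg hf]; rfl

lemma mfd_congr {f g : M → M'} {x : M} (h : f =ᶠ[𝓝 x] g) :
    (mfd f x : E →L[ℝ] E') = mfd g x :=
  h.mfderiv_eq

lemma mfd_id (x : M) : (mfd (fun y : M => y) x : E →L[ℝ] E) = ContinuousLinearMap.id ℝ E :=
  mfderiv_id

lemma mfd_const (x : M) (c : M') : (mfd (fun _ : M => c) x : E →L[ℝ] E') = 0 :=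
  mfderiv_const

lemma mfd_eq_fderiv (f : E → E') (x : E) : mfd f x = fderiv ℝ f x := mfderiv_eq_fderiv

/-- The derivative of a function of two variables, restricted to a curve in the product. -/
lemma mfd_comp₂ {F : Type*} [NormedAddCommGroup F] [NormedSpace ℝ F]
    {N : Type*} [TopologicalSpace N] [ChartedSpace F N]
    {f : M → M' → M''} {g : N → M} {h : N → M'} (x : N)
    (hf : MDifferentiableAt (𝓘(ℝ, E).prod 𝓘(ℝ, E')) 𝓘(ℝ, E'') (fun q : M × M' => f q.1 q.2)
      (g x, h x))
    (hg : MDifferentiableAt 𝓘(ℝ, F) 𝓘(ℝ, E) g x) (hh : MDifferentiableAt 𝓘(ℝ, F) 𝓘(ℝ, E') h x)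
    (v : F) :
    (mfd (fun y => f (g y) (h y)) x : F →L[ℝ] E'') v =
      (mfd (fun m => f m (h x)) (g x) : E →L[ℝ] E'') ((mfd g x : F →L[ℝ] E) v) +
      (mfd (fun m' => f (g x) m') (h x) : E' →L[ℝ] E'') ((mfd h x : F →L[ℝ] E') v) := by
  have h1 := mfderiv_comp (I := 𝓘(ℝ, F)) (I' := 𝓘(ℝ, E).prod 𝓘(ℝ, E')) (I'' := 𝓘(ℝ, E''))
    (f := fun y => (g y, h y)) x hf (hg.prodMk hh)
  have h2 : (mfd (fun y => f (g y) (h y)) x : F →L[ℝ] E'') v =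
    (mfderiv (𝓘(ℝ, E).prod 𝓘(ℝ, E')) 𝓘(ℝ, E'') (fun q : M × M' => f q.1 q.2) (g x, h x))
     ((mfderiv 𝓘(ℝ, F) (𝓘(ℝ, E).prod 𝓘(ℝ, E')) (fun y => (g y, h y)) x) v) :=
    congrArg (fun L : F →L[ℝ] E'' => L v) h1
  rw [h2, mfderiv_prodMk hg hh, mfderiv_prod_eq_add_apply hf]
  rfl

variable [IsManifold 𝓘(ℝ, E) ∞ M]

/-- A vector field on `M`, read in the preferred chart at `x`. -/
def chartField (V : Π x : M, TangentSpace 𝓘(ℝ, E) x) (x : M) (z : E) : E :=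
  (mfd (extChartAt 𝓘(ℝ, E) x) ((extChartAt 𝓘(ℝ, E) x).symm z) : E →L[ℝ] E)
    (V ((extChartAt 𝓘(ℝ, E) x).symm z))

lemma mfd_chart_self (x : M) :
    (mfd (extChartAt 𝓘(ℝ, E) x) x : E →L[ℝ] E) = ContinuousLinearMap.id ℝ E :=
  mfderiv_extChartAt_self

lemma mdifferentiableAt_chart_symm (x : M) {z : E} (hz : z ∈ (extChartAt 𝓘(ℝ, E) x).target) :
    MDifferentiableAt 𝓘(ℝ, E) 𝓘(ℝ, E) (extChartAt 𝓘(ℝ, E) x).symm z := by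
  have := mdifferentiableWithinAt_extChartAt_symm (I := 𝓘(ℝ, E)) hz
  rwa [modelWithCornersSelf_coe, range_id, mdifferentiableWithinAt_univ] at this

lemma mdifferentiableAt_chart (x : M) {y : M} (hy : y ∈ (extChartAt 𝓘(ℝ, E) x).source) :
    MDifferentiableAt 𝓘(ℝ, E) 𝓘(ℝ, E) (extChartAt 𝓘(ℝ, E) x) y :=
  mdifferentiableAt_extChartAt (by rwa [extChartAt_source] at hy)

lemma mfd_symm_comp_chart (x : M) {z : E} (hz : z ∈ (extChartAt 𝓘(ℝ, E) x).target) (v : E) :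
    (mfd (extChartAt 𝓘(ℝ, E) x).symm z : E →L[ℝ] E)
    ((mfd (extChartAt 𝓘(ℝ, E) x) ((extChartAt 𝓘(ℝ, E) x).symm z) : E →L[ℝ] E) v) = v := by
  have h : extChartAt 𝓘(ℝ, E) x ((extChartAt 𝓘(ℝ, E) x).symm z) = z :=
    (extChartAt 𝓘(ℝ, E) x).right_inv hz
  have h3 := (extChartAt 𝓘(ℝ, E) x).map_target hz
  have h2 := mfd_comp_apply (g := (extChartAt 𝓘(ℝ, E) x).symm) (f := extChartAt 𝓘(ℝ, E) x)
    ((extChartAt 𝓘(ℝ, E) x).symm z) (by rw [h]; exact mdifferentiableAt_chart_symm x hz)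
    (mdifferentiableAt_chart x h3) v
  rw [h] at h2
  rw [← h2, mfd_congr (g := fun y : M => y), mfd_id]
  · rfl
  · filter_upwards [(isOpen_extChartAt_source x).mem_nhds h3] with y hy
    exact (extChartAt 𝓘(ℝ, E) x).left_inv hy

lemma chartField_self (V : Π x : M, TangentSpace 𝓘(ℝ, E) x) (x : M) :
    chartField V x (extChartAt 𝓘(ℝ, E) x x) = V x := by
  have h : ∀ y : M, y = x → (mfd (extChartAt 𝓘(ℝ, E) x) y : E →L[ℝ] E) (V y) = V x := by
    rintro y rfl
    exact congrArg (fun L : E →L[ℝ] E => L (V y)) (mfd_chart_self y)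
  exact h _ (extChartAt_to_inv x)

/-- The pull-back is built from the inverse of the derivative of the inverse chart, which on the
chart target is the derivative of the chart. -/
lemma mpullbackWithin_chart_eq (V : Π x : M, TangentSpace 𝓘(ℝ, E) x) (x : M) {z : E}
    (hz : z ∈ (extChartAt 𝓘(ℝ, E) x).target) :
    mpullbackWithin 𝓘(ℝ, E) 𝓘(ℝ, E) (extChartAt 𝓘(ℝ, E) x).symm V (range 𝓘(ℝ, E)) z
      = chartField V x z := by
  rw [mpullbackWithin_apply, chartField]
  have h1 := mfderiv_extChartAt_comp_mfderivWithin_extChartAt_symm (I := 𝓘(ℝ, E)) hz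
  have h2 := mfderivWithin_extChartAt_symm_comp_mfderiv_extChartAt (I := 𝓘(ℝ, E)) hz
  rw [ContinuousLinearMap.inverse_eq h2 h1]
  rfl

/-- The Lie bracket of vector fields, computed in the preferred chart. -/
lemma mlieBracket_eq_chart (V W : Π x : M, TangentSpace 𝓘(ℝ, E) x) (x : M) :
    (mlieBracket 𝓘(ℝ, E) V W x : TangentSpace 𝓘(ℝ, E) x) =
      (lieBracket ℝ (chartField V x) (chartField W x) (extChartAt 𝓘(ℝ, E) x x) : E) := by
  have h : (extChartAt 𝓘(ℝ, E) x).target ∈ 𝓝 (extChartAt 𝓘(ℝ, E) x x) :=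
    extChartAt_target_mem_nhds x
  have h0 : lieBracketWithin ℝ
      (mpullbackWithin 𝓘(ℝ, E) 𝓘(ℝ, E) (extChartAt 𝓘(ℝ, E) x).symm V (range 𝓘(ℝ, E)))
      (mpullbackWithin 𝓘(ℝ, E) 𝓘(ℝ, E) (extChartAt 𝓘(ℝ, E) x).symm W (range 𝓘(ℝ, E)))
      ((extChartAt 𝓘(ℝ, E) x).symm ⁻¹' univ ∩ range 𝓘(ℝ, E)) (extChartAt 𝓘(ℝ, E) x x) =
      lieBracket ℝ (chartField V x) (chartField W x) (extChartAt 𝓘(ℝ, E) x x) := by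
    have : (extChartAt 𝓘(ℝ, E) x).symm ⁻¹' univ ∩ range 𝓘(ℝ, E) = univ := by simp
    rw [this]
    refine Eq.trans (congrFun lieBracketWithin_univ _) ?_
    refine Filter.EventuallyEq.lieBracket_vectorField_eq ?_ ?_
    · filter_upwards [h] with z hz
      exact mpullbackWithin_chart_eq V x hz
    · filter_upwards [h] with z hz
      exact mpullbackWithin_chart_eq W x hz
  rw [← mlieBracketWithin_univ, mlieBracketWithin_apply, mfderiv_extChartAt_self, h0]
  exact congrArg (fun L : E →L[ℝ] E => L _) ContinuousLinearMap.inverse_id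

end ModelDerivative
/-! ### The adjoint representation -/

section LieGroup

variable {EK : Type*} [NormedAddCommGroup EK] [NormedSpace ℝ EK]
  {K : Type*} [TopologicalSpace K] [ChartedSpace EK K] [Group K] [LieGroup 𝓘(ℝ, EK) ∞ K]

lemma three_le_infty : (3 : ℕ∞ω) ≤ ∞ := ENat.LEInfty.out
-- This is the smoothness class under which `GroupLieAlgebra` carries its Lie algebra structure.
instance lieGroup_minSmoothness : LieGroup 𝓘(ℝ, EK) (minSmoothness ℝ 3) K := by
  rw [minSmoothness_of_isRCLikeNormedField]
  exact LieGroup.of_le (n := ∞) three_le_infty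

variable (EK) in
/-- The adjoint representation on the model space. -/
def AdE (g : K) : EK →L[ℝ] EK := Ad (EK := EK) g

omit [LieGroup 𝓘(ℝ, EK) ∞ K] in
lemma AdE_eq_mfd (g : K) : AdE EK g = mfd (fun x : K => g * x * g⁻¹) 1 := rfl

/-- Derivatives of a smooth family are smooth when read in tangent coordinates. Conjugation fixes
`1`, so source and target both stay over `1` and the coordinate changes are the identity. -/
lemma contMDiff_AdE : ContMDiff 𝓘(ℝ, EK) 𝓘(ℝ, EK →L[ℝ] EK) ∞ (fun g : K => AdE EK g) := by
  intro g₀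
  have h : ContMDiffAt (𝓘(ℝ, EK).prod 𝓘(ℝ, EK)) 𝓘(ℝ, EK) ∞
      (Function.uncurry fun (g : K) (x : K) => g * x * g⁻¹) (g₀, 1) := by
    apply ContMDiff.contMDiffAt
    exact (contMDiff_fst.mul contMDiff_snd).mul (contMDiff_fst.inv)
  have h2 := ContMDiffAt.mfderiv (fun (g : K) (x : K) => g * x * g⁻¹) (fun _ => 1) h
    (m := ∞) contMDiffAt_const (by simp)
  refine h2.congr_of_eventuallyEq (Filter.Eventually.of_forall fun g => ?_)
  have key : ∀ (a b : K) (_ : a = 1) (_ : b = 1) (v : EK),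
      (tangentBundleCore 𝓘(ℝ, EK) K).coordChange (achart EK a) (achart EK b) a v = v := by
    rintro a b rfl rfl v
    exact (tangentBundleCore 𝓘(ℝ, EK) K).coordChange_self _ _ (mem_chart_source EK (1 : K)) v
  refine Eq.trans ?_ (inTangentCoordinates_eq (f := fun _ : K => (1 : K))
    (g := fun x : K => x * 1 * x⁻¹) (ϕ := fun x : K => AdE EK x)
    (mem_chart_source EK (1 : K)) (by simp)).symm
  ext v
  refine Eq.symm ((key _ _ (by simp) (by simp) _).trans ?_)
  exact congrArg (AdE EK g) (key 1 1 rfl rfl v)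

lemma mdifferentiable_conj (g : K) :
    MDifferentiable 𝓘(ℝ, EK) 𝓘(ℝ, EK) (fun x : K => g * x * g⁻¹) := by
  have : ContMDiff 𝓘(ℝ, EK) 𝓘(ℝ, EK) ∞ (fun x : K => g * x * g⁻¹) :=
    (contMDiff_const.mul contMDiff_id).mul contMDiff_const
  exact this.mdifferentiable (by simp)

lemma AdE_one : AdE EK (1 : K) = ContinuousLinearMap.id ℝ EK := by
  rw [AdE_eq_mfd]
  simp only [one_mul, inv_one, mul_one]
  exact mfd_id (1 : K)

lemma AdE_mul (g h : K) : AdE EK (g * h) = (AdE EK g).comp (AdE EK h) := by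
  have h1 := mfd_comp (E := EK) (E' := EK) (E'' := EK) (g := fun x : K => g * x * g⁻¹) (f := fun x : K => h * x * h⁻¹) (1 : K)
    (mdifferentiable_conj g _) (mdifferentiable_conj h _)
  rw [AdE_eq_mfd, AdE_eq_mfd, AdE_eq_mfd]
  have e : h * 1 * h⁻¹ = 1 := by simp
  rw [e] at h1
  rw [← h1]
  congr 1
  ext x
  simp [mul_assoc]

lemma AdE_mul_apply (g h : K) (v : EK) : AdE EK (g * h) v = AdE EK g (AdE EK h v) := by
  rw [AdE_mul]; rfl

lemma AdE_inv_AdE (g : K) (v : EK) : AdE EK g⁻¹ (AdE EK g v) = v := by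
  rw [← AdE_mul_apply, inv_mul_cancel, AdE_one]; rfl

lemma AdE_AdE_inv (g : K) (v : EK) : AdE EK g (AdE EK g⁻¹ v) = v := by
  rw [← AdE_mul_apply, mul_inv_cancel, AdE_one]; rfl

/-! ### The group law in the chart at the identity, and the derivative of `Ad` -/

variable (EK K) in
/-- The multiplication of `K`, read in the preferred chart at `1`. -/
def chartMul (q : EK × EK) : EK :=
  extChartAt 𝓘(ℝ, EK) (1 : K)
    ((extChartAt 𝓘(ℝ, EK) (1 : K)).symm q.1 * (extChartAt 𝓘(ℝ, EK) (1 : K)).symm q.2)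

variable (EK K) in
/-- The coordinates of `1` in the preferred chart at `1`. -/
def chartOne : EK := extChartAt 𝓘(ℝ, EK) (1 : K) 1

omit [LieGroup 𝓘(ℝ, EK) ∞ K] in
lemma chart_symm_chartOne : (extChartAt 𝓘(ℝ, EK) (1 : K)).symm (chartOne EK K) = 1 :=
  extChartAt_to_inv _

lemma contDiffAt_chartMul : ContDiffAt ℝ ∞ (chartMul EK K) (chartOne EK K, chartOne EK K) := by
  rw [← contMDiffAt_iff_contDiffAt, modelWithCornersSelf_prod, ← chartedSpaceSelf_prod]
  have hs : ContMDiffAt 𝓘(ℝ, EK) 𝓘(ℝ, EK) ∞ (extChartAt 𝓘(ℝ, EK) (1 : K)).symm (chartOne EK K) :=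
    (contMDiffOn_extChartAt_symm (1 : K)).contMDiffAt (extChartAt_target_mem_nhds _)
  have h2 : ContMDiffAt 𝓘(ℝ, EK) 𝓘(ℝ, EK) ∞ (extChartAt 𝓘(ℝ, EK) (1 : K))
    ((extChartAt 𝓘(ℝ, EK) (1 : K)).symm (chartOne EK K) *
      (extChartAt 𝓘(ℝ, EK) (1 : K)).symm (chartOne EK K)) := by
    rw [chart_symm_chartOne, mul_one]
    exact contMDiffAt_extChartAt
  have h3 : ContMDiffAt (𝓘(ℝ, EK).prod 𝓘(ℝ, EK)) 𝓘(ℝ, EK) ∞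
      (fun q : EK × EK => (extChartAt 𝓘(ℝ, EK) (1 : K)).symm q.1 *
        (extChartAt 𝓘(ℝ, EK) (1 : K)).symm q.2) (chartOne EK K, chartOne EK K) :=
    ContMDiffAt.mul (ContMDiffAt.comp (chartOne EK K, chartOne EK K) hs contMDiffAt_fst)
      (ContMDiffAt.comp (chartOne EK K, chartOne EK K) hs contMDiffAt_snd)
  have h4 := h2.comp_of_eq (x := (chartOne EK K, chartOne EK K)) h3 rfl
  exact h4

lemma mdifferentiable_mul_left' (g : K) :
    MDifferentiable 𝓘(ℝ, EK) 𝓘(ℝ, EK) (fun x : K => g * x) :=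
  (contMDiff_mul_left (I := 𝓘(ℝ, EK)) (n := ∞)).mdifferentiable (by simp)

lemma mdifferentiable_mul_right' (g : K) :
    MDifferentiable 𝓘(ℝ, EK) 𝓘(ℝ, EK) (fun x : K => x * g) :=
  (contMDiff_mul_right (I := 𝓘(ℝ, EK)) (n := ∞)).mdifferentiable (by simp)

lemma mfd_chart_symm_chartOne (X : EK) :
    (mfd (extChartAt 𝓘(ℝ, EK) (1 : K)).symm (chartOne EK K) : EK →L[ℝ] EK) X = X := by
  have h := mfd_symm_comp_chart (1 : K) (mem_extChartAt_target (I := 𝓘(ℝ, EK)) (1 : K)) X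
  rw [extChartAt_to_inv, mfd_chart_self] at h
  exact h

/-- Differentiate `(g x g⁻¹) g = g x` at `x = 1`. This identity links `Ad` to the left-invariant
fields in `mfd_AdE`. -/
lemma mfd_mul_right_AdE (g : K) (Y : EK) :
    (mfd (fun x : K => x * g) 1 : EK →L[ℝ] EK) (AdE EK g Y)
      = (mfd (fun x : K => g * x) 1 : EK →L[ℝ] EK) Y := by
  have h := mfd_comp_apply (E := EK) (E' := EK) (E'' := EK) (g := fun x : K => x * g)
    (f := fun x : K => g * x * g⁻¹) 1
    (mdifferentiable_mul_right' g _) (mdifferentiable_conj g _) Y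
  have e : g * 1 * g⁻¹ = 1 := by simp
  rw [e] at h
  rw [AdE_eq_mfd, ← h]
  simp

/-- The right side is the left-invariant field of `Y` read in the chart, so that field becomes a
partial derivative of the multiplication. -/
lemma eventually_fderiv_chartMul_left (Y : EK) : ∀ᶠ x in 𝓝 (chartOne EK K),
    fderiv ℝ (chartMul EK K) (x, chartOne EK K) (0, Y) =
      (mfd (extChartAt 𝓘(ℝ, EK) (1 : K)) ((extChartAt 𝓘(ℝ, EK) (1 : K)).symm x) : EK →L[ℝ] EK)
        ((mfd (fun y : K => (extChartAt 𝓘(ℝ, EK) (1 : K)).symm x * y) 1 : EK →L[ℝ] EK) Y) := by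
  have h1 : ∀ᶠ x in 𝓝 (chartOne EK K),
      DifferentiableAt ℝ (chartMul EK K) (x, chartOne EK K) := by
    have h2 : Filter.Tendsto (fun x : EK => (x, chartOne EK K)) (𝓝 (chartOne EK K))
        (𝓝 (chartOne EK K, chartOne EK K)) := by
      apply Continuous.tendsto' <;> [fun_prop; rfl]
    refine h2.eventually ?_
    filter_upwards [((contDiffAt_chartMul (EK := EK) (K := K)).of_le
      (m := 1) ENat.LEInfty.out).eventually (by simp)] with q hq
    exact hq.differentiableAt (by simp)
  filter_upwards [h1, extChartAt_target_mem_nhds (I := 𝓘(ℝ, EK)) (1 : K)] with x hx hxt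
  have h3 : fderiv ℝ (chartMul EK K) (x, chartOne EK K) (0, Y) =
      fderiv ℝ (fun y => chartMul EK K (x, y)) (chartOne EK K) Y := by
    have := (hx.hasFDerivAt.comp (chartOne EK K)
      (hasFDerivAt_prodMk_right x (chartOne EK K))).fderiv
    exact (congrArg (fun L : EK →L[ℝ] EK => L Y) this).symm
  rw [h3, ← mfd_eq_fderiv]
  set g := (extChartAt 𝓘(ℝ, EK) (1 : K)).symm x with hg
  have hgs : g ∈ (extChartAt 𝓘(ℝ, EK) (1 : K)).source :=
    (extChartAt 𝓘(ℝ, EK) (1 : K)).map_target hxt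
  have hs := mdifferentiableAt_chart_symm (E := EK) (1 : K) (mem_extChartAt_target (1 : K))
  have h4 := mfd_comp_apply (E := EK) (E' := EK) (E'' := EK)
    (g := fun y : K => extChartAt 𝓘(ℝ, EK) (1 : K) (g * y))
    (f := (extChartAt 𝓘(ℝ, EK) (1 : K)).symm) (chartOne EK K)
    (by
      rw [chart_symm_chartOne]
      refine MDifferentiableAt.comp (1 : K) ?_ (mdifferentiable_mul_left' g _)
      rw [mul_one]
      exact mdifferentiableAt_chart (1 : K) hgs) hs Y
  rw [mfd_chart_symm_chartOne, chart_symm_chartOne] at h4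
  have h5 := mfd_comp_apply (E := EK) (E' := EK) (E'' := EK)
    (g := extChartAt 𝓘(ℝ, EK) (1 : K)) (f := fun y : K => g * y) (1 : K)
    (by rw [mul_one]; exact mdifferentiableAt_chart (1 : K) hgs) (mdifferentiable_mul_left' g _) Y
  rw [mul_one] at h5
  rw [← h5, ← h4]
  rfl

/-- The right-invariant counterpart. The vector is quantified inside the neighbourhood because it is
later taken to be `Ad_x Y`, which varies with `x`. -/
lemma eventually_fderiv_chartMul_right : ∀ᶠ x in 𝓝 (chartOne EK K), ∀ Y : EK,
    fderiv ℝ (chartMul EK K) (chartOne EK K, x) (Y, 0) =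
      (mfd (extChartAt 𝓘(ℝ, EK) (1 : K)) ((extChartAt 𝓘(ℝ, EK) (1 : K)).symm x) : EK →L[ℝ] EK)
        ((mfd (fun y : K => y * (extChartAt 𝓘(ℝ, EK) (1 : K)).symm x) 1 : EK →L[ℝ] EK) Y) := by
  have h1 : ∀ᶠ x in 𝓝 (chartOne EK K),
      DifferentiableAt ℝ (chartMul EK K) (chartOne EK K, x) := by
    have h2 : Filter.Tendsto (fun x : EK => (chartOne EK K, x)) (𝓝 (chartOne EK K))
        (𝓝 (chartOne EK K, chartOne EK K)) := by
      apply Continuous.tendsto' <;> [fun_prop; rfl]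
    refine h2.eventually ?_
    filter_upwards [((contDiffAt_chartMul (EK := EK) (K := K)).of_le
      (m := 1) ENat.LEInfty.out).eventually (by simp)] with q hq
    exact hq.differentiableAt (by simp)
  filter_upwards [h1, extChartAt_target_mem_nhds (I := 𝓘(ℝ, EK)) (1 : K)] with x hx hxt Y
  have h3 : fderiv ℝ (chartMul EK K) (chartOne EK K, x) (Y, 0) =
      fderiv ℝ (fun y => chartMul EK K (y, x)) (chartOne EK K) Y := by
    have := (hx.hasFDerivAt.comp (chartOne EK K)
      (hasFDerivAt_prodMk_left (𝕜 := ℝ) (chartOne EK K) x)).fderiv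
    exact (congrArg (fun L : EK →L[ℝ] EK => L Y) this).symm
  rw [h3, ← mfd_eq_fderiv]
  set g := (extChartAt 𝓘(ℝ, EK) (1 : K)).symm x with hg
  have hgs : g ∈ (extChartAt 𝓘(ℝ, EK) (1 : K)).source :=
    (extChartAt 𝓘(ℝ, EK) (1 : K)).map_target hxt
  have hs := mdifferentiableAt_chart_symm (E := EK) (1 : K) (mem_extChartAt_target (1 : K))
  have h4 := mfd_comp_apply (E := EK) (E' := EK) (E'' := EK)
    (g := fun y : K => extChartAt 𝓘(ℝ, EK) (1 : K) (y * g))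
    (f := (extChartAt 𝓘(ℝ, EK) (1 : K)).symm) (chartOne EK K)
    (by
      rw [chart_symm_chartOne]
      refine MDifferentiableAt.comp (1 : K) ?_ (mdifferentiable_mul_right' g _)
      rw [one_mul]
      exact mdifferentiableAt_chart (1 : K) hgs) hs Y
  rw [mfd_chart_symm_chartOne, chart_symm_chartOne] at h4
  have h5 := mfd_comp_apply (E := EK) (E' := EK) (E'' := EK)
    (g := extChartAt 𝓘(ℝ, EK) (1 : K)) (f := fun y : K => y * g) (1 : K)
    (by rw [one_mul]; exact mdifferentiableAt_chart (1 : K) hgs) (mdifferentiable_mul_right' g _) Y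
  rw [one_mul] at h5
  rw [← h5, ← h4]
  rfl

variable (K) in
/-- The Lie bracket of `K` on the model space. -/
def br (X Y : EK) : EK :=
  Bracket.bracket (L := GroupLieAlgebra 𝓘(ℝ, EK) K) (M := GroupLieAlgebra 𝓘(ℝ, EK) K) X Y

/-- The derivative of the adjoint representation is the Lie bracket. -/
lemma mfd_AdE (X Y : EK) : (mfd (fun g : K => AdE EK g Y) 1 : EK →L[ℝ] EK) X = br K X Y := by
  set e := chartOne EK K with he
  set m := chartMul EK K
  set D := fderiv ℝ (fderiv ℝ m) (e, e) with hD
  have hm : ContDiffAt ℝ ∞ m (e, e) := contDiffAt_chartMul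
  have hdm : HasFDerivAt (fderiv ℝ m) D (e, e) :=
    ((hm.fderiv_right (m := 1) (by norm_cast)).differentiableAt (by simp)).hasFDerivAt
  have hsymm : ∀ v w, D v w = D w v := fun v w =>
    (hm.isSymmSndFDerivAt (by simpa using ENat.LEInfty.out)) v w
  have hleft : ∀ Y : EK, HasFDerivAt (fun x => fderiv ℝ m (x, e) (0, Y))
      ((D.flip (0, Y)).comp (ContinuousLinearMap.inl ℝ EK EK)) e := fun Y => by
    have h := HasFDerivAt.comp (f := fun x => (x, e)) e hdm (hasFDerivAt_prodMk_left e e)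
    have h2 := (ContinuousLinearMap.apply ℝ EK ((0, Y) : EK × EK)).hasFDerivAt.comp e h
    exact h2
  have hinv : ∀ Y : EK, chartField (mulInvariantVectorField (I := 𝓘(ℝ, EK)) (G := K) Y) 1
      =ᶠ[𝓝 e] fun x => fderiv ℝ m (x, e) (0, Y) := fun Y => by
    filter_upwards [eventually_fderiv_chartMul_left (K := K) Y] with x hx
    exact hx.symm
  -- The left-invariant field of `Y` is `x ↦ ∂₂m(x, e)Y`, with value `Y` at `e` and derivative `X ↦
  -- D (X, 0) (0, Y)`. The bracket in the chart is thus a difference of mixed second derivatives.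
  have hbr : br K X Y = D (X, 0) (0, Y) - D (Y, 0) (0, X) := by
    have h := mlieBracket_eq_chart (mulInvariantVectorField (I := 𝓘(ℝ, EK)) (G := K) X)
      (mulInvariantVectorField (I := 𝓘(ℝ, EK)) (G := K) Y) 1
    refine Eq.trans h ?_
    have hval : ∀ Y : EK,
        chartField (mulInvariantVectorField (I := 𝓘(ℝ, EK)) (G := K) Y) 1 e = Y := fun Y => by
      refine (chartField_self _ _).trans ?_
      change (mfd (fun y : K => 1 * y) 1 : EK →L[ℝ] EK) Y = Y
      simp only [one_mul]
      rw [mfd_id]; rfl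
    have hd : ∀ Y : EK, fderiv ℝ
        (chartField (mulInvariantVectorField (I := 𝓘(ℝ, EK)) (G := K) Y) 1) e =
        ((D.flip (0, Y)).comp (ContinuousLinearMap.inl ℝ EK EK)) := fun Y => by
      rw [(hinv Y).fderiv_eq, (hleft Y).fderiv]
    change fderiv ℝ _ e (chartField _ _ e) - fderiv ℝ _ e (chartField _ _ e) = _
    rw [hd, hd, hval, hval]
    rfl
  have hAd : HasFDerivAt (fun x => AdE EK ((extChartAt 𝓘(ℝ, EK) (1 : K)).symm x) Y)
      (mfd (fun g : K => AdE EK g Y) 1 : EK →L[ℝ] EK) e := by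
    have hs := mdifferentiableAt_chart_symm (E := EK) (1 : K) (mem_extChartAt_target (1 : K))
    have hg : MDifferentiable 𝓘(ℝ, EK) 𝓘(ℝ, EK) (fun g : K => AdE EK g Y) :=
      ((contMDiff_AdE (EK := EK) (K := K)).clm_apply contMDiff_const).mdifferentiable (by simp)
    have h2 := (hg _).comp _ hs
    have h3 : HasFDerivAt (fun x => AdE EK ((extChartAt 𝓘(ℝ, EK) (1 : K)).symm x) Y)
      (fderiv ℝ (fun x => AdE EK ((extChartAt 𝓘(ℝ, EK) (1 : K)).symm x) Y) e) e :=
      h2.differentiableAt.hasFDerivAt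
    convert h3 using 1
    rw [← mfd_eq_fderiv]
    ext X
    refine Eq.trans ?_ (mfd_comp_apply (g := fun g : K => AdE EK g Y) _ (hg _) hs X).symm
    have h4 := mfd_chart_symm_chartOne (K := K) X
    rw [chartOne] at h4
    rw [h4, extChartAt_to_inv]
  have hid : ∀ Z : EK, fderiv ℝ m (e, e) (Z, 0) = Z := fun Z => by
    have := (eventually_fderiv_chartMul_right (EK := EK) (K := K)).self_of_nhds Z
    rw [chart_symm_chartOne, mfd_chart_self] at this
    refine this.trans ?_
    simp only [mul_one]
    rw [mfd_id]; rfl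
  have hright : HasFDerivAt (fun x => fderiv ℝ m (e, x)
      (AdE EK ((extChartAt 𝓘(ℝ, EK) (1 : K)).symm x) Y, (0 : EK)))
      _ e := (HasFDerivAt.comp (f := fun x => (e, x)) e hdm
        (hasFDerivAt_prodMk_right e e)).clm_apply (hAd.prodMk (hasFDerivAt_const 0 e))
  -- The identity `∂₁m(e, x)(Ad_x Y) = ∂₂m(x, e)Y` is differentiated at `e` in the direction `X`. As
  -- `∂₁m(e, e) = id`, it yields `dAd(X)Y + D (0, X) (Y, 0) = D (X, 0) (0, Y)`, and symmetry of `D`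
  -- finishes.
  have hrl : (fun x => fderiv ℝ m (e, x)
      (AdE EK ((extChartAt 𝓘(ℝ, EK) (1 : K)).symm x) Y, (0 : EK))) =ᶠ[𝓝 e]
      fun x => fderiv ℝ m (x, e) (0, Y) := by
    filter_upwards [eventually_fderiv_chartMul_right (EK := EK) (K := K),
      eventually_fderiv_chartMul_left (K := K) Y] with x h1 h2
    rw [h1, h2, mfd_mul_right_AdE]
  have h5 := congrArg (fun L : EK →L[ℝ] EK => L X)
    (hright.unique ((hleft Y).congr_of_eventuallyEq hrl))
  have h6 : (chartAt EK (1 : K)).symm e = 1 := chart_symm_chartOne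
  simp [hid] at h5
  rw [h6, AdE_one, hsymm (0, X), ContinuousLinearMap.id_apply] at h5
  rw [hbr, ← h5, add_sub_cancel_right]

lemma contMDiff_AdE_inv : ContMDiff 𝓘(ℝ, EK) 𝓘(ℝ, EK →L[ℝ] EK) ∞
    (fun g : K => AdE EK g⁻¹) :=
  contMDiff_AdE.comp (contMDiff_inv 𝓘(ℝ, EK) ∞)

/-- Differentiating `Ad_g Ad_{g⁻¹} Y = Y` at `1` gives the sign without computing the derivative of
inversion. -/
lemma mfd_AdE_inv (X Y : EK) :
    (mfd (fun g : K => AdE EK g⁻¹ Y) 1 : EK →L[ℝ] EK) X = - br K X Y := by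
  have h : ContMDiff (𝓘(ℝ, EK).prod 𝓘(ℝ, EK)) 𝓘(ℝ, EK) ∞
      (fun q : K × K => AdE EK q.1 (AdE EK q.2⁻¹ Y)) :=
    (contMDiff_AdE.comp contMDiff_fst).clm_apply
      ((contMDiff_AdE_inv.comp contMDiff_snd).clm_apply contMDiff_const)
  have h2 := mfd_comp₂ (f := fun g h : K => AdE EK g (AdE EK h⁻¹ Y)) (g := fun g : K => g)
    (h := fun g : K => g) (1 : K) (h.mdifferentiable (by simp) _) mdifferentiableAt_id
    mdifferentiableAt_id X
  simp only [AdE_AdE_inv, mfd_const, mfd_id, inv_one, AdE_one] at h2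
  have h3 := mfd_AdE (K := K) X Y
  simp at h2
  rw [h3] at h2
  exact (neg_eq_of_add_eq_zero_right h2.symm).symm

variable [FiniteDimensional ℝ EK]

lemma br_skew (X Y : EK) : br K X Y = - br K Y X :=
  haveI : CompleteSpace EK := FiniteDimensional.complete ℝ EK
  (lie_skew (L := GroupLieAlgebra 𝓘(ℝ, EK) K) X Y).symm

lemma br_add_left (X Y Z : EK) : br K (X + Y) Z = br K X Z + br K Y Z :=
  haveI : CompleteSpace EK := FiniteDimensional.complete ℝ EK
  add_lie (L := GroupLieAlgebra 𝓘(ℝ, EK) K)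
    (M := GroupLieAlgebra 𝓘(ℝ, EK) K) X Y Z

lemma br_add_right (X Y Z : EK) : br K X (Y + Z) = br K X Y + br K X Z :=
  haveI : CompleteSpace EK := FiniteDimensional.complete ℝ EK
  lie_add (L := GroupLieAlgebra 𝓘(ℝ, EK) K)
    (M := GroupLieAlgebra 𝓘(ℝ, EK) K) X Y Z

lemma br_smul_left (c : ℝ) (X Y : EK) : br K (c • X) Y = c • br K X Y :=
  haveI : CompleteSpace EK := FiniteDimensional.complete ℝ EK
  smul_lie (L := GroupLieAlgebra 𝓘(ℝ, EK) K)
    (M := GroupLieAlgebra 𝓘(ℝ, EK) K) c X Y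

lemma br_smul_right (c : ℝ) (X Y : EK) : br K X (c • Y) = c • br K X Y :=
  haveI : CompleteSpace EK := FiniteDimensional.complete ℝ EK
  lie_smul (L := GroupLieAlgebra 𝓘(ℝ, EK) K)
    (M := GroupLieAlgebra 𝓘(ℝ, EK) K) c X Y

variable (EK K) in
/-- The Lie bracket as a continuous bilinear map on the model space. -/
def brL : EK →L[ℝ] EK →L[ℝ] EK :=
  (LinearMap.mk₂ ℝ (br (EK := EK) K) br_add_left br_smul_left br_add_right
    br_smul_right).toContinuousBilinearMap

@[simp] lemma brL_apply (X Y : EK) : brL EK K X Y = br K X Y := rfl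

variable (K) in
/-- A bilinear form on the Lie algebra as a continuous bilinear map on the model space. -/
def formE (B : LinearMap.BilinForm ℝ (GroupLieAlgebra 𝓘(ℝ, EK) K)) : EK →L[ℝ] EK →L[ℝ] ℝ :=
  LinearMap.toContinuousBilinearMap (𝕜 := ℝ) (E := EK) (F := EK) (G := ℝ) B

namespace IsAdInvariantInner

variable {B : LinearMap.BilinForm ℝ (GroupLieAlgebra 𝓘(ℝ, EK) K)} (hB : IsAdInvariantInner B)
include hB

lemma formE_symm (X Y : EK) : formE K B X Y = formE K B Y X := hB.symm X Y

lemma formE_pos {X : EK} (hX : X ≠ 0) : 0 < formE K B X X := hB.pos X hX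

lemma formE_AdE (g : K) (X Y : EK) : formE K B (AdE EK g X) (AdE EK g Y) = formE K B X Y :=
  hB.invariant g X Y

/-- Infinitesimal invariance: `ad X` is skew. -/
lemma formE_br (X Y Z : EK) : formE K B (br K X Y) Z = - formE K B Y (br K X Z) := by
  have hg : ∀ Y : EK, ContMDiff 𝓘(ℝ, EK) 𝓘(ℝ, EK) ∞ (fun g : K => AdE EK g Y) := fun Y =>
    contMDiff_AdE.clm_apply contMDiff_const
  have h : ContMDiff (𝓘(ℝ, EK).prod 𝓘(ℝ, EK)) 𝓘(ℝ, ℝ) ∞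
      (fun q : K × K => formE K B (AdE EK q.1 Y) (AdE EK q.2 Z)) :=
    ((contMDiff_const (c := formE K B)).clm_apply ((hg Y).comp contMDiff_fst)).clm_apply
      ((hg Z).comp contMDiff_snd)
  have h2 := mfd_comp₂ (E := EK) (E' := EK) (E'' := ℝ)
    (f := fun g h : K => formE K B (AdE EK g Y) (AdE EK h Z)) (g := fun g : K => g)
    (h := fun g : K => g) (1 : K) (h.mdifferentiable (by simp) _) mdifferentiableAt_id
    mdifferentiableAt_id X
  -- By invariance `B(Ad_g Y, Ad_g Z)` does not depend on `g`, so the two partial derivatives at `1`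
  -- add up to zero.
  simp only [hB.formE_AdE, mfd_const, mfd_id, AdE_one] at h2
  have hd : ∀ Y, MDifferentiableAt 𝓘(ℝ, EK) 𝓘(ℝ, EK) (fun g : K => AdE EK g Y) 1 := fun Y =>
    (hg Y).mdifferentiable (by simp) _
  have hlin : ∀ (L : EK →L[ℝ] ℝ) (Y : EK),
      (mfd (fun g : K => L (AdE EK g Y)) 1 : EK →L[ℝ] ℝ) X = L (br K X Y) := fun L Y => by
    rw [← mfd_AdE, mfd_comp_apply (E := EK) (E' := EK) (E'' := ℝ) (g := L) 1
      L.differentiableAt.mdifferentiableAt (hd Y), mfd_eq_fderiv, L.fderiv]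
  have e1 := hlin ((formE K B).flip Z) Y
  have e2 := hlin (formE K B Y) Z
  simp only [ContinuousLinearMap.flip_apply] at e1
  simp only [ContinuousLinearMap.id_apply, zero_apply] at h2
  rw [e1, e2] at h2
  linarith

end IsAdInvariantInner
end LieGroup

/-! ### One-parameter subgroups and tori of dimension one -/

section Torus

variable {EK : Type*} [NormedAddCommGroup EK] [NormedSpace ℝ EK]
  {K : Type*} [TopologicalSpace K] [ChartedSpace EK K] [Group K] [LieGroup 𝓘(ℝ, EK) ∞ K]

lemma mdifferentiable_AdE (Y : EK) : MDifferentiable 𝓘(ℝ, EK) 𝓘(ℝ, EK)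
    (fun g : K => AdE EK g Y) :=
  ((contMDiff_AdE (EK := EK) (K := K)).clm_apply contMDiff_const).mdifferentiable (by simp)

/-- `Ad g` is a homomorphism of Lie algebras. -/
lemma AdE_br (g : K) (X Y : EK) : AdE EK g (br K X Y) = br K (AdE EK g X) (AdE EK g Y) := by
  have h1 := mfd_comp_apply (E := EK) (E' := EK) (E'' := EK) (g := fun h : K => AdE EK h (AdE EK g Y))
    (f := fun h : K => g * h * g⁻¹) 1 (mdifferentiable_AdE _ _) (mdifferentiable_conj g _) X
  have h2 := mfd_comp_apply (E := EK) (E' := EK) (E'' := EK) (g := AdE EK g)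
    (f := fun h : K => AdE EK h Y) 1 (AdE EK g).differentiableAt.mdifferentiableAt
    (mdifferentiable_AdE _ _) X
  have e : g * 1 * g⁻¹ = 1 := by simp
  rw [mfd_eq_fderiv, ContinuousLinearMap.fderiv, mfd_AdE] at h2
  rw [e, mfd_AdE, ← AdE_eq_mfd] at h1
  rw [← h2, ← h1]
  congr 2
  ext h
  rw [AdE_mul_apply, AdE_mul_apply, AdE_inv_AdE]

lemma mfd_mul_left_mulInvariant (g h : K) (Y : EK) :
    (mfd (fun x : K => g * x) h : EK →L[ℝ] EK) ((mfd (fun x : K => h * x) 1 : EK →L[ℝ] EK) Y) =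
      (mfd (fun x : K => g * h * x) 1 : EK →L[ℝ] EK) Y := by
  have h1 := mfd_comp_apply (E := EK) (E' := EK) (E'' := EK) (g := fun x : K => g * x)
    (f := fun x : K => h * x) 1 (mdifferentiable_mul_left' g _) (mdifferentiable_mul_left' h _) Y
  rw [mul_one] at h1
  rw [← h1]
  simp only [mul_assoc]

/-- Since `g (h x) g⁻¹ = (g h g⁻¹)(g x g⁻¹)`, conjugation carries the left-invariant field of `Y` to
that of `Ad_g Y`. -/
lemma mfd_conj_mulInvariant (g h : K) (Y : EK) :
    (mfd (fun x : K => g * x * g⁻¹) h : EK →L[ℝ] EK)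
      ((mfd (fun x : K => h * x) 1 : EK →L[ℝ] EK) Y) =
      (mfd (fun x : K => g * h * g⁻¹ * x) 1 : EK →L[ℝ] EK) (AdE EK g Y) := by
  have h1 := mfd_comp_apply (E := EK) (E' := EK) (E'' := EK) (g := fun x : K => g * x * g⁻¹)
    (f := fun x : K => h * x) 1 (mdifferentiable_conj g _) (mdifferentiable_mul_left' h _) Y
  have h2 := mfd_comp_apply (E := EK) (E' := EK) (E'' := EK) (g := fun x : K => g * h * g⁻¹ * x)
    (f := fun x : K => g * x * g⁻¹) 1 (mdifferentiable_mul_left' _ _) (mdifferentiable_conj g _) Y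
  have e : g * 1 * g⁻¹ = 1 := by simp
  rw [mul_one] at h1
  rw [e, ← AdE_eq_mfd] at h2
  rw [← h1, ← h2]
  congr 2
  ext x
  group

/-- The curve `γ` is an integral curve of the left-invariant vector field of `Y`. -/
abbrev IsInvariantCurve (γ : ℝ → K) (Y : EK) : Prop :=
  IsMIntegralCurve γ (mulInvariantVectorField (I := 𝓘(ℝ, EK)) (G := K) Y)

lemma contMDiff_one_mulInvariant (Y : EK) :
    ContMDiff 𝓘(ℝ, EK) 𝓘(ℝ, EK).tangent 1
      (fun g : K => (mulInvariantVectorField (I := 𝓘(ℝ, EK)) Y g : TangentBundle 𝓘(ℝ, EK) K)) := by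
  refine (contMDiff_mulInvariantVectorField (I := 𝓘(ℝ, EK)) (G := K) Y).of_le ?_
  rw [minSmoothness_of_isRCLikeNormedField]
  exact one_le_two

/-- The chain rule for maps relating two left-invariant fields. It is stated within a set so that it
serves local as well as global integral curves. -/
lemma hasMFDerivAt_comp_invariantCurve {γ : ℝ → K} {Y : EK} {Z : EK} {F : K → K} {s : Set ℝ} {t : ℝ}
    (hγ : HasMFDerivWithinAt 𝓘(ℝ, ℝ) 𝓘(ℝ, EK) γ s t
      ((1 : ℝ →L[ℝ] ℝ).smulRight (mulInvariantVectorField (I := 𝓘(ℝ, EK)) (G := K) Y (γ t))))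
    (hF : MDifferentiableAt 𝓘(ℝ, EK) 𝓘(ℝ, EK) F (γ t))
    (h : (mfd F (γ t) : EK →L[ℝ] EK) ((mfd (fun x : K => γ t * x) 1 : EK →L[ℝ] EK) Y)
      = (mfd (fun x : K => F (γ t) * x) 1 : EK →L[ℝ] EK) Z) :
    HasMFDerivWithinAt 𝓘(ℝ, ℝ) 𝓘(ℝ, EK) (fun s => F (γ s)) s t
      ((1 : ℝ →L[ℝ] ℝ).smulRight (mulInvariantVectorField (I := 𝓘(ℝ, EK)) (G := K) Z (F (γ t)))) := by
  have h1 := hF.hasMFDerivAt.comp_hasMFDerivWithinAt t hγ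
  have e : (mfd F (γ t) : EK →L[ℝ] EK).comp ((1 : ℝ →L[ℝ] ℝ).smulRight
      ((mfd (fun x : K => γ t * x) 1 : EK →L[ℝ] EK) Y)) =
      (1 : ℝ →L[ℝ] ℝ).smulRight ((mfd (fun x : K => F (γ t) * x) 1 : EK →L[ℝ] EK) Z) := by
    ext
    simp [h]
  have key : ∀ L L' : ℝ →L[ℝ] EK, HasMFDerivWithinAt 𝓘(ℝ, ℝ) 𝓘(ℝ, EK) (fun s => F (γ s)) s t L →
      L = L' → HasMFDerivWithinAt 𝓘(ℝ, ℝ) 𝓘(ℝ, EK) (fun s => F (γ s)) s t L' := by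
    rintro L _ h rfl
    exact h
  exact key _ _ h1 e

lemma IsInvariantCurve.mul_left_on {γ : ℝ → K} {Y : EK} {s : Set ℝ}
    (hγ : IsMIntegralCurveOn γ (mulInvariantVectorField (I := 𝓘(ℝ, EK)) (G := K) Y) s) (g : K) :
    IsMIntegralCurveOn (fun t => g * γ t)
      (mulInvariantVectorField (I := 𝓘(ℝ, EK)) (G := K) Y) s := fun t ht =>
  hasMFDerivAt_comp_invariantCurve (F := fun x : K => g * x) (hγ t ht)
    (mdifferentiable_mul_left' g _) (mfd_mul_left_mulInvariant g (γ t) Y)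

lemma IsInvariantCurve.mul_left {γ : ℝ → K} {Y : EK} (hγ : IsInvariantCurve γ Y) (g : K) :
    IsInvariantCurve (fun t => g * γ t) Y := by
  rw [IsInvariantCurve, isMIntegralCurve_iff_isMIntegralCurveOn] at hγ ⊢
  exact IsInvariantCurve.mul_left_on hγ g

lemma IsInvariantCurve.conj {γ : ℝ → K} {Y : EK} (hγ : IsInvariantCurve γ Y) (g : K) :
    IsInvariantCurve (fun t => g * γ t * g⁻¹) (AdE EK g Y) := by
  rw [IsInvariantCurve, isMIntegralCurve_iff_isMIntegralCurveOn] at hγ ⊢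
  exact fun t ht => hasMFDerivAt_comp_invariantCurve (F := fun x : K => g * x * g⁻¹) (hγ t ht)
    (mdifferentiable_conj g _) (mfd_conj_mulInvariant g (γ t) Y)

variable [T2Space K]

lemma IsInvariantCurve.eq {γ γ' : ℝ → K} {Y : EK} (hγ : IsInvariantCurve γ Y)
    (hγ' : IsInvariantCurve γ' Y) (h : γ 0 = γ' 0) : γ = γ' :=
  isMIntegralCurve_Ioo_eq_of_contMDiff_boundaryless (contMDiff_one_mulInvariant Y) hγ hγ' h

variable [FiniteDimensional ℝ EK]

variable (K) in
-- Left translates of one local integral curve through `1` are integral curves through every point,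
-- all defined for the same time `ε`. A uniform existence time makes the field complete.
lemma exists_isInvariantCurve (Y : EK) : ∃ γ : ℝ → K, γ 0 = 1 ∧ IsInvariantCurve γ Y := by
  have : CompleteSpace EK := FiniteDimensional.complete ℝ EK
  obtain ⟨γ, h0, hγ⟩ := exists_isMIntegralCurveAt_of_contMDiffAt_boundaryless (I := 𝓘(ℝ, EK))
    (t₀ := 0) (x₀ := (1 : K)) ((contMDiff_one_mulInvariant (K := K) Y) 1)
  obtain ⟨ε, hε, hγ⟩ := isMIntegralCurveAt_iff'.mp hγ
  refine exists_isMIntegralCurve_of_isMIntegralCurveOn (contMDiff_one_mulInvariant (K := K) Y) hε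
    (fun x => ⟨fun t => x * γ t, by simp [h0], ?_⟩) 1
  rw [Real.ball_eq_Ioo, zero_sub, zero_add] at hγ
  exact IsInvariantCurve.mul_left_on hγ x

/-- The time shift of `γ` by `s` and its left translate by `γ s` solve the same equation and agree
at `0`. -/
lemma IsInvariantCurve.map_add {γ : ℝ → K} {Y : EK} (hγ : IsInvariantCurve γ Y) (h0 : γ 0 = 1)
    (s t : ℝ) : γ (s + t) = γ s * γ t := by
  have h1 : IsInvariantCurve (γ ∘ (· + s)) Y := hγ.comp_add s
  have h := IsInvariantCurve.eq h1 (IsInvariantCurve.mul_left hγ (γ s)) (by simp [h0])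
  have := congrFun h t
  simpa [add_comm] using this

/-- The conjugate curve is an integral curve for `Ad_g Y = Y` through `1`, hence is `γ` itself. -/
lemma IsInvariantCurve.commute {γ : ℝ → K} {Y : EK} (hγ : IsInvariantCurve γ Y) (h0 : γ 0 = 1)
    {g : K} (hg : AdE EK g Y = Y) (t : ℝ) : g * γ t = γ t * g := by
  have h1 := IsInvariantCurve.conj hγ g
  rw [hg] at h1
  have := congrFun (IsInvariantCurve.eq h1 hγ (by simp [h0])) t
  exact mul_inv_eq_iff_eq_mul.mp this

/-- The velocity at `0` of a curve through `1`, read in the preferred chart. -/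
lemma hasDerivAt_chart_comp {τ : ℝ → K} (h0 : τ 0 = 1)
    (hτ : MDifferentiableAt 𝓘(ℝ, ℝ) 𝓘(ℝ, EK) τ 0) :
    HasDerivAt (fun t => extChartAt 𝓘(ℝ, EK) (1 : K) (τ t)) ((mfd τ 0 : ℝ →L[ℝ] EK) 1) 0 := by
  have hc : MDifferentiableAt 𝓘(ℝ, EK) 𝓘(ℝ, EK) (extChartAt 𝓘(ℝ, EK) (1 : K)) (τ 0) := by
    rw [h0]; exact mdifferentiableAt_chart (1 : K) (mem_extChartAt_source _)
  have h1 : DifferentiableAt ℝ (fun t => extChartAt 𝓘(ℝ, EK) (1 : K) (τ t)) 0 :=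
    (hc.comp (0 : ℝ) hτ).differentiableAt
  have h2 := mfd_comp_apply (E := ℝ) (E' := EK) (E'' := EK) (g := extChartAt 𝓘(ℝ, EK) (1 : K))
    (f := τ) (0 : ℝ) hc hτ 1
  rw [h0, mfd_chart_self, mfd_eq_fderiv] at h2
  have h3 := h1.hasFDerivAt.hasDerivAt
  rw [h2] at h3
  exact h3

lemma IsInvariantCurve.mfd_zero {γ : ℝ → K} {Y : EK} (hγ : IsInvariantCurve γ Y) (h0 : γ 0 = 1) :
    (mfd γ 0 : ℝ →L[ℝ] EK) 1 = Y := by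
  have h : (mfd γ 0 : ℝ →L[ℝ] EK) =
      (1 : ℝ →L[ℝ] ℝ).smulRight ((mfd (fun x : K => γ 0 * x) 1 : EK →L[ℝ] EK) Y) :=
    (hγ 0).mfderiv
  rw [h, h0]
  simp [mfd_id]

/-- A differentiable one-parameter subgroup is an integral curve of a left-invariant field. -/
lemma isInvariantCurve_of_map_add {τ : ℝ → K} (h0 : τ 0 = 1)
    (hadd : ∀ s t, τ (s + t) = τ s * τ t) (hτ : MDifferentiable 𝓘(ℝ, ℝ) 𝓘(ℝ, EK) τ) :
    IsInvariantCurve τ ((mfd τ 0 : ℝ →L[ℝ] EK) 1) := by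
  intro t
  have hs : MDifferentiableAt 𝓘(ℝ, ℝ) 𝓘(ℝ, ℝ) (fun s : ℝ => s - t) t :=
    (differentiableAt_id.sub_const t).mdifferentiableAt
  -- Writing `τ s = τ t * τ (s - t)` makes the derivative at `t` the left translate of the
  -- derivative at `0`.
  have h1 := mfd_comp (E := ℝ) (E' := ℝ) (E'' := EK) (g := fun s => τ t * τ s)
    (f := fun s : ℝ => s - t) t
    ((mdifferentiable_mul_left' (τ t) _).comp _ (hτ _)) hs
  have h2 := mfd_comp (E := ℝ) (E' := EK) (E'' := EK) (g := fun x => τ t * x)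
    (f := τ) 0 (mdifferentiable_mul_left' (τ t) _) (hτ _)
  have e : (fun s => τ t * τ (s - t)) = τ := by
    ext s; rw [← hadd]; congr 1; ring
  have e3 : fderiv ℝ (fun s : ℝ => s - t) t = ContinuousLinearMap.id ℝ ℝ := by
    rw [fderiv_sub_const, fderiv_fun_id]
  rw [sub_self, e, mfd_eq_fderiv, h2, e3, h0] at h1
  have h4 := (hτ t).hasMFDerivAt
  have e5 : (mfd τ t : ℝ →L[ℝ] EK) = (1 : ℝ →L[ℝ] ℝ).smulRight
      ((mfd (fun x : K => τ t * x) 1 : EK →L[ℝ] EK) ((mfd τ 0 : ℝ →L[ℝ] EK) 1)) := by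
    rw [h1]; ext; simp
  have h6 : HasMFDerivAt 𝓘(ℝ, ℝ) 𝓘(ℝ, EK) τ t (mfd τ t : ℝ →L[ℝ] EK) := h4
  rw [e5] at h6
  exact h6

/-- If the velocity of a one-parameter subgroup commutes with `Y`, so does the subgroup. -/
lemma AdE_eq_of_br_eq_zero {τ : ℝ → K} (h0 : τ 0 = 1)
    (hadd : ∀ s t, τ (s + t) = τ s * τ t) (hτ : MDifferentiable 𝓘(ℝ, ℝ) 𝓘(ℝ, EK) τ) {Y : EK}
    (hY : br K ((mfd τ 0 : ℝ →L[ℝ] EK) 1) Y = 0) (t : ℝ) : AdE EK (τ t) Y = Y := by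
  have hd : MDifferentiable 𝓘(ℝ, ℝ) 𝓘(ℝ, EK) (fun t => AdE EK (τ t) Y) :=
    (mdifferentiable_AdE Y).comp hτ
  have hd' : Differentiable ℝ (fun t => AdE EK (τ t) Y) := fun t => (hd t).differentiableAt
  have hz : fderiv ℝ (fun t => AdE EK (τ t) Y) 0 = 0 := by
    rw [← mfd_eq_fderiv]
    ext
    rw [mfd_comp_apply (E := ℝ) (E' := EK) (E'' := EK) (g := fun g : K => AdE EK g Y) (f := τ)
      0 (mdifferentiable_AdE Y _) (hτ 0), h0, mfd_AdE, hY]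
    rfl
  -- The group law moves the vanishing of the derivative from `0` to every `t`: `Ad_{τ s} Y = Ad_{τ
  -- t} Ad_{τ (s - t)} Y`.
  have h2 : ∀ t, fderiv ℝ (fun t => AdE EK (τ t) Y) t = 0 := fun t => by
    have e : (fun s => AdE EK (τ s) Y) = fun s => AdE EK (τ t) (AdE EK (τ (s - t)) Y) := by
      ext s; rw [← AdE_mul_apply, ← hadd, add_sub_cancel]
    have h3 : HasFDerivAt (fun s => AdE EK (τ (s - t)) Y) (0 : ℝ →L[ℝ] EK) t := by
      have := (hd' 0).hasFDerivAt
      rw [hz] at this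
      exact (hasFDerivAt_comp_sub (f := fun s => AdE EK (τ s) Y) t).mpr (by rwa [sub_self])
    rw [e]
    have := ((AdE EK (τ t)).hasFDerivAt.comp t h3).fderiv
    rw [ContinuousLinearMap.comp_zero] at this
    exact this
  have := is_const_of_fderiv_eq_zero hd' h2 t 0
  simpa [h0, AdE_one] using this

/-- In a maximal torus of dimension one, every one-parameter subgroup commuting with the torus
has velocity proportional to that of the torus. -/
lemma mem_span_of_br_eq_zero [CompactSpace K] {T : Subgroup K} (hT : IsMaximalTorus T) {τ : ℝ → K}
    (h0 : τ 0 = 1) (hadd : ∀ s t, τ (s + t) = τ s * τ t)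
    (hτ : MDifferentiable 𝓘(ℝ, ℝ) 𝓘(ℝ, EK) τ) (hrange : range τ = (T : Set K))
    (hker : ∀ t, τ t = 1 ↔ ∃ m : ℤ, t = m) (hH : (mfd τ 0 : ℝ →L[ℝ] EK) 1 ≠ 0) {Y : EK}
    (hY : br K ((mfd τ 0 : ℝ →L[ℝ] EK) 1) Y = 0) :
    Y ∈ Submodule.span ℝ {(mfd τ 0 : ℝ →L[ℝ] EK) 1} := by
  have : IsTopologicalGroup K := topologicalGroup_of_lieGroup 𝓘(ℝ, EK) ∞
  obtain ⟨γ, hγ0, hγ⟩ := exists_isInvariantCurve K Y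
  have hγadd := IsInvariantCurve.map_add hγ hγ0
  have hcomm : ∀ s t, τ t * γ s = γ s * τ t := fun s t =>
    IsInvariantCurve.commute hγ hγ0 (AdE_eq_of_br_eq_zero h0 hadd hτ hY t) s
  have hγc : Continuous γ := IsMIntegralCurve.continuous hγ
  have hτc : Continuous τ := hτ.continuous
  have hγneg : ∀ s, γ s * γ (-s) = 1 := fun s => by rw [← hγadd, add_neg_cancel, hγ0]
  have hτneg : ∀ s, τ s * τ (-s) = 1 := fun s => by rw [← hadd, add_neg_cancel, h0]
  -- The commuting one-parameter subgroups `γ` and `τ` generate an abelian connected subgroup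
  -- containing `T`. Its closure in the compact group is a torus, so maximality forces `γ` into `T`.
  let S : Subgroup K :=
    { carrier := range fun q : ℝ × ℝ => γ q.1 * τ q.2
      mul_mem' := by
        rintro _ _ ⟨⟨s, t⟩, rfl⟩ ⟨⟨s', t'⟩, rfl⟩
        refine ⟨(s + s', t + t'), ?_⟩
        simp only [hγadd, hadd]
        rw [mul_assoc, ← mul_assoc (γ s'), ← hcomm]
        simp only [mul_assoc]
      one_mem' := ⟨(0, 0), by simp [hγ0, h0]⟩
      inv_mem' := by
        rintro _ ⟨⟨s, t⟩, rfl⟩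
        refine ⟨(-s, -t), ?_⟩
        refine eq_inv_of_mul_eq_one_right ?_
        simp only
        rw [mul_assoc, ← mul_assoc (τ t), hcomm, mul_assoc (γ (-s)), hτneg, mul_one, hγneg] }
  have hScomm : ∀ x y : S, x * y = y * x := by
    rintro ⟨_, ⟨⟨s, t⟩, rfl⟩⟩ ⟨_, ⟨⟨s', t'⟩, rfl⟩⟩
    ext
    simp only [Subgroup.coe_mul]
    rw [mul_assoc, ← mul_assoc (τ t), hcomm, mul_assoc (γ s') (τ t) (τ t'), ← hadd, ← mul_assoc,
      ← hγadd, mul_assoc (γ s'), ← mul_assoc (τ t'), hcomm, mul_assoc (γ s) (τ t') (τ t), ← hadd,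
      ← mul_assoc, ← hγadd, add_comm s, add_comm t]
  have hTS : T ≤ S := by
    intro x hx
    rw [← SetLike.mem_coe, ← hrange] at hx
    obtain ⟨t, rfl⟩ := hx
    exact ⟨(0, t), by simp [hγ0]⟩
  have htorus : IsTorus S.topologicalClosure := by
    refine ⟨S.isClosed_topologicalClosure.isCompact, ?_, ?_⟩
    · rw [Subgroup.topologicalClosure_coe]
      refine IsConnected.closure ?_
      exact isConnected_range (f := fun q : ℝ × ℝ => γ q.1 * τ q.2) (by fun_prop)
    · intro a ha b hb
      let _ := S.commGroupTopologicalClosure hScomm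
      exact congrArg Subtype.val (mul_comm (⟨a, ha⟩ : S.topologicalClosure) ⟨b, hb⟩)
  have hST : ∀ s, ∃ t, τ t = γ s := fun s => by
    have h1 : S.topologicalClosure ≤ T := hT.2 htorus (hTS.trans S.le_topologicalClosure)
    have h2 : γ s ∈ T := h1 (S.le_topologicalClosure ⟨(s, 0), by simp [h0]⟩)
    rwa [← SetLike.mem_coe, ← hrange] at h2
  -- The parameter is reduced modulo `ℤ` by rounding. In this interval `0` is the only integer, so
  -- `0` is the only parameter there that `τ` sends to `1`.
  have hST' : ∀ s, ∃ t ∈ Icc (-(1 / 2) : ℝ) (1 / 2), τ t = γ s := fun s => by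
    obtain ⟨t, ht⟩ := hST s
    refine ⟨t - round t, abs_le.mp (abs_sub_round t), ?_⟩
    rw [← ht, sub_eq_add_neg, hadd]
    have : τ (-(round t : ℝ)) = 1 := (hker _).mpr ⟨-round t, by push_cast; rfl⟩
    rw [this, mul_one]
  choose θ hθI hθ using hST'
  -- The function `θ` is an arbitrary choice, so its continuity at `0` needs proof. The image under
  -- `τ` of the parameters in the interval with `ε ≤ |t|` is compact and misses `1 = γ 0`; hence `γ
  -- s` avoids it for small `s`.
  have hθ0 : Filter.Tendsto θ (𝓝 0) (𝓝 0) := by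
    rw [Metric.tendsto_nhds]
    intro ε hε
    have hc : IsCompact (Icc (-(1 / 2) : ℝ) (1 / 2) ∩ {t | ε ≤ |t|}) :=
      isCompact_Icc.inter_right (isClosed_le continuous_const continuous_abs)
    have h1 : (1 : K) ∉ τ '' (Icc (-(1 / 2) : ℝ) (1 / 2) ∩ {t | ε ≤ |t|}) := by
      rintro ⟨t, ⟨ht1, ht2⟩, ht⟩
      obtain ⟨m, rfl⟩ := (hker t).mp ht
      have h2 : |(m : ℝ)| ≤ 1 / 2 := abs_le.mpr ht1
      have h3 : m = 0 := by
        by_contra hm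
        have : (1 : ℝ) ≤ |(m : ℝ)| := by exact_mod_cast Int.one_le_abs hm
        linarith
      simp only [h3, Int.cast_zero, abs_zero, Set.mem_ofPred_eq] at ht2
      linarith
    have h2 : (τ '' (Icc (-(1 / 2) : ℝ) (1 / 2) ∩ {t | ε ≤ |t|}))ᶜ ∈ 𝓝 (γ 0) := by
      rw [hγ0]
      exact (hc.image hτc).isClosed.isOpen_compl.mem_nhds h1
    filter_upwards [hγc.continuousAt h2] with s hs
    rw [Real.dist_eq, sub_zero]
    by_contra hle
    exact hs ⟨θ s, ⟨hθI s, not_lt.mp hle⟩, hθ s⟩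
  -- Take a functional `L` that kills the velocity `H` of `τ` but not `Y`. In the chart, `H ≠ 0`
  -- gives `θ(s) = O(s)`, while `L(H) = 0` makes `L` along `τ` change by `o(θ(s)) = o(s)`. As `γ s =
  -- τ (θ s)`, this forces `L(Y) = 0`.
  by_contra hspan
  obtain ⟨L₀, hLY, hL⟩ := Submodule.exists_le_ker_of_notMem hspan
  set L : EK →L[ℝ] ℝ := LinearMap.toContinuousLinearMap L₀
  have hLH : L ((mfd τ 0 : ℝ →L[ℝ] EK) 1) = 0 :=
    hL (Submodule.subset_span (mem_singleton _))
  have hdγ := hasDerivAt_chart_comp hγ0 ((hγ 0).mdifferentiableAt)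
  rw [IsInvariantCurve.mfd_zero hγ hγ0] at hdγ
  have hdτ := hasDerivAt_chart_comp h0 (hτ 0)
  set c := fun s => extChartAt 𝓘(ℝ, EK) (1 : K) (γ s) with hc
  set d := fun t => extChartAt 𝓘(ℝ, EK) (1 : K) (τ t) with hd
  have hcd : ∀ s, c s = d (θ s) := fun s => by simp only [hc, hd, hθ]
  have hcd0 : c 0 = d 0 := by simp only [hc, hd, h0, hγ0]
  have h1 : θ =O[𝓝 0] fun s : ℝ => s := by
    have hk : Filter.Tendsto (fun s => (θ s, (0 : ℝ))) (𝓝 0) (𝓝 0 ×ˢ pure 0) :=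
      hθ0.prodMk (Filter.tendsto_pure.mpr (Filter.Eventually.of_forall fun _ => rfl))
    have e1 := (HasDerivAtFilter.isTheta_sub hdτ hH).isBigO_symm.comp_tendsto hk
    have e2 : (fun s => c s - c 0) =O[𝓝 0] fun s : ℝ => s := by
      simpa using hdγ.isBigO_sub
    refine (e1.congr (fun s => ?_) fun s => ?_).trans e2
    · simp
    · simp [hcd s, hcd0]
  have h2 : (fun s => L (c s) - L (c 0)) =o[𝓝 0] fun s : ℝ => s := by
    have h3 : (fun t => L (d t) - L (d 0)) =o[𝓝 0] fun t : ℝ => t := by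
      have := L.hasFDerivAt.comp_hasDerivAt 0 hdτ
      rw [hLH, hasDerivAt_iff_isLittleO] at this
      simpa using this
    have h4 := (h3.comp_tendsto hθ0).trans_isBigO h1
    refine h4.congr_left fun s => ?_
    simp [hcd s, hcd0]
  have h5 : HasDerivAt (fun s => L (c s)) 0 0 := by
    rw [hasDerivAt_iff_isLittleO]
    simpa using h2
  exact hLY ((L.hasFDerivAt.comp_hasDerivAt 0 hdγ).unique h5)

/-- If `K` is compact, every element of the Lie algebra is conjugate to one commuting with `H`. -/
lemma exists_br_AdE_eq_zero [CompactSpace K]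
    {B : LinearMap.BilinForm ℝ (GroupLieAlgebra 𝓘(ℝ, EK) K)} (hB : IsAdInvariantInner B)
    (Y H : EK) : ∃ g : K, br K (AdE EK g Y) H = 0 := by
  have hc : Continuous fun g : K => formE K B (AdE EK g Y) H :=
    (((formE K B).flip H).continuous).comp (mdifferentiable_AdE Y).continuous
  -- At a maximum of `g ↦ B(Ad_g Y, H)`, with `Z = Ad_g Y`, the first-order condition is `B([X, Z],
  -- H) = 0` for all `X`.
  obtain ⟨g, -, hg⟩ := isCompact_univ.exists_isMaxOn univ_nonempty hc.continuousOn
  refine ⟨g, ?_⟩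
  set Z := AdE EK g Y with hZ
  have hmax : ∀ h : K, formE K B (AdE EK h Z) H ≤ formE K B Z H := fun h => by
    rw [hZ, ← AdE_mul_apply]
    exact hg (mem_univ (h * g))
  have hs := mdifferentiableAt_chart_symm (E := EK) (1 : K) (mem_extChartAt_target (1 : K))
  have hd : ∀ X : EK, formE K B (br K X Z) H = 0 := fun X => by
    set F : K → ℝ := fun h => (formE K B).flip H (AdE EK h Z)
    have hF : MDifferentiable 𝓘(ℝ, EK) 𝓘(ℝ, ℝ) F :=
      (((formE K B).flip H).differentiable.mdifferentiable).comp (mdifferentiable_AdE Z)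
    have h1 := mfd_comp_apply (E := EK) (E' := EK) (E'' := ℝ) (g := F)
      (f := (extChartAt 𝓘(ℝ, EK) (1 : K)).symm) (chartOne EK K) (hF _) hs X
    have h2 := mfd_comp_apply (E := EK) (E' := EK) (E'' := ℝ) (g := (formE K B).flip H)
      (f := fun h : K => AdE EK h Z) 1 ((formE K B).flip H).differentiableAt.mdifferentiableAt
      (mdifferentiable_AdE Z 1) X
    rw [mfd_AdE, mfd_eq_fderiv, ContinuousLinearMap.fderiv] at h2
    rw [mfd_chart_symm_chartOne, chart_symm_chartOne, mfd_eq_fderiv] at h1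
    have h3 : IsLocalMax (fun y => F ((extChartAt 𝓘(ℝ, EK) (1 : K)).symm y)) (chartOne EK K) := by
      refine Filter.Eventually.of_forall fun y => ?_
      beta_reduce
      rw [chart_symm_chartOne]
      simpa [F, AdE_one] using hmax ((extChartAt 𝓘(ℝ, EK) (1 : K)).symm y)
    rw [h3.fderiv_eq_zero] at h1
    exact h2.symm.trans h1.symm
  by_contra hne
  have h1 := hB.formE_pos hne
  -- Testing the critical-point condition on `X = [Z, H]` and moving `ad Z` across `B` gives `|[Z,
  -- H]|² = 0`.
  have h2 := hd (br K Z H)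
  rw [br_skew, map_neg, neg_apply, hB.formE_br] at h2
  linarith

/-- In a compact Lie group with a maximal torus of dimension one, commuting elements of the Lie
algebra are linearly dependent. -/
lemma br_ne_zero_of_torusDim_one [CompactSpace K]
    {B : LinearMap.BilinForm ℝ (GroupLieAlgebra 𝓘(ℝ, EK) K)} (hB : IsAdInvariantInner B)
    {T : Subgroup K} (hT : IsMaximalTorus T) (hT1 : HasTorusDim EK T 1) {X Y : EK}
    (hXY : LinearIndependent ℝ ![X, Y]) : br K X Y ≠ 0 := by
  obtain ⟨f, hf, hfadd, hfr, hfk⟩ := hT1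
  set τ : ℝ → K := fun t => f (fun _ => t) with hτdef
  have hτ : MDifferentiable 𝓘(ℝ, ℝ) 𝓘(ℝ, EK) τ := by
    refine (hf.mdifferentiable (by simp)).comp ?_
    have : Differentiable ℝ fun (t : ℝ) (_ : Fin 1) => t := by fun_prop
    exact this.mdifferentiable
  have hadd : ∀ s t, τ (s + t) = τ s * τ t := fun s t => hfadd _ _
  have hker : ∀ t, τ t = 1 ↔ ∃ m : ℤ, t = m := fun t => by simp [hτdef, hfk]
  have h0 : τ 0 = 1 := (hker 0).mpr ⟨0, by simp⟩
  have hrange : range τ = (T : Set K) := by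
    rw [← hfr]
    ext k
    constructor
    · rintro ⟨t, rfl⟩
      exact ⟨_, rfl⟩
    · rintro ⟨t, rfl⟩
      refine ⟨t 0, congrArg f ?_⟩
      ext i
      rw [Subsingleton.elim i 0]
  have hcurve := isInvariantCurve_of_map_add h0 hadd hτ
  -- Zero velocity would make `τ` constant by uniqueness of integral curves; then `τ (1 / 2) = 1`,
  -- although `1 / 2` is not an integer.
  have hH : (mfd τ 0 : ℝ →L[ℝ] EK) 1 ≠ 0 := fun hz => by
    rw [hz] at hcurve
    have hconst : IsInvariantCurve (fun _ : ℝ => (1 : K)) (0 : EK) :=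
      isMIntegralCurve_const (by exact map_zero _)
    have h1 := congrFun (IsInvariantCurve.eq hcurve hconst h0) (1 / 2)
    obtain ⟨m, hm⟩ := (hker _).mp h1
    have : (2 * m : ℤ) = 1 := by
      have : (2 * m : ℝ) = 1 := by rw [← hm]; norm_num
      exact_mod_cast this
    omega
  intro hbr
  obtain ⟨g, hg⟩ := exists_br_AdE_eq_zero hB X ((mfd τ 0 : ℝ →L[ℝ] EK) 1)
  rw [br_skew, neg_eq_zero] at hg
  obtain ⟨a, ha⟩ := Submodule.mem_span_singleton.mp
    (mem_span_of_br_eq_zero hT h0 hadd hτ hrange hker hH hg)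
  have hinj : ∀ Z : EK, AdE EK g Z = 0 → Z = 0 := fun Z hZ => by
    rw [← AdE_inv_AdE g Z, hZ, map_zero]
  have ha0 : a ≠ 0 := by
    rintro rfl
    rw [zero_smul] at ha
    have : ![X, Y] 0 ≠ 0 := hXY.ne_zero 0
    exact this (hinj X ha.symm)
  have h2 : br K ((mfd τ 0 : ℝ →L[ℝ] EK) 1) (AdE EK g Y) = 0 := by
    have h3 := AdE_br g X Y
    rw [hbr, map_zero, ← ha, br_smul_left] at h3
    exact (smul_eq_zero.mp h3.symm).resolve_left ha0
  obtain ⟨b, hb⟩ := Submodule.mem_span_singleton.mp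
    (mem_span_of_br_eq_zero hT h0 hadd hτ hrange hker hH h2)
  -- Here `Ad_g X = aH` and `Ad_g Y = bH`, so this combination is killed by the injective `Ad_g`.
  have h4 : b • X - a • Y = 0 := hinj _ (by
    rw [map_sub, map_smul, map_smul, ← ha, ← hb, smul_smul, smul_smul, mul_comm, sub_self])
  have h5 := LinearIndependent.pair_iff.mp hXY b (-a) (by rw [neg_smul, ← sub_eq_add_neg, h4])
  exact ha0 (neg_eq_zero.mp h5.2)

end Torus

/-! ### Pointwise algebra of principal bundles -/

section Bundle

variable {EK : Type*} [NormedAddCommGroup EK] [NormedSpace ℝ EK]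
  {K : Type*} [TopologicalSpace K] [ChartedSpace EK K] [Group K]
  {EP : Type*} [NormedAddCommGroup EP] [NormedSpace ℝ EP]
  {P : Type*} [TopologicalSpace P] [ChartedSpace EP P]
  {EM : Type*} [NormedAddCommGroup EM] [NormedSpace ℝ EM]
  {M : Type*} [TopologicalSpace M] [ChartedSpace EM M]

/-- A one-form at a point, as a linear map between the model spaces. -/
def OneForm.toE (η : OneForm EK K EP P) (p : P) : EP →L[ℝ] EK := η p

namespace PrincipalBundle

/-! ### The group action: fibres and vertical vectors -/

section Action

variable (Q : PrincipalBundle EK K EP P EM M)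

/-- The fundamental vector fields, on the model spaces. -/
def fundE (p : P) : EK →L[ℝ] EP := mfd (fun g : K => Q.act p g) 1

/-- The derivative of a right translation, on the model spaces. -/
def transE (g : K) (p : P) : EP →L[ℝ] EP := mfd (fun q : P => Q.act q g) p

/-- The derivative of the projection, on the model spaces. -/
def projE (p : P) : EP →L[ℝ] EM := mfd Q.proj p

lemma mdifferentiable_proj : MDifferentiable 𝓘(ℝ, EP) 𝓘(ℝ, EM) Q.proj :=
  Q.contMDiff_proj.mdifferentiable (by simp)

lemma mdifferentiable_act :
    MDifferentiable (𝓘(ℝ, EP).prod 𝓘(ℝ, EK)) 𝓘(ℝ, EP) (fun q : P × K => Q.act q.1 q.2) :=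
  Q.contMDiff_act.mdifferentiable (by simp)

lemma contMDiff_act_right (p : P) : ContMDiff 𝓘(ℝ, EK) 𝓘(ℝ, EP) ∞ (fun g : K => Q.act p g) :=
  Q.contMDiff_act.comp (contMDiff_const.prodMk contMDiff_id)

lemma contMDiff_act_left (g : K) : ContMDiff 𝓘(ℝ, EP) 𝓘(ℝ, EP) ∞ (fun p : P => Q.act p g) :=
  Q.contMDiff_act.comp (contMDiff_id.prodMk contMDiff_const)

lemma mdifferentiable_act_right (p : P) :
    MDifferentiable 𝓘(ℝ, EK) 𝓘(ℝ, EP) (fun g : K => Q.act p g) :=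
  (Q.contMDiff_act_right p).mdifferentiable (by simp)

lemma mdifferentiable_act_left (g : K) :
    MDifferentiable 𝓘(ℝ, EP) 𝓘(ℝ, EP) (fun p : P => Q.act p g) :=
  (Q.contMDiff_act_left g).mdifferentiable (by simp)

/-- A smooth local section together with the fibre coordinate that it defines. -/
lemma exists_local_section (x : M) : ∃ (U : Set M) (s : M → P) (κ : P → K),
    IsOpen U ∧ x ∈ U ∧ ContMDiffOn 𝓘(ℝ, EM) 𝓘(ℝ, EP) ∞ s U ∧
    ContMDiffOn 𝓘(ℝ, EP) 𝓘(ℝ, EK) ∞ κ (Q.proj ⁻¹' U) ∧ (∀ y ∈ U, Q.proj (s y) = y) ∧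
    (∀ q, Q.proj q ∈ U → Q.act (s (Q.proj q)) (κ q) = q) ∧
    ∀ q, Q.proj q ∈ U → ∀ g, κ (Q.act q g) = κ q * g := by
  obtain ⟨U, e, hU, hx, hs, ht, h1, h2, h3, h4⟩ := Q.exists_trivialization x
  have hmem : ∀ y ∈ U, (y, (1 : K)) ∈ e.target := fun y hy => by rw [ht]; exact ⟨hy, mem_univ _⟩
  have hsrc : ∀ y ∈ U, e.symm (y, 1) ∈ e.source := fun y hy => e.map_target (hmem y hy)
  have hproj : ∀ y ∈ U, Q.proj (e.symm (y, 1)) = y := fun y hy => by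
    rw [← h3 _ (hsrc y hy), e.right_inv (hmem y hy)]
  refine ⟨U, fun y => e.symm (y, 1), fun q => (e q).2, hU, hx, ?_, ?_, hproj, ?_, ?_⟩
  · exact h2.comp (contMDiff_id.prodMk contMDiff_const).contMDiffOn fun y hy => hmem y hy
  · rw [← hs]
    exact contMDiff_snd.comp_contMDiffOn h1
  · intro q hq
    have hqs : q ∈ e.source := by rw [hs]; exact hq
    have hp := hproj _ hq
    have has : Q.act (e.symm (Q.proj q, 1)) (e q).2 ∈ e.source := by
      rw [hs, mem_preimage, Q.proj_act, hp]; exact hq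
    refine e.injOn has hqs ?_
    rw [h4 _ (hsrc _ hq), hp, e.right_inv (hmem _ hq), one_mul, ← h3 q hqs]
  · intro q hq g
    exact congrArg Prod.snd (h4 q (by rw [hs]; exact hq) g)

lemma act_left_cancel {p : P} {g h : K} (hgh : Q.act p g = Q.act p h) : g = h := by
  obtain ⟨U, s, κ, -, hx, -, -, -, -, hκ⟩ := Q.exists_local_section (Q.proj p)
  have := congrArg κ hgh
  rw [hκ p hx, hκ p hx] at this
  exact mul_left_cancel this

/-- The quotient of the two fibre coordinates moves `p` to `q`; together with `act_left_cancel` the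
fibres are torsors under `K`. -/
lemma exists_act_eq {p q : P} (h : Q.proj q = Q.proj p) : ∃ g, Q.act p g = q := by
  obtain ⟨U, s, κ, -, hx, -, -, -, hκ, -⟩ := Q.exists_local_section (Q.proj p)
  have h1 := hκ p hx
  have h2 := hκ q (by rwa [h])
  refine ⟨(κ p)⁻¹ * κ q, ?_⟩
  calc Q.act p ((κ p)⁻¹ * κ q) = Q.act (Q.act (s (Q.proj p)) (κ p)) ((κ p)⁻¹ * κ q) := by rw [h1]
    _ = Q.act (s (Q.proj q)) (κ q) := by rw [← Q.act_mul, mul_inv_cancel_left, h]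
    _ = q := h2

lemma projE_fundE (p : P) (X : EK) : Q.projE p (Q.fundE p X) = 0 := by
  have h := mfd_comp_apply (E := EK) (E' := EP) (E'' := EM) (g := Q.proj)
    (f := fun g : K => Q.act p g) 1 (Q.mdifferentiable_proj _) (Q.mdifferentiable_act_right p 1) X
  simp only [Q.proj_act, Q.act_one, mfd_const] at h
  exact h.symm

lemma projE_transE (g : K) (p : P) (v : EP) :
    Q.projE (Q.act p g) (Q.transE g p v) = Q.projE p v := by
  have h := mfd_comp_apply (E := EP) (E' := EP) (E'' := EM) (g := Q.proj)
    (f := fun q : P => Q.act q g) p (Q.mdifferentiable_proj _) (Q.mdifferentiable_act_left g p) v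
  simp only [Q.proj_act] at h
  exact h.symm

/-- Translating a local section by `κ p` makes it pass through `p`; the chain rule for its composite
with the projection supplies a preimage. -/
lemma projE_surjective (p : P) (u : EM) : ∃ v, Q.projE p v = u := by
  obtain ⟨U, s, κ, hU, hx, hs, -, hps, hκ, -⟩ := Q.exists_local_section (Q.proj p)
  have hsd : MDifferentiableAt 𝓘(ℝ, EM) 𝓘(ℝ, EP) s (Q.proj p) :=
    (hs.contMDiffAt (hU.mem_nhds hx)).mdifferentiableAt (by simp)
  have h := mfd_comp_apply (E := EM) (E' := EP) (E'' := EM) (g := Q.proj)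
    (f := fun y : M => Q.act (s y) (κ p)) (Q.proj p) (Q.mdifferentiable_proj _)
    ((Q.mdifferentiable_act_left (κ p) _).comp _ hsd) u
  rw [hκ p hx, mfd_congr (g := fun y : M => y), mfd_id] at h
  · exact ⟨_, h.symm⟩
  · filter_upwards [hU.mem_nhds hx] with y hy
    rw [Q.proj_act, hps y hy]

/-- Vertical vectors are values of fundamental vector fields. -/
lemma exists_fundE_eq {p : P} {v : EP} [LieGroup 𝓘(ℝ, EK) ∞ K] (hv : Q.projE p v = 0) :
    ∃ X, Q.fundE p X = v := by
  obtain ⟨U, s, κ, hU, hx, hs, hκs, hps, hκ, -⟩ := Q.exists_local_section (Q.proj p)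
  have hsd : MDifferentiableAt 𝓘(ℝ, EM) 𝓘(ℝ, EP) s (Q.proj p) :=
    (hs.contMDiffAt (hU.mem_nhds hx)).mdifferentiableAt (by simp)
  have hU' : Q.proj ⁻¹' U ∈ 𝓝 p := Q.contMDiff_proj.continuous.continuousAt (hU.mem_nhds hx)
  have hκd : MDifferentiableAt 𝓘(ℝ, EP) 𝓘(ℝ, EK) κ p :=
    (hκs.contMDiffAt hU').mdifferentiableAt (by simp)
  -- Differentiate `q = s(π q) κ(q)`. For vertical `v` the first slot contributes nothing. The
  -- second is the derivative of `k ↦ p (κ(p)⁻¹ k)`, so `X` is `dκ(v)` translated back to `1`.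
  have h1 := mfd_comp₂ (f := Q.act) (g := fun q => s (Q.proj q)) (h := κ) p
    (Q.mdifferentiable_act _) (hsd.comp p (Q.mdifferentiable_proj p)) hκd v
  have h2 := mfd_comp_apply (E := EP) (E' := EM) (E'' := EP) (g := s) (f := Q.proj) p hsd
    (Q.mdifferentiable_proj p) v
  have h3 : (mfd Q.proj p : EP →L[ℝ] EM) v = 0 := hv
  rw [h2, h3, map_zero, map_zero, zero_add, mfd_congr (g := fun q : P => q), mfd_id] at h1
  · have e : (fun k => Q.act (s (Q.proj p)) k) = fun k => Q.act p ((κ p)⁻¹ * k) := by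
      ext k
      nth_rewrite 2 [← hκ p hx]
      rw [← Q.act_mul, mul_inv_cancel_left]
    have h4 := mfd_comp_apply (E := EK) (E' := EK) (E'' := EP) (g := fun k => Q.act p k)
      (f := fun k => (κ p)⁻¹ * k) (κ p) (Q.mdifferentiable_act_right p _)
      (mdifferentiable_mul_left' _ _) ((mfd κ p : EP →L[ℝ] EK) v)
    rw [e, h4, inv_mul_cancel] at h1
    exact ⟨_, h1.symm⟩
  · filter_upwards [hU'] with q hq
    exact hκ q hq

end Action

/-! ### The adjoint bundle: coordinates in a fibre -/

section AdBundle

variable [LieGroup 𝓘(ℝ, EK) ∞ K] (Q : PrincipalBundle EK K EP P EM M)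

lemma cls_act (p : P) (g : K) (X : EK) : Q.cls (Q.act p g) (AdE EK g⁻¹ X) = Q.cls p X :=
  (Quot.sound ⟨g, rfl⟩ : Q.cls p X = Q.cls (Q.act p g) (AdE EK g⁻¹ X)).symm

lemma adRel_equivalence : Equivalence Q.adRel where
  refl := by
    rintro ⟨p, X⟩
    refine ⟨1, ?_⟩
    have : AdE EK (1 : K)⁻¹ X = X := by rw [inv_one, AdE_one]; rfl
    exact Prod.ext (Q.act_one p).symm this.symm
  symm := by
    rintro ⟨p, X⟩ _ ⟨g, rfl⟩
    refine ⟨g⁻¹, Prod.ext ?_ ?_⟩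
    · change p = Q.act (Q.act p g) g⁻¹
      rw [← Q.act_mul, mul_inv_cancel, Q.act_one]
    · exact (AdE_inv_AdE (EK := EK) g⁻¹ X).symm
  trans := by
    rintro ⟨p, X⟩ _ _ ⟨g, rfl⟩ ⟨h, rfl⟩
    refine ⟨g * h, Prod.ext ?_ ?_⟩
    · exact (Q.act_mul p g h).symm
    · have h1 := AdE_mul_apply (EK := EK) h⁻¹ g⁻¹ X
      rw [← mul_inv_rev] at h1
      exact h1.symm

/-- As `adRel` is already an equivalence, equal classes differ by some `g` fixing `p`, and freeness
gives `g = 1`. This makes `coord`, a choice by `invFun`, the true coordinate on classes `[p; X]`. -/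
lemma cls_injective (p : P) {X Y : EK} (h : Q.cls p X = Q.cls p Y) : X = Y := by
  have h1 := Quot.eqvGen_exact h
  rw [Q.adRel_equivalence.eqvGen_eq] at h1
  obtain ⟨g, hg⟩ := h1
  have hg1 : p = Q.act p g := congrArg Prod.fst hg
  have hg2 : Y = AdE EK g⁻¹ X := congrArg Prod.snd hg
  have : g = 1 := Q.act_left_cancel (p := p) (by rw [← hg1, Q.act_one])
  rw [hg2, this, inv_one, AdE_one]
  rfl

lemma coord_cls (p : P) (X : EK) : Q.coord p (Q.cls p X) = X :=
  Function.leftInverse_invFun (fun _ _ h => Q.cls_injective p h) X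

end AdBundle

/-! ### Horizontal lifts and equivariant functions -/

namespace Connection

variable [LieGroup 𝓘(ℝ, EK) ∞ K] [FiniteDimensional ℝ EK] [FiniteDimensional ℝ EP]
  [FiniteDimensional ℝ EM] [IsManifold 𝓘(ℝ, EP) ∞ P] {Q : PrincipalBundle EK K EP P EM M}
  (A : Q.Connection)

lemma form_fundE (p : P) (X : EK) : A.form.toE p (Q.fundE p X) = X := A.form_fundamental p X

lemma form_transE (p : P) (g : K) (v : EP) :
    A.form.toE (Q.act p g) (Q.transE g p v) = AdE EK g⁻¹ (A.form.toE p v) := A.equivariant p g v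

lemma ext_of_projE_form (p : P) {v w : EP} (h : Q.projE p v = Q.projE p w)
    (h' : A.form.toE p v = A.form.toE p w) : v = w := by
  obtain ⟨X, hX⟩ := Q.exists_fundE_eq (p := p) (v := v - w) (by rw [map_sub, h, sub_self])
  have h1 := A.form_fundE p X
  rw [hX, map_sub, h', sub_self] at h1
  rw [← h1, map_zero] at hX
  exact sub_eq_zero.mp hX.symm

/-- Horizontal lifts are defined through `ContinuousLinearMap.inverse`, which is `0` on
non-invertible maps; bijectivity rules that default out. -/
lemma bijective_projE_form (p : P) :
    Function.Bijective ((Q.projE p).prod (A.form.toE p)) := by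
  refine ⟨fun v w h => ?_, fun ⟨u, X⟩ => ?_⟩
  · simp only [ContinuousLinearMap.prod_apply, Prod.mk.injEq] at h
    exact A.ext_of_projE_form p h.1 h.2
  · obtain ⟨v, hv⟩ := Q.projE_surjective p u
    refine ⟨v + Q.fundE p (X - A.form.toE p v), ?_⟩
    simp [hv, Q.projE_fundE, A.form_fundE]

/-- The horizontal lift, on the model spaces. -/
def liftE (p : P) : EM →L[ℝ] EP :=
  ((Q.projE p).prod (A.form.toE p)).inverse.comp (ContinuousLinearMap.inl ℝ EM EK)

lemma projE_form_liftE (p : P) (u : EM) :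
    Q.projE p (A.liftE p u) = u ∧ A.form.toE p (A.liftE p u) = 0 := by
  have h := A.bijective_projE_form p
  set L := (Q.projE p).prod (A.form.toE p) with hL
  let e : EP ≃L[ℝ] (EM × EK) := (LinearEquiv.ofBijective (L : EP →ₗ[ℝ] (EM × EK)) h).toContinuousLinearEquiv
  have he : (e : EP →L[ℝ] (EM × EK)) = L := by ext v <;> rfl
  have h1 : L (A.liftE p u) = (u, 0) := by
    have : A.liftE p u = e.symm (u, 0) := by
      change L.inverse (u, 0) = _
      rw [← he, ContinuousLinearMap.inverse_equiv]; rfl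
    rw [this, ← he]
    exact e.apply_symm_apply _
  exact ⟨congrArg Prod.fst h1, congrArg Prod.snd h1⟩

@[simp] lemma projE_liftE (p : P) (u : EM) : Q.projE p (A.liftE p u) = u :=
  (A.projE_form_liftE p u).1

@[simp] lemma form_liftE (p : P) (u : EM) : A.form.toE p (A.liftE p u) = 0 :=
  (A.projE_form_liftE p u).2

lemma transE_liftE (p : P) (g : K) (u : EM) :
    Q.transE g p (A.liftE p u) = A.liftE (Q.act p g) u := by
  refine A.ext_of_projE_form (Q.act p g) ?_ ?_
  · rw [Q.projE_transE, projE_liftE, projE_liftE]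
  · rw [form_transE, form_liftE, form_liftE, map_zero]

/-- Every tangent vector is the sum of its horizontal and its vertical part. -/
lemma liftE_eq_sub (p : P) (v : EP) :
    A.liftE p (Q.projE p v) = v - Q.fundE p (A.form.toE p v) := by
  refine A.ext_of_projE_form p ?_ ?_
  · simp [Q.projE_fundE]
  · simp [A.form_fundE]

lemma liftAt_eq {p : P} {x : M} (h : Q.proj p = x) (u : EM) : A.liftAt p h u = A.liftE p u := by
  subst h; rfl

/-- `ˇβ` can be computed at any point of the fibre if `β` is equivariant there. -/
lemma check_eq {β : OneForm EK K EP P} {x : M} (u : EM)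
    (hβ : ∀ p g, Q.proj p = x → β.toE (Q.act p g) (A.liftE (Q.act p g) u) =
      AdE EK g⁻¹ (β.toE p (A.liftE p u))) {p : P} (hp : Q.proj p = x) :
    A.check β x u = Q.cls p (β.toE p (A.liftE p u)) := by
  obtain ⟨g, rfl⟩ := Q.exists_act_eq (p := Q.pt x) (q := p) (by rw [hp, Q.proj_pt])
  rw [hβ _ _ (Q.proj_pt x), Q.cls_act]
  exact congrArg (Q.cls _) (congrArg (β.toE _) (A.liftAt_eq _ u))

variable {α : OneForm EK K EP P}

section Tensorial

variable (hα : Q.IsTensorial α)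
include hα

lemma tensorial_liftE (u : EM) (p : P) (g : K) :
    α.toE (Q.act p g) (A.liftE (Q.act p g) u) = AdE EK g⁻¹ (α.toE p (A.liftE p u)) := by
  rw [← A.transE_liftE]
  exact hα.equivariant p g _

/-- The values of a tensorial form only depend on the projections of its arguments. -/
lemma tensorial_eq (p : P) (v : EP) : α.toE p v = α.toE p (A.liftE p (Q.projE p v)) := by
  rw [liftE_eq_sub, map_sub]
  have : α.toE p (Q.fundE p (A.form.toE p v)) = 0 :=
    hα.vertical p _ (Q.projE_fundE p _)
  rw [this, sub_zero]

lemma check_tensorial {p : P} {x : M} (hp : Q.proj p = x) (u : EM) :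
    A.check α x u = Q.cls p (α.toE p (A.liftE p u)) :=
  A.check_eq u (fun p g _ => A.tensorial_liftE hα u p g) hp

/-- The definition evaluates at the chosen point `pt x`; equivariance of `α` and `Ad`-invariance of
`B` allow any point of the fibre. -/
lemma gMetric_eq {B : LinearMap.BilinForm ℝ (GroupLieAlgebra 𝓘(ℝ, EK) K)}
    (hB : IsAdInvariantInner B) {p : P} {x : M} (hp : Q.proj p = x) (u v : EM) :
    A.gMetric α B x u v = formE K B (α.toE p (A.liftE p u)) (α.toE p (A.liftE p v)) := by
  have h1 : A.gMetric α B x u v =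
      formE K B (α.toE (Q.pt x) (A.liftE (Q.pt x) u)) (α.toE (Q.pt x) (A.liftE (Q.pt x) v)) := by
    unfold gMetric
    rw [A.check_tensorial hα (Q.proj_pt x) u, A.check_tensorial hα (Q.proj_pt x) v]
    unfold adMetric
    have e : Q.adProj (Q.cls (Q.pt x) (α.toE (Q.pt x) (A.liftE (Q.pt x) u))) = x := Q.proj_pt x
    rw [e, Q.coord_cls, Q.coord_cls]
    rfl
  obtain ⟨g, rfl⟩ := Q.exists_act_eq (p := Q.pt x) (q := p) (by rw [hp, Q.proj_pt])
  rw [h1, A.tensorial_liftE hα, A.tensorial_liftE hα, hB.formE_AdE]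

variable (hiso : ∀ p : P, Function.Bijective
      (fun v : {v : TangentSpace 𝓘(ℝ, EP) p // A.form p v = 0} => α p v.1))
include hiso

lemma bijective_liftE (p : P) : Function.Bijective ((α.toE p).comp (A.liftE p)) := by
  refine ⟨fun u v h => ?_, fun X => ?_⟩
  · have := (hiso p).1 (a₁ := ⟨A.liftE p u, A.form_liftE p u⟩)
      (a₂ := ⟨A.liftE p v, A.form_liftE p v⟩) h
    have h2 : A.liftE p u = A.liftE p v := congrArg Subtype.val this
    rw [← A.projE_liftE p u, h2, projE_liftE]
  · obtain ⟨⟨v, hv⟩, hX⟩ := (hiso p).2 X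
    refine ⟨Q.projE p v, ?_⟩
    have hv' : A.form.toE p v = 0 := hv
    have : A.liftE p (Q.projE p v) = v := by
      refine (A.liftE_eq_sub p v).trans ?_
      rw [hv', map_zero]
      exact sub_zero (v : EP)
    rw [ContinuousLinearMap.comp_apply, this]
    exact hX

/-- The isomorphism `T_xM → 𝔨` given by `α` at a point of the fibre over `x`. -/
def isoE (p : P) : EM ≃L[ℝ] EK :=
  (LinearEquiv.ofBijective ((α.toE p).comp (A.liftE p) : EM →ₗ[ℝ] EK)
    (A.bijective_liftE hα hiso p)).toContinuousLinearEquiv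

lemma isoE_apply (p : P) (u : EM) : A.isoE hα hiso p u = α.toE p (A.liftE p u) := rfl

/-- Injectivity of `ˇα` on the tangent space, and `[p; X]` being one of its values, keep `invFun`
off its default. -/
lemma checkInv_cls {p : P} {x : M} (hp : Q.proj p = x) (X : EK) :
    A.checkInv α x (Q.cls p X) = (A.isoE hα hiso p).symm X := by
  have hinj : Function.Injective (A.check α x) := fun u v h => by
    have h1 := A.check_tensorial hα hp u
    have h2 := A.check_tensorial hα hp v
    have h3 := Q.cls_injective p (h1.symm.trans (h.trans h2))
    exact (A.isoE hα hiso p).injective h3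
  have h : A.check α x ((A.isoE hα hiso p).symm X) = Q.cls p X := by
    rw [A.check_tensorial hα hp, ← A.isoE_apply hα hiso, ContinuousLinearEquiv.apply_symm_apply]
  rw [← h]
  exact Function.leftInverse_invFun hinj _

end Tensorial

/-- The equivariant function `p ↦ α (W̃ p)` that belongs to the vector field `W`. -/
def fieldFun (α : OneForm EK K EP P) (W : Π x : M, TangentSpace 𝓘(ℝ, EM) x) (p : P) : EK :=
  α.toE p (A.liftE p (W (Q.proj p)))

variable (hα : Q.IsTensorial α)
include hα

lemma fieldFun_act (W : Π x : M, TangentSpace 𝓘(ℝ, EM) x) (p : P) (g : K) :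
    A.fieldFun α W (Q.act p g) = AdE EK g⁻¹ (A.fieldFun α W p) := by
  have key : ∀ x, x = Q.proj p → α.toE p (A.liftE p (W x)) = A.fieldFun α W p := by
    rintro _ rfl
    rfl
  rw [← key _ (Q.proj_act p g)]
  exact A.tensorial_liftE hα _ p g

/-- This replaces sections of the quotient `ad(P)` by `𝔨`-valued functions on `P`, which can be
differentiated directly. -/
lemma hatSection_check (W : Π x : M, TangentSpace 𝓘(ℝ, EM) x) :
    Q.hatSection (fun y => A.check α y (W y)) = A.fieldFun α W := by
  funext p
  exact (congrArg (Q.coord p) (A.check_tensorial hα rfl (W (Q.proj p)))).trans (Q.coord_cls p _)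

lemma dAFun_liftE (f : P → EK) (p : P) (u : EM) :
    OneForm.toE (A.dAFun f) p (A.liftE p u) = (mfd f p : EP →L[ℝ] EK) (A.liftE p u) := by
  have h : A.liftE p u - Q.fundE p (A.form.toE p (A.liftE p u)) = A.liftE p u := by
    rw [A.form_liftE, map_zero, sub_zero]
  exact congrArg (mfd f p : EP →L[ℝ] EK) h

lemma nablaAd_check (W : Π x : M, TangentSpace 𝓘(ℝ, EM) x) (x : M) (u : EM) :
    A.nablaAd (fun y => A.check α y (W y)) x u =
      Q.cls (Q.pt x) ((mfd (A.fieldFun α W) (Q.pt x) : EP →L[ℝ] EK) (A.liftE (Q.pt x) u)) := by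
  unfold nablaAd
  rw [A.hatSection_check hα, ← A.dAFun_liftE hα]
  exact congrArg (fun v => Q.cls (Q.pt x) (OneForm.toE (A.dAFun (A.fieldFun α W)) (Q.pt x) v))
    (A.liftAt_eq (Q.proj_pt x) u)

/-- Equivariance of the derivative of `p ↦ α (W̃ p)`. -/
lemma mfd_fieldFun_act (W : Π x : M, TangentSpace 𝓘(ℝ, EM) x) (p : P) (g : K)
    (hW : MDifferentiableAt 𝓘(ℝ, EP) 𝓘(ℝ, EK) (A.fieldFun α W) p)
    (hW' : MDifferentiableAt 𝓘(ℝ, EP) 𝓘(ℝ, EK) (A.fieldFun α W) (Q.act p g)) (u : EM) :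
    (mfd (A.fieldFun α W) (Q.act p g) : EP →L[ℝ] EK) (A.liftE (Q.act p g) u) =
      AdE EK g⁻¹ ((mfd (A.fieldFun α W) p : EP →L[ℝ] EK) (A.liftE p u)) := by
  have h1 := mfd_comp_apply (E := EP) (E' := EP) (E'' := EK) (g := A.fieldFun α W)
    (f := fun q => Q.act q g) p hW' (Q.mdifferentiable_act_left g p) (A.liftE p u)
  have h2 := mfd_comp_apply (E := EP) (E' := EK) (E'' := EK) (g := AdE EK g⁻¹)
    (f := A.fieldFun α W) p (AdE EK g⁻¹).differentiableAt.mdifferentiableAt hW (A.liftE p u)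
  rw [mfd_eq_fderiv, ContinuousLinearMap.fderiv] at h2
  have e : (mfd (fun q => Q.act q g) p : EP →L[ℝ] EP) (A.liftE p u) = A.liftE (Q.act p g) u :=
    A.transE_liftE p g u
  rw [e] at h1
  rw [← h1, ← h2]
  simp only [A.fieldFun_act hα]

end Connection
end PrincipalBundle
end Bundle

/-! ### Pull-backs of one-forms to the model space -/

section Pull

variable {EK : Type*} [NormedAddCommGroup EK] [NormedSpace ℝ EK]
  {K : Type*} [TopologicalSpace K] [ChartedSpace EK K] [Group K]
  {EP : Type*} [NormedAddCommGroup EP] [NormedSpace ℝ EP]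
  {P : Type*} [TopologicalSpace P] [ChartedSpace EP P] [IsManifold 𝓘(ℝ, EP) ∞ P]
  {E : Type*} [NormedAddCommGroup E] [NormedSpace ℝ E]

/-- The pull-back of a one-form by a map from a vector space. -/
def OneForm.pull (η : OneForm EK K EP P) (σ : E → P) (y : E) : E →L[ℝ] EK :=
  (η.toE (σ y)).comp (mfd σ y)

lemma OneForm.pull_apply (η : OneForm EK K EP P) (σ : E → P) (y v : E) :
    η.pull σ y v = η.toE (σ y) ((mfd σ y : E →L[ℝ] EP) v) := rfl

/-- In finite dimensions it suffices to test on a fixed vector `v`. The result is the smooth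
function on `TP` composed with the tangent map of `σ` along the constant field `v`. -/
lemma OneForm.contDiffOn_pull [FiniteDimensional ℝ E] {η : OneForm EK K EP P} (hη : η.IsSmooth)
    {σ : E → P} {V : Set E} (hV : IsOpen V) (hσ : ContMDiffOn 𝓘(ℝ, E) 𝓘(ℝ, EP) ∞ σ V) :
    ContDiffOn ℝ ∞ (η.pull σ) V := by
  rw [contDiffOn_clm_apply]
  intro v
  have h1 := hσ.contMDiffOn_tangentMapWithin (m := ∞) (by simp) hV.uniqueMDiffOn
  have h2 : ContMDiff 𝓘(ℝ, E) 𝓘(ℝ, E).tangent ∞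
      (fun y : E => (⟨y, v⟩ : TangentBundle 𝓘(ℝ, E) E)) :=
    (contMDiff_vectorSpace_iff_contDiff (V := fun _ : E => v)).mpr contDiff_const
  have h3 := h1.comp h2.contMDiffOn (s := V) fun y hy => hy
  have h4 := ContMDiff.comp_contMDiffOn hη h3
  rw [← contMDiffOn_iff_contDiffOn]
  refine h4.congr fun y hy => ?_
  have h5 : mfderivWithin 𝓘(ℝ, E) 𝓘(ℝ, EP) σ V y = mfderiv 𝓘(ℝ, E) 𝓘(ℝ, EP) σ y :=
    mfderivWithin_of_isOpen hV hy
  exact congrArg (fun L : E →L[ℝ] EP => η.toE (σ y) (L v)) h5.symm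

/-- The exterior derivative commutes with pull-back. -/
lemma OneForm.fderiv_pull [FiniteDimensional ℝ EP] {η : OneForm EK K EP P} (hη : η.IsSmooth)
    {σ : E → P} {V : Set E} (hV : IsOpen V) (hσ : ContMDiffOn 𝓘(ℝ, E) 𝓘(ℝ, EP) ∞ σ V)
    {y : E} (hy : y ∈ V) (u v : E) :
    fderiv ℝ (η.pull σ) y u v - fderiv ℝ (η.pull σ) y v u =
      (η.d (σ y) ((mfd σ y : E →L[ℝ] EP) u) ((mfd σ y : E →L[ℝ] EP) v) : EK) := by
  set φ := extChartAt 𝓘(ℝ, EP) (σ y) with hφ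
  set ψ : E → EP := fun z => φ (σ z) with hψ
  have hσd : ∀ z ∈ V, MDifferentiableAt 𝓘(ℝ, E) 𝓘(ℝ, EP) σ z := fun z hz =>
    (hσ.contMDiffAt (hV.mem_nhds hz)).mdifferentiableAt (by simp)
  have hsrc : ∀ᶠ z in 𝓝 y, z ∈ V ∧ σ z ∈ φ.source := by
    filter_upwards [hV.mem_nhds hy,
      (hσd y hy).continuousAt (extChartAt_source_mem_nhds (I := 𝓘(ℝ, EP)) (σ y))] with z h1 h2
    exact ⟨h1, h2⟩
  have hψs : ContDiffAt ℝ ∞ ψ y := by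
    rw [← contMDiffAt_iff_contDiffAt]
    exact (contMDiffAt_extChartAt (x := σ y)).comp y (hσ.contMDiffAt (hV.mem_nhds hy))
  have hψd : ∀ z, z ∈ V → σ z ∈ φ.source → ∀ v : E,
      fderiv ℝ ψ z v = (mfd φ (σ z) : EP →L[ℝ] EP) ((mfd σ z : E →L[ℝ] EP) v) := fun z hz hz' v => by
    rw [← mfd_eq_fderiv]
    exact mfd_comp_apply z (mdifferentiableAt_chart _ hz') (hσd z hz) v
  have hpull : η.pull σ =ᶠ[𝓝 y] fun z => (η.inChart (σ y) (ψ z)).comp (fderiv ℝ ψ z) := by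
    filter_upwards [hsrc] with z ⟨hz, hz'⟩
    ext v
    have h1 : φ.symm (ψ z) = σ z := φ.left_inv hz'
    have h2 : η.inChart (σ y) (ψ z) (fderiv ℝ ψ z v) = η.toE (φ.symm (ψ z))
      ((mfd φ.symm (ψ z) : EP →L[ℝ] EP) (fderiv ℝ ψ z v)) := rfl
    have h3 := mfd_symm_comp_chart (σ y) (φ.map_source hz') ((mfd σ z : E →L[ℝ] EP) v)
    rw [ContinuousLinearMap.comp_apply, h2, hψd z hz hz', OneForm.pull_apply, h1]
    rw [← hφ, φ.left_inv hz'] at h3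
    rw [hψ]
    beta_reduce
    rw [h3]
  have hin : DifferentiableAt ℝ (η.inChart (σ y)) (ψ y) := by
    have h1 := OneForm.contDiffOn_pull hη (isOpen_extChartAt_target (I := 𝓘(ℝ, EP)) (σ y))
      (contMDiffOn_extChartAt_symm (σ y))
    exact (h1.contDiffAt (extChartAt_target_mem_nhds (σ y))).differentiableAt (by simp)
  have hψ2 : HasFDerivAt (fderiv ℝ ψ) (fderiv ℝ (fderiv ℝ ψ) y) y :=
    ((hψs.fderiv_right (m := 1) (by norm_cast)).differentiableAt (by simp)).hasFDerivAt
  have hψ1 : HasFDerivAt ψ (fderiv ℝ ψ y) y := (hψs.differentiableAt (by simp)).hasFDerivAt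
  -- With `ψ` the map `σ` in the chart, the product rule leaves one term with the second derivative
  -- of `ψ`. It is symmetric and disappears on antisymmetrising.
  have hsymm : ∀ v w, fderiv ℝ (fderiv ℝ ψ) y v w = fderiv ℝ (fderiv ℝ ψ) y w v := fun v w =>
    (hψs.isSymmSndFDerivAt (by simpa using ENat.LEInfty.out)) v w
  have hD := (hin.hasFDerivAt.comp y hψ1).clm_comp hψ2
  have hd : ∀ u v, fderiv ℝ (η.pull σ) y u v = η.inChart (σ y) (ψ y) (fderiv ℝ (fderiv ℝ ψ) y u v)
      + fderiv ℝ (η.inChart (σ y)) (ψ y) (fderiv ℝ ψ y u) (fderiv ℝ ψ y v) := fun u v => by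
    rw [hpull.fderiv_eq]
    have := congrArg (fun L : E →L[ℝ] E →L[ℝ] EK => L u v) hD.fderiv
    exact this
  rw [hd, hd, hsymm u v, add_sub_add_left_eq_sub,
    hψd y hy (mem_extChartAt_source (σ y)), hψd y hy (mem_extChartAt_source (σ y))]
  rfl

end Pull

/-! ### Regularity of vector fields read in a chart -/

section ChartField

variable {E : Type*} [NormedAddCommGroup E] [NormedSpace ℝ E] [FiniteDimensional ℝ E]
  {M : Type*} [TopologicalSpace M] [ChartedSpace E M] [IsManifold 𝓘(ℝ, E) ∞ M]

lemma differentiableAt_chartField {W : Π x : M, TangentSpace 𝓘(ℝ, E) x} {x : M}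
    (hW : MDiffAt (T% W) x) : DifferentiableAt ℝ (chartField W x) (extChartAt 𝓘(ℝ, E) x x) := by
  have : CompleteSpace E := FiniteDimensional.complete ℝ E
  have h := (hW.mdifferentiableWithinAt (s := univ)
    ).differentiableWithinAt_mpullbackWithin_vectorField
  have e : (extChartAt 𝓘(ℝ, E) x).symm ⁻¹' univ ∩ range 𝓘(ℝ, E) = univ := by simp
  rw [e] at h
  have h' := differentiableWithinAt_univ.mp h
  refine h'.congr_of_eventuallyEq ?_
  filter_upwards [extChartAt_target_mem_nhds (I := 𝓘(ℝ, E)) x] with z hz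
  exact (mpullbackWithin_chart_eq W x hz).symm

lemma contDiffAt_chartField {W : Π x : M, TangentSpace 𝓘(ℝ, E) x} {x : M}
    (hW : ContMDiffAt 𝓘(ℝ, E) 𝓘(ℝ, E).tangent ∞ (T% W) x) :
    ContDiffAt ℝ ∞ (chartField W x) (extChartAt 𝓘(ℝ, E) x x) := by
  have : CompleteSpace E := FiniteDimensional.complete ℝ E
  have h := VectorField.contMDiffWithinAt_mpullbackWithin_extChartAt_symm (n := ∞)
    (hW.contMDiffWithinAt (s := univ)) uniqueMDiffOn_univ (mem_univ x) (by simp)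
  have h' := h.contMDiffAt (Filter.inter_mem (extChartAt_target_mem_nhds (I := 𝓘(ℝ, E)) x)
    (by simp))
  have h2 := contMDiffAt_vectorSpace_iff_contDiffAt.mp h'
  refine h2.congr_of_eventuallyEq ?_
  filter_upwards [extChartAt_target_mem_nhds (I := 𝓘(ℝ, E)) x] with z hz
  exact (mpullbackWithin_chart_eq W x hz).symm

end ChartField

/-! ### Local formulas for the connection -/

section Local

variable {EK : Type*} [NormedAddCommGroup EK] [NormedSpace ℝ EK] [FiniteDimensional ℝ EK]
  {K : Type*} [TopologicalSpace K] [ChartedSpace EK K] [Group K] [LieGroup 𝓘(ℝ, EK) ∞ K]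
  {EP : Type*} [NormedAddCommGroup EP] [NormedSpace ℝ EP] [FiniteDimensional ℝ EP]
  {P : Type*} [TopologicalSpace P] [ChartedSpace EP P] [IsManifold 𝓘(ℝ, EP) ∞ P]
  {EM : Type*} [NormedAddCommGroup EM] [NormedSpace ℝ EM] [FiniteDimensional ℝ EM]
  {M : Type*} [TopologicalSpace M] [ChartedSpace EM M] [IsManifold 𝓘(ℝ, EM) ∞ M]

namespace PrincipalBundle

/-- A smooth local section of the bundle, written in the preferred chart at `x`. -/
structure IsChartSection (Q : PrincipalBundle EK K EP P EM M) (x : M) (V : Set EM)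
    (σ : EM → P) : Prop where
  isOpen : IsOpen V
  subset_target : V ⊆ (extChartAt 𝓘(ℝ, EM) x).target
  smooth : ContMDiffOn 𝓘(ℝ, EM) 𝓘(ℝ, EP) ∞ σ V
  proj_eq : ∀ z ∈ V, Q.proj (σ z) = (extChartAt 𝓘(ℝ, EM) x).symm z

namespace Connection

variable {Q : PrincipalBundle EK K EP P EM M} (A : Q.Connection)

/-- Through every point there is a local section which is horizontal at that point. -/
lemma exists_horizontal_section (p : P) : ∃ (V : Set EM) (σ : EM → P),
    Q.IsChartSection (Q.proj p) V σ ∧ extChartAt 𝓘(ℝ, EM) (Q.proj p) (Q.proj p) ∈ V ∧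
    σ (extChartAt 𝓘(ℝ, EM) (Q.proj p) (Q.proj p)) = p ∧
    A.form.pull σ (extChartAt 𝓘(ℝ, EM) (Q.proj p) (Q.proj p)) = 0 := by
  obtain ⟨U, s, κ, hU, hx, hs, -, hps, hκ, -⟩ := Q.exists_local_section (Q.proj p)
  set φ := extChartAt 𝓘(ℝ, EM) (Q.proj p) with hφ
  set y₀ := φ (Q.proj p) with hy₀
  have hφy₀ : φ.symm y₀ = Q.proj p := extChartAt_to_inv _
  set ψ := extChartAt 𝓘(ℝ, EK) (1 : K) with hψ
  have hV₁ : IsOpen (φ.target ∩ φ.symm ⁻¹' U) :=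
    (continuousOn_extChartAt_symm (Q.proj p)).isOpen_inter_preimage
      (isOpen_extChartAt_target (Q.proj p)) hU
  have hy₁ : y₀ ∈ φ.target ∩ φ.symm ⁻¹' U :=
    ⟨mem_extChartAt_target (Q.proj p), by rw [mem_preimage, hφy₀]; exact hx⟩
  have hs₁ : ContMDiffOn 𝓘(ℝ, EM) 𝓘(ℝ, EP) ∞ (fun z => Q.act (s (φ.symm z)) (κ p))
      (φ.target ∩ φ.symm ⁻¹' U) :=
    (Q.contMDiff_act_left (κ p)).comp_contMDiffOn
      (hs.comp ((contMDiffOn_extChartAt_symm (Q.proj p)).mono inter_subset_left) fun z hz => hz.2)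
  set s₁ : EM → P := fun z => Q.act (s (φ.symm z)) (κ p) with hs₁def
  have hs₁y₀ : s₁ y₀ = p := by
    rw [hs₁def]
    beta_reduce
    rw [hφy₀, hκ p hx]
  set L : EM →L[ℝ] EK := -(A.form.pull s₁ y₀) with hL
  set c : EM → EK := fun z => chartOne EK K + L (z - y₀) with hc
  have hcs : ContDiff ℝ ∞ c := by fun_prop
  have hcy₀ : c y₀ = chartOne EK K := by simp [hc]
  have hV₂ : IsOpen (c ⁻¹' ψ.target) :=
    (isOpen_extChartAt_target (1 : K)).preimage hcs.continuous
  have hy₂ : y₀ ∈ c ⁻¹' ψ.target := by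
    rw [mem_preimage, hcy₀]
    exact mem_extChartAt_target (1 : K)
  have hg : ContMDiffOn 𝓘(ℝ, EM) 𝓘(ℝ, EK) ∞ (fun z => ψ.symm (c z)) (c ⁻¹' ψ.target) :=
    (contMDiffOn_extChartAt_symm (1 : K)).comp hcs.contMDiff.contMDiffOn fun z hz => hz
  have hgy₀ : ψ.symm (c y₀) = 1 := by rw [hcy₀]; exact chart_symm_chartOne
  have hy : y₀ ∈ (φ.target ∩ φ.symm ⁻¹' U) ∩ c ⁻¹' ψ.target := ⟨hy₁, hy₂⟩
  refine ⟨(φ.target ∩ φ.symm ⁻¹' U) ∩ c ⁻¹' ψ.target, fun z => Q.act (s₁ z) (ψ.symm (c z)),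
    ⟨hV₁.inter hV₂, fun z hz => hz.1.1, ?_, fun z hz => ?_⟩, hy, ?_, ?_⟩
  · exact Q.contMDiff_act.comp_contMDiffOn
      ((hs₁.mono inter_subset_left).prodMk (hg.mono inter_subset_right))
  · rw [Q.proj_act, hs₁def, Q.proj_act, hps _ hz.1.2]
  · beta_reduce
    rw [hgy₀, Q.act_one, hs₁y₀]
  · ext u
    have h1 := mfd_comp₂ (f := Q.act) (g := s₁) (h := fun z => ψ.symm (c z)) y₀
      (Q.mdifferentiable_act _)
      ((hs₁.contMDiffAt (hV₁.mem_nhds hy₁)).mdifferentiableAt (by simp))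
      ((hg.contMDiffAt (hV₂.mem_nhds hy₂)).mdifferentiableAt (by simp)) u
    have h2 := mfd_comp_apply (E := EM) (E' := EK) (E'' := EK) (g := ψ.symm) (f := c) y₀
      (mdifferentiableAt_chart_symm (1 : K) hy₂)
      (hcs.contMDiff.mdifferentiable (by simp) _) u
    have h3 : (mfd c y₀ : EM →L[ℝ] EK) u = L u := by
      rw [mfd_eq_fderiv, hc]
      simp [fderiv_const_add, fderiv_sub_const]
    rw [h3, hcy₀, mfd_chart_symm_chartOne] at h2
    have h4 : (fun q => Q.act q (ψ.symm (c y₀))) = fun q => q := by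
      funext q
      rw [hgy₀, Q.act_one]
    rw [h2, h4, mfd_id, hgy₀, hs₁y₀] at h1
    have h5 : (Q.act (s₁ y₀) (ψ.symm (c y₀))) = p := by rw [hgy₀, Q.act_one, hs₁y₀]
    rw [OneForm.pull_apply, h5, h1]
    have h6 : A.form.toE p (Q.fundE p (L u)) = L u := A.form_fundE p _
    have h7 : L u = - A.form.toE p ((mfd s₁ y₀ : EM →L[ℝ] EP) u) := by
      rw [hL, neg_apply, OneForm.pull_apply, hs₁y₀]
    have h8 : A.form.toE p ((ContinuousLinearMap.id ℝ EP) ((mfd s₁ y₀ : EM →L[ℝ] EP) u)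
      + Q.fundE p (L u)) = 0 := by
      rw [map_add, h6, h7]
      simp
    exact h8

variable {x : M} {V : Set EM} {σ : EM → P} (hσ : Q.IsChartSection x V σ)
include hσ

omit [IsManifold 𝓘(ℝ, EP) ∞ P] in
lemma _root_.AdBundleGeometry.PrincipalBundle.IsChartSection.mdifferentiableAt {z : EM}
    (hz : z ∈ V) : MDifferentiableAt 𝓘(ℝ, EM) 𝓘(ℝ, EP) σ z :=
  (hσ.smooth.contMDiffAt (hσ.isOpen.mem_nhds hz)).mdifferentiableAt (by simp)

lemma projE_mfd {z : EM} (hz : z ∈ V) (u : EM) :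
    Q.projE (σ z) ((mfd σ z : EM →L[ℝ] EP) u) =
      (mfd (extChartAt 𝓘(ℝ, EM) x).symm z : EM →L[ℝ] EM) u := by
  have h := mfd_comp_apply (E := EM) (E' := EP) (E'' := EM) (g := Q.proj) (f := σ) z
    (Q.mdifferentiable_proj _) (hσ.mdifferentiableAt hz) u
  rw [mfd_congr (g := (extChartAt 𝓘(ℝ, EM) x).symm)] at h
  · exact h.symm
  · filter_upwards [hσ.isOpen.mem_nhds hz] with y hy
    exact hσ.proj_eq y hy

/-- Decomposition of the derivative of a section into horizontal and vertical part. -/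
lemma mfd_section {z : EM} (hz : z ∈ V) (u : EM) :
    A.liftE (σ z) ((mfd (extChartAt 𝓘(ℝ, EM) x).symm z : EM →L[ℝ] EM) u) =
      (mfd σ z : EM →L[ℝ] EP) u - Q.fundE (σ z) (A.form.pull σ z u) := by
  rw [← projE_mfd hσ hz, A.liftE_eq_sub]
  rfl

variable {α : OneForm EK K EP P} (hα : Q.IsTensorial α)
include hα

lemma tensorial_liftE_section {z : EM} (hz : z ∈ V) (u : EM) :
    α.toE (σ z) (A.liftE (σ z) ((mfd (extChartAt 𝓘(ℝ, EM) x).symm z : EM →L[ℝ] EM) u)) =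
      α.pull σ z u := by
  rw [← projE_mfd hσ hz, ← A.tensorial_eq hα, OneForm.pull_apply]

/-- Tensoriality makes the vertical part of `dσ` invisible to `α`, so the function `w` of `W` is `β
= σ^*α` applied to `W` in the chart. -/
lemma fieldFun_section (W : Π x : M, TangentSpace 𝓘(ℝ, EM) x) {z : EM} (hz : z ∈ V) :
    A.fieldFun α W (σ z) = α.pull σ z (chartField W x z) := by
  rw [← A.tensorial_liftE_section hσ hα hz]
  have h := mfd_symm_comp_chart x (hσ.subset_target hz) (W ((extChartAt 𝓘(ℝ, EM) x).symm z))
  have h2 : ∀ q, q = (extChartAt 𝓘(ℝ, EM) x).symm z → A.liftE (σ z) (W q) =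
      A.liftE (σ z) ((mfd (extChartAt 𝓘(ℝ, EM) x).symm z : EM →L[ℝ] EM) (chartField W x z)) := by
    rintro _ rfl
    exact congrArg (A.liftE (σ z)) h.symm
  exact congrArg (α.toE (σ z)) (h2 _ (hσ.proj_eq z hz))

omit A hα in
/-- The fibre coordinate defined by a local section. -/
lemma exists_fibre_coordinate {z : EM} (hz : z ∈ V) {q₀ : P}
    (hq₀ : Q.proj q₀ = (extChartAt 𝓘(ℝ, EM) x).symm z) :
    ∃ κ : P → K, MDifferentiableAt 𝓘(ℝ, EP) 𝓘(ℝ, EK) κ q₀ ∧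
      ∀ᶠ q in 𝓝 q₀, Q.act (σ (extChartAt 𝓘(ℝ, EM) x (Q.proj q))) (κ q) = q := by
  obtain ⟨U, s, κ, hU, hx, hs, hκs, hps, hκ, -⟩ := Q.exists_local_section (Q.proj q₀)
  set φ := extChartAt 𝓘(ℝ, EM) x with hφ
  have hsrc : Q.proj q₀ ∈ φ.source := by rw [hq₀]; exact φ.map_target (hσ.subset_target hz)
  have hφq₀ : φ (Q.proj q₀) = z := by rw [hq₀]; exact φ.right_inv (hσ.subset_target hz)
  have hU' : Q.proj ⁻¹' U ∈ 𝓝 q₀ := Q.contMDiff_proj.continuous.continuousAt (hU.mem_nhds hx)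
  have hd : MDifferentiableAt 𝓘(ℝ, EP) 𝓘(ℝ, EM) (fun q => φ (Q.proj q)) q₀ :=
    (mdifferentiableAt_chart x hsrc).comp q₀ (Q.mdifferentiable_proj q₀)
  have hσd : MDifferentiableAt 𝓘(ℝ, EP) 𝓘(ℝ, EP) (fun q => σ (φ (Q.proj q))) q₀ := by
    refine MDifferentiableAt.comp q₀ ?_ hd
    rw [hφq₀]
    exact hσ.mdifferentiableAt hz
  have hκd : ∀ q, Q.proj q = Q.proj q₀ → MDifferentiableAt 𝓘(ℝ, EP) 𝓘(ℝ, EK) κ q := fun q hq =>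
    (hκs.contMDiffAt (Q.contMDiff_proj.continuous.continuousAt
      (hU.mem_nhds (by rw [hq]; exact hx)))).mdifferentiableAt (by simp)
  -- The coordinate `κ` is relative to the section `s` of the trivialization; dividing by its value
  -- on `σ` makes it relative to `σ`.
  refine ⟨fun q => (κ (σ (φ (Q.proj q))))⁻¹ * κ q, ?_, ?_⟩
  · have h1 : MDifferentiableAt 𝓘(ℝ, EP) 𝓘(ℝ, EK) (fun q => κ (σ (φ (Q.proj q)))) q₀ := by
      refine MDifferentiableAt.comp q₀ (hκd _ ?_) hσd
      rw [hφq₀, hσ.proj_eq z hz, hq₀]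
    have h2 : MDifferentiable (𝓘(ℝ, EK).prod 𝓘(ℝ, EK)) 𝓘(ℝ, EK) (fun q : K × K => q.1⁻¹ * q.2) :=
      ((contMDiff_fst (I := 𝓘(ℝ, EK)) (J := 𝓘(ℝ, EK)) (n := ∞)).inv.mul
        contMDiff_snd).mdifferentiable (by simp)
    exact (h2 _).comp q₀ (h1.prodMk (hκd q₀ rfl))
  · have h1 : ∀ᶠ q in 𝓝 q₀, φ (Q.proj q) ∈ V :=
      hd.continuousAt.preimage_mem_nhds (by rw [hφq₀]; exact hσ.isOpen.mem_nhds hz)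
    have h2 : ∀ᶠ q in 𝓝 q₀, Q.proj q ∈ φ.source :=
      Q.contMDiff_proj.continuous.continuousAt
        ((isOpen_extChartAt_source (I := 𝓘(ℝ, EM)) x).mem_nhds hsrc)
    filter_upwards [h1, h2, hU'] with q hq1 hq2 hq3
    have h4 : Q.proj (σ (φ (Q.proj q))) = Q.proj q := by
      rw [hσ.proj_eq _ hq1]
      exact φ.left_inv hq2
    have h5 := hκ (σ (φ (Q.proj q))) (by rw [h4]; exact hq3)
    rw [h4] at h5
    calc Q.act (σ (φ (Q.proj q))) ((κ (σ (φ (Q.proj q))))⁻¹ * κ q)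
        = Q.act (Q.act (s (Q.proj q)) (κ (σ (φ (Q.proj q)))))
          ((κ (σ (φ (Q.proj q))))⁻¹ * κ q) := by rw [h5]
      _ = q := by rw [← Q.act_mul, mul_inv_cancel_left, hκ q hq3]

/-- Equivariance writes `f_W(q) = Ad_{κ(q)⁻¹} w(φ(π q))`, so differentiability along one section
spreads to all of the fibre, including the point `pt` used in the definition of `∇`. -/
lemma mdifferentiableAt_fieldFun {W : Π x : M, TangentSpace 𝓘(ℝ, EM) x} {z : EM} (hz : z ∈ V)
    (hW : DifferentiableAt ℝ (fun y => A.fieldFun α W (σ y)) z) {q₀ : P}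
    (hq₀ : Q.proj q₀ = (extChartAt 𝓘(ℝ, EM) x).symm z) :
    MDifferentiableAt 𝓘(ℝ, EP) 𝓘(ℝ, EK) (A.fieldFun α W) q₀ := by
  obtain ⟨κ, hκ, hκ'⟩ := exists_fibre_coordinate hσ hz hq₀
  set φ := extChartAt 𝓘(ℝ, EM) x with hφ
  have hsrc : Q.proj q₀ ∈ φ.source := by rw [hq₀]; exact φ.map_target (hσ.subset_target hz)
  have hφq₀ : φ (Q.proj q₀) = z := by rw [hq₀]; exact φ.right_inv (hσ.subset_target hz)
  have hd : MDifferentiableAt 𝓘(ℝ, EP) 𝓘(ℝ, EM) (fun q => φ (Q.proj q)) q₀ :=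
    (mdifferentiableAt_chart x hsrc).comp q₀ (Q.mdifferentiable_proj q₀)
  have h1 : MDifferentiableAt 𝓘(ℝ, EP) 𝓘(ℝ, EK)
      (fun q => A.fieldFun α W (σ (φ (Q.proj q)))) q₀ := by
    refine MDifferentiableAt.comp (g := fun y => A.fieldFun α W (σ y)) q₀ ?_ hd
    rw [hφq₀]
    exact hW.mdifferentiableAt
  have h2 : MDifferentiableAt 𝓘(ℝ, EP) 𝓘(ℝ, EK →L[ℝ] EK) (fun q => AdE EK (κ q)⁻¹) q₀ :=
    (contMDiff_AdE_inv.mdifferentiable (by simp) _).comp q₀ hκ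
  refine (h2.clm_apply h1).congr_of_eventuallyEq ?_
  filter_upwards [hκ'] with q hq
  rw [← A.fieldFun_act hα, hq]

/-- The covariant derivative of an equivariant function in terms of a local section. -/
lemma mfd_fieldFun_liftE {W : Π x : M, TangentSpace 𝓘(ℝ, EM) x} {z : EM} (hz : z ∈ V)
    (hW : DifferentiableAt ℝ (fun y => A.fieldFun α W (σ y)) z) (u : EM) :
    (mfd (A.fieldFun α W) (σ z) : EP →L[ℝ] EK)
      (A.liftE (σ z) ((mfd (extChartAt 𝓘(ℝ, EM) x).symm z : EM →L[ℝ] EM) u)) =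
      fderiv ℝ (fun y => A.fieldFun α W (σ y)) z u
        + br K (A.form.pull σ z u) (A.fieldFun α W (σ z)) := by
  have hd := A.mdifferentiableAt_fieldFun hσ hα hz hW (hσ.proj_eq z hz)
  have h1 := mfd_comp_apply (E := EM) (E' := EP) (E'' := EK) (g := A.fieldFun α W) (f := σ) z
    hd (hσ.mdifferentiableAt hz) u
  have h2 := mfd_comp_apply (E := EK) (E' := EP) (E'' := EK) (g := A.fieldFun α W)
    (f := fun g => Q.act (σ z) g) 1 (by rw [Q.act_one]; exact hd)
    (Q.mdifferentiable_act_right (σ z) 1) (A.form.pull σ z u)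
  simp only [A.fieldFun_act hα, Q.act_one] at h2
  rw [mfd_AdE_inv] at h2
  rw [mfd_eq_fderiv] at h1
  rw [A.mfd_section hσ hz, map_sub, ← h1]
  -- Along the orbit `f_W` varies by `Ad_{g⁻¹}`, hence the minus sign; subtracting the vertical part
  -- of `dσ(u)` turns it into `+[a(u), w]`.
  have h3 : (mfd (A.fieldFun α W) (σ z) : EP →L[ℝ] EK) (Q.fundE (σ z) (A.form.pull σ z u)) =
    - br K (A.form.pull σ z u) (A.fieldFun α W (σ z)) := h2.symm
  rw [h3, sub_neg_eq_add]

lemma contDiffAt_fieldFun {W : Π x : M, TangentSpace 𝓘(ℝ, EM) x}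
    (hx : extChartAt 𝓘(ℝ, EM) x x ∈ V)
    (hW : ContMDiffAt 𝓘(ℝ, EM) 𝓘(ℝ, EM).tangent ∞ (T% W) x) :
    ContDiffAt ℝ ∞ (fun y => A.fieldFun α W (σ y)) (extChartAt 𝓘(ℝ, EM) x x) := by
  have h1 := (OneForm.contDiffOn_pull hα.smooth hσ.isOpen hσ.smooth).contDiffAt
    (hσ.isOpen.mem_nhds hx)
  refine (h1.clm_apply (contDiffAt_chartField hW)).congr_of_eventuallyEq ?_
  filter_upwards [hσ.isOpen.mem_nhds hx] with z hz
  exact A.fieldFun_section hσ hα W hz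

lemma differentiableAt_fieldFun {W : Π x : M, TangentSpace 𝓘(ℝ, EM) x}
    (hx : extChartAt 𝓘(ℝ, EM) x x ∈ V) (hW : MDiffAt (T% W) x) :
    DifferentiableAt ℝ (fun y => A.fieldFun α W (σ y)) (extChartAt 𝓘(ℝ, EM) x x) := by
  have h1 := ((OneForm.contDiffOn_pull hα.smooth hσ.isOpen hσ.smooth).contDiffAt
    (hσ.isOpen.mem_nhds hx)).differentiableAt (by simp)
  refine (h1.clm_apply (differentiableAt_chartField hW)).congr_of_eventuallyEq ?_
  filter_upwards [hσ.isOpen.mem_nhds hx] with z hz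
  exact A.fieldFun_section hσ hα W hz

omit hσ
variable (hiso : ∀ p : P, Function.Bijective
      (fun v : {v : TangentSpace 𝓘(ℝ, EP) p // A.form p v = 0} => α p v.1))
include hiso

/-- The connection `∇` at a point, as a linear map on the model space. -/
def covE (W : Π x : M, TangentSpace 𝓘(ℝ, EM) x) (x : M) : EM →L[ℝ] EM :=
  ((A.isoE hα hiso (Q.pt x)).symm : EK →L[ℝ] EM).comp
    ((mfd (A.fieldFun α W) (Q.pt x) : EP →L[ℝ] EK).comp (A.liftE (Q.pt x)))

lemma nabla_eq_covE (W : Π x : M, TangentSpace 𝓘(ℝ, EM) x) (x : M) (u : EM) :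
    A.nabla α W x u = A.covE hα hiso W x u := by
  unfold nabla
  rw [A.nablaAd_check hα, A.checkInv_cls hα hiso (Q.proj_pt x)]
  rfl

include hσ in
/-- The local formula for the connection `∇`. -/
lemma isoE_covE {W : Π x : M, TangentSpace 𝓘(ℝ, EM) x} {z : EM} (hz : z ∈ V)
    (hW : DifferentiableAt ℝ (fun y => A.fieldFun α W (σ y)) z) (u : EM) :
    A.isoE hα hiso (σ z) (A.covE hα hiso W ((extChartAt 𝓘(ℝ, EM) x).symm z)
      ((mfd (extChartAt 𝓘(ℝ, EM) x).symm z : EM →L[ℝ] EM) u)) =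
      fderiv ℝ (fun y => A.fieldFun α W (σ y)) z u
        + br K (A.form.pull σ z u) (A.fieldFun α W (σ z)) := by
  rw [← A.mfd_fieldFun_liftE hσ hα hz hW]
  set y := (extChartAt 𝓘(ℝ, EM) x).symm z
  set u' := (mfd (extChartAt 𝓘(ℝ, EM) x).symm z : EM →L[ℝ] EM) u
  have hd := fun q => A.mdifferentiableAt_fieldFun hσ hα hz hW (q₀ := q)
  -- `covE` is computed at the chosen point `pt y`. Both sides transform by the same `Ad_{g⁻¹}` when
  -- moved to `σ z`.
  obtain ⟨g, hg⟩ := Q.exists_act_eq (p := Q.pt y) (q := σ z)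
    (by rw [hσ.proj_eq z hz, Q.proj_pt])
  have h1 := A.mfd_fieldFun_act hα W (Q.pt y) g (hd _ (Q.proj_pt y))
    (by rw [hg]; exact hd _ (hσ.proj_eq z hz)) u'
  have h2 := A.tensorial_liftE hα (A.covE hα hiso W y u') (Q.pt y) g
  have h3 : A.isoE hα hiso (Q.pt y) (A.covE hα hiso W y u') =
      (mfd (A.fieldFun α W) (Q.pt y) : EP →L[ℝ] EK) (A.liftE (Q.pt y) u') :=
    (A.isoE hα hiso (Q.pt y)).apply_symm_apply _
  rw [isoE_apply] at h3 ⊢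
  rw [hg] at h1 h2
  rw [h1, h2, h3]

end Connection
end PrincipalBundle
end Local

/-! ### Covariant derivative, torsion, metric and curvature at the centre of a horizontal section -/

section Geometry

variable {EK : Type*} [NormedAddCommGroup EK] [NormedSpace ℝ EK] [FiniteDimensional ℝ EK]
  {K : Type*} [TopologicalSpace K] [ChartedSpace EK K] [Group K] [LieGroup 𝓘(ℝ, EK) ∞ K]
  {EP : Type*} [NormedAddCommGroup EP] [NormedSpace ℝ EP] [FiniteDimensional ℝ EP]
  {P : Type*} [TopologicalSpace P] [ChartedSpace EP P] [IsManifold 𝓘(ℝ, EP) ∞ P]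
  {EM : Type*} [NormedAddCommGroup EM] [NormedSpace ℝ EM] [FiniteDimensional ℝ EM]
  {M : Type*} [TopologicalSpace M] [ChartedSpace EM M] [IsManifold 𝓘(ℝ, EM) ∞ M]

lemma mfd_chart_symm_self (x : M) (u : EM) :
    (mfd (extChartAt 𝓘(ℝ, EM) x).symm (extChartAt 𝓘(ℝ, EM) x x) : EM →L[ℝ] EM) u = u := by
  have h := mfd_symm_comp_chart x (mem_extChartAt_target (I := 𝓘(ℝ, EM)) x) u
  rw [extChartAt_to_inv, mfd_chart_self] at h
  exact h

namespace PrincipalBundle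

/-- A local section through `p`, written in the preferred chart at `π p`, which is horizontal
at `p`. -/
structure IsHorizontalSection {Q : PrincipalBundle EK K EP P EM M} (A : Q.Connection) (p : P)
    (V : Set EM) (σ : EM → P) : Prop extends Q.IsChartSection (Q.proj p) V σ where
  mem : extChartAt 𝓘(ℝ, EM) (Q.proj p) (Q.proj p) ∈ V
  apply_center : σ (extChartAt 𝓘(ℝ, EM) (Q.proj p) (Q.proj p)) = p
  horizontal : A.form.pull σ (extChartAt 𝓘(ℝ, EM) (Q.proj p) (Q.proj p)) = 0

namespace Connection

variable {Q : PrincipalBundle EK K EP P EM M} (A : Q.Connection)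
  {α : OneForm EK K EP P} (hα : Q.IsTensorial α)
  (hiso : ∀ p : P, Function.Bijective
    (fun v : {v : TangentSpace 𝓘(ℝ, EP) p // A.form p v = 0} => α p v.1))
  {p : P} {S : Set EM} {σ : EM → P} (hσ : IsHorizontalSection A p S σ)

lemma fieldFun_add (W W' : Π x : M, TangentSpace 𝓘(ℝ, EM) x) (q : P) :
    A.fieldFun α (W + W') q = A.fieldFun α W q + A.fieldFun α W' q :=
  ((congrArg (α.toE q) (map_add (A.liftE q) (W (Q.proj q) : EM) (W' (Q.proj q)))).trans
    (map_add (α.toE q) _ _))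

lemma fieldFun_smul (g : M → ℝ) (W : Π x : M, TangentSpace 𝓘(ℝ, EM) x) (q : P) :
    A.fieldFun α (g • W) q = g (Q.proj q) • A.fieldFun α W q :=
  ((congrArg (α.toE q) (map_smul (A.liftE q) (g (Q.proj q)) (W (Q.proj q) : EM))).trans
    (map_smul (α.toE q) _ _))

section Center

include hσ

lemma mfd_center (u : EM) :
    (mfd σ (extChartAt 𝓘(ℝ, EM) (Q.proj p) (Q.proj p)) : EM →L[ℝ] EP) u = A.liftE p u := by
  have h := A.mfd_section hσ.toIsChartSection hσ.mem u
  rw [mfd_chart_symm_self, hσ.apply_center, hσ.horizontal] at h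
  have h2 : Q.fundE p ((0 : EM →L[ℝ] EK) u) = 0 := map_zero _
  rw [h2] at h
  exact (h.trans (sub_zero (_ : EP))).symm

include hα in
lemma pull_center (u : EM) :
    α.pull σ (extChartAt 𝓘(ℝ, EM) (Q.proj p) (Q.proj p)) u = A.isoE hα hiso p u := by
  rw [OneForm.pull_apply, A.mfd_center hσ, hσ.apply_center, isoE_apply]

/-- At the centre `a = 0`, so the bracket term vanishes and `∇` is the ordinary derivative of `w`.
-/
lemma isoE_covE_center {W : Π x : M, TangentSpace 𝓘(ℝ, EM) x}
    (hW : DifferentiableAt ℝ (fun y => A.fieldFun α W (σ y))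
      (extChartAt 𝓘(ℝ, EM) (Q.proj p) (Q.proj p))) (u : EM) :
    A.isoE hα hiso p (A.covE hα hiso W (Q.proj p) u) =
      fderiv ℝ (fun y => A.fieldFun α W (σ y)) (extChartAt 𝓘(ℝ, EM) (Q.proj p) (Q.proj p)) u := by
  have h := A.isoE_covE hσ.toIsChartSection hα hiso hσ.mem hW u
  rw [mfd_chart_symm_self, hσ.apply_center, hσ.horizontal, extChartAt_to_inv] at h
  have h2 : br K ((0 : EM →L[ℝ] EK) u) (A.fieldFun α W p) = 0 := by
    have := br_smul_left (K := K) 0 (0 : EK) (A.fieldFun α W p)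
    rw [zero_smul, zero_smul] at this
    exact this
  rw [h2, add_zero] at h
  exact h

end Center

lemma exists_isHorizontalSection (p : P) : ∃ S σ, IsHorizontalSection A p S σ := by
  obtain ⟨S, σ, h1, h2, h3, h4⟩ := A.exists_horizontal_section p
  exact ⟨S, σ, h1, h2, h3, h4⟩

lemma covE_add {W W' : Π x : M, TangentSpace 𝓘(ℝ, EM) x} {x : M} (hW : MDiffAt (T% W) x)
    (hW' : MDiffAt (T% W') x) :
    A.covE hα hiso (W + W') x = A.covE hα hiso W x + A.covE hα hiso W' x := by
  obtain ⟨p, rfl⟩ := Q.exists_proj_eq x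
  obtain ⟨S, σ, hσ⟩ := A.exists_isHorizontalSection p
  have hd := A.differentiableAt_fieldFun hσ.toIsChartSection hα hσ.mem hW
  have hd' := A.differentiableAt_fieldFun hσ.toIsChartSection hα hσ.mem hW'
  have e : (fun y => A.fieldFun α (W + W') (σ y)) =
      fun y => A.fieldFun α W (σ y) + A.fieldFun α W' (σ y) := by
    funext y
    exact A.fieldFun_add W W' (σ y)
  ext u
  apply (A.isoE hα hiso p).injective
  rw [A.isoE_covE_center hα hiso hσ (by rw [e]; exact hd.add hd'), e, fderiv_fun_add hd hd',
    add_apply, add_apply, map_add,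
    A.isoE_covE_center hα hiso hσ hd, A.isoE_covE_center hα hiso hσ hd']

/-- The encoding by `fieldFun` is linear over functions on `M`, so this is the product rule at the
centre of a horizontal section. -/
lemma covE_leibniz {W : Π x : M, TangentSpace 𝓘(ℝ, EM) x} {g : M → ℝ} {x : M}
    (hW : MDiffAt (T% W) x) (hg : MDifferentiableAt 𝓘(ℝ, EM) 𝓘(ℝ, ℝ) g x) :
    A.covE hα hiso (g • W) x = g x • A.covE hα hiso W x +
      ContinuousLinearMap.smulRight (M₂ := EM) (mfd g x : EM →L[ℝ] ℝ) (W x) := by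
  obtain ⟨p, rfl⟩ := Q.exists_proj_eq x
  obtain ⟨S, σ, hσ⟩ := A.exists_isHorizontalSection p
  have hd := A.differentiableAt_fieldFun hσ.toIsChartSection hα hσ.mem hW
  set φ := extChartAt 𝓘(ℝ, EM) (Q.proj p) with hφ
  have hφy : φ.symm (φ (Q.proj p)) = Q.proj p := extChartAt_to_inv _
  have hgd : MDifferentiableAt 𝓘(ℝ, EM) 𝓘(ℝ, ℝ) (fun z => g (φ.symm z)) (φ (Q.proj p)) :=
    MDifferentiableAt.comp (g := g) (f := φ.symm) _ (by rw [hφy]; exact hg)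
      (mdifferentiableAt_chart_symm _ (mem_extChartAt_target _))
  have hgd' : DifferentiableAt ℝ (fun z => g (φ.symm z)) (φ (Q.proj p)) := hgd.differentiableAt
  have hgf : ∀ u, fderiv ℝ (fun z => g (φ.symm z)) (φ (Q.proj p)) u =
      (mfd g (Q.proj p) : EM →L[ℝ] ℝ) u := fun u => by
    have := mfd_comp_apply (E := EM) (E' := EM) (E'' := ℝ) (g := g) (f := φ.symm)
      (φ (Q.proj p)) (by rw [hφy]; exact hg)
      (mdifferentiableAt_chart_symm _ (mem_extChartAt_target _)) u
    rw [mfd_chart_symm_self, mfd_eq_fderiv, hφy] at this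
    exact this
  have e : (fun y => A.fieldFun α (g • W) (σ y)) =ᶠ[𝓝 (φ (Q.proj p))]
      fun y => g (φ.symm y) • A.fieldFun α W (σ y) := by
    filter_upwards [hσ.isOpen.mem_nhds hσ.mem] with y hy
    rw [A.fieldFun_smul, hσ.proj_eq y hy]
  ext u
  apply (A.isoE hα hiso p).injective
  have h1 : A.fieldFun α W (σ (φ (Q.proj p))) = A.isoE hα hiso p (W (Q.proj p)) := by
    rw [hσ.apply_center]; rfl
  rw [A.isoE_covE_center hα hiso hσ ((hgd'.smul hd).congr_of_eventuallyEq e), e.fderiv_eq,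
    fderiv_fun_smul hgd' hd, h1, hφy]
  simp only [add_apply, smul_apply, ContinuousLinearMap.smulRight_apply, map_add, map_smul, hgf,
    A.isoE_covE_center hα hiso hσ hd]
  exact congrArg₂ (· + ·) rfl (map_smul (A.isoE hα hiso p) _ _).symm

/-- The connection `∇` on the tangent bundle. -/
def covariantDerivative :
    CovariantDerivative 𝓘(ℝ, EM) EM (TangentSpace 𝓘(ℝ, EM) : M → Type _) where
  toFun := A.covE hα hiso
  isCovariantDerivativeOnUniv :=
    { add := fun hW hW' _ => A.covE_add hα hiso hW hW'
      leibniz := fun hW hg _ => A.covE_leibniz hα hiso hW hg }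

section Forms

include hσ

/-- At the centre `dσ` takes horizontal values, where `d_A α` and `dα` coincide; the conclusion is
`dβ = 0` at this point. -/
lemma fderiv_pull_tensorial (hα : Q.IsTensorial α) (hdα : ∀ p u v, A.dA α p u v = 0) (u v : EM) :
    fderiv ℝ (α.pull σ) (extChartAt 𝓘(ℝ, EM) (Q.proj p) (Q.proj p)) u v =
      fderiv ℝ (α.pull σ) (extChartAt 𝓘(ℝ, EM) (Q.proj p) (Q.proj p)) v u := by
  have h := OneForm.fderiv_pull hα.smooth hσ.isOpen hσ.smooth hσ.mem u v
  rw [A.mfd_center hσ, A.mfd_center hσ, hσ.apply_center] at h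
  have hh : ∀ u, A.hor p (A.liftE p u) = A.liftE p u := fun u => by
    have : A.liftE p u - Q.fundE p (A.form.toE p (A.liftE p u)) = A.liftE p u := by
      rw [A.form_liftE, map_zero, sub_zero]
    exact this
  have h2 := hdα p (A.liftE p u) (A.liftE p v)
  unfold dA at h2
  rw [hh, hh] at h2
  exact sub_eq_zero.mp (h.trans h2)

/-- On horizontal vectors `[ω_A ∧ ω_A]` vanishes, so `F_A` reduces to `dω_A`; the factor `½` cancels
the two equal terms of `[α ∧ α]`. -/
lemma fderiv_pull_form
    (hF : ∀ p u v, A.curvatureForm p u v = (1 / 2 : ℝ) • α.bracketWedge α p u v) (u v : EM) :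
    fderiv ℝ (A.form.pull σ) (extChartAt 𝓘(ℝ, EM) (Q.proj p) (Q.proj p)) u v -
      fderiv ℝ (A.form.pull σ) (extChartAt 𝓘(ℝ, EM) (Q.proj p) (Q.proj p)) v u =
      br K (A.isoE hα hiso p u) (A.isoE hα hiso p v) := by
  have h := OneForm.fderiv_pull A.smooth hσ.isOpen hσ.smooth hσ.mem u v
  rw [A.mfd_center hσ, A.mfd_center hσ, hσ.apply_center] at h
  rw [h]
  obtain ⟨D, hD⟩ : ∃ D : EK, D = A.form.d p (A.liftE p u) (A.liftE p v) := ⟨_, rfl⟩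
  have h2 := hF p (A.liftE p u) (A.liftE p v)
  have h3 : D + (1 / 2 : ℝ) •
      (br K (A.form.toE p (A.liftE p u)) (A.form.toE p (A.liftE p v)) -
        br K (A.form.toE p (A.liftE p v)) (A.form.toE p (A.liftE p u))) =
      (1 / 2 : ℝ) • (br K (A.isoE hα hiso p u) (A.isoE hα hiso p v) -
        br K (A.isoE hα hiso p v) (A.isoE hα hiso p u)) := by
    rw [hD]
    exact h2
  rw [A.form_liftE, A.form_liftE, sub_self, smul_zero, add_zero,
    br_skew (A.isoE hα hiso p v)] at h3
  refine hD.symm.trans ?_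
  rw [h3, sub_neg_eq_add, ← two_smul ℝ, smul_smul]
  norm_num

end Forms

/-- The connection `∇` is torsion free if `d_A α = 0`. -/
lemma covE_torsion (hdα : ∀ p u v, A.dA α p u v = 0)
    {U V : Π x : M, TangentSpace 𝓘(ℝ, EM) x} {x : M} (hU : MDiffAt (T% U) x)
    (hV : MDiffAt (T% V) x) :
    (A.covE hα hiso V x (U x) - A.covE hα hiso U x (V x) : EM) =
      VectorField.mlieBracket 𝓘(ℝ, EM) U V x := by
  obtain ⟨p, rfl⟩ := Q.exists_proj_eq x
  obtain ⟨S, σ, hσ⟩ := A.exists_isHorizontalSection p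
  have hb := ((OneForm.contDiffOn_pull hα.smooth hσ.isOpen hσ.smooth).contDiffAt
    (hσ.isOpen.mem_nhds hσ.mem)).differentiableAt (by simp)
  -- The product rule for `w = β(W)`. On antisymmetrising, the terms with `dβ` cancel and the
  -- derivatives of the chart fields form the Lie bracket.
  have key : ∀ {W : Π x : M, TangentSpace 𝓘(ℝ, EM) x}, MDiffAt (T% W) (Q.proj p) → ∀ u : EM,
      A.isoE hα hiso p (A.covE hα hiso W (Q.proj p) u) =
      fderiv ℝ (α.pull σ) (extChartAt 𝓘(ℝ, EM) (Q.proj p) (Q.proj p)) u (W (Q.proj p)) +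
      A.isoE hα hiso p
        (fderiv ℝ (chartField W (Q.proj p)) (extChartAt 𝓘(ℝ, EM) (Q.proj p) (Q.proj p)) u) := by
    intro W hW u
    have e : (fun y => A.fieldFun α W (σ y)) =ᶠ[𝓝 (extChartAt 𝓘(ℝ, EM) (Q.proj p) (Q.proj p))]
        fun y => α.pull σ y (chartField W (Q.proj p) y) := by
      filter_upwards [hσ.isOpen.mem_nhds hσ.mem] with y hy
      exact A.fieldFun_section hσ.toIsChartSection hα W hy
    rw [A.isoE_covE_center hα hiso hσ
      (A.differentiableAt_fieldFun hσ.toIsChartSection hα hσ.mem hW), e.fderiv_eq,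
      (hb.hasFDerivAt.clm_apply (differentiableAt_chartField hW).hasFDerivAt).fderiv,
      ← A.pull_center hα hiso hσ]
    simp only [add_apply, ContinuousLinearMap.comp_apply, chartField_self]
    exact add_comm _ _
  apply (A.isoE hα hiso p).injective
  rw [mlieBracket_eq_chart, VectorField.lieBracket, chartField_self, chartField_self, map_sub]
  have h1 := key hV (U (Q.proj p))
  have h2 := key hU (V (Q.proj p))
  have h3 := A.fderiv_pull_tensorial hσ hα hdα (U (Q.proj p)) (V (Q.proj p))
  refine (congrArg₂ (· - ·) h1 h2).trans ?_
  rw [h3]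
  refine (add_sub_add_left_eq_sub _ _ _).trans ?_
  exact (map_sub (A.isoE hα hiso p) _ _).symm

/-- The connection `∇` is compatible with the metric `g_α`. -/
lemma gMetric_covE {B : LinearMap.BilinForm ℝ (GroupLieAlgebra 𝓘(ℝ, EK) K)}
    (hB : IsAdInvariantInner B) {V W : Π x : M, TangentSpace 𝓘(ℝ, EM) x} {x : M}
    (hV : MDiffAt (T% V) x) (hW : MDiffAt (T% W) x) :
    MDifferentiableAt 𝓘(ℝ, EM) 𝓘(ℝ, ℝ) (fun y => A.gMetric α B y (V y) (W y)) x ∧ ∀ u : EM,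
      (mfd (fun y => A.gMetric α B y (V y) (W y)) x : EM →L[ℝ] ℝ) u =
        A.gMetric α B x (A.covE hα hiso V x u) (W x) +
          A.gMetric α B x (V x) (A.covE hα hiso W x u) := by
  obtain ⟨p, rfl⟩ := Q.exists_proj_eq x
  obtain ⟨S, σ, hσ⟩ := A.exists_isHorizontalSection p
  set φ := extChartAt 𝓘(ℝ, EM) (Q.proj p) with hφ
  have hdV := A.differentiableAt_fieldFun hσ.toIsChartSection hα hσ.mem hV
  have hdW := A.differentiableAt_fieldFun hσ.toIsChartSection hα hσ.mem hW
  set H : EM → ℝ := fun z => formE K B (A.fieldFun α V (σ z)) (A.fieldFun α W (σ z)) with hH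
  have hHd := ((formE K B).hasFDerivAt.comp _ hdV.hasFDerivAt).clm_apply hdW.hasFDerivAt
  have hHf : fderiv ℝ H (φ (Q.proj p)) = _ := hHd.fderiv
  have hφd : MDifferentiableAt 𝓘(ℝ, EM) 𝓘(ℝ, EM) φ (Q.proj p) :=
    mdifferentiableAt_chart _ (mem_extChartAt_source _)
  -- Any point of the fibre computes the metric, in particular the one on `σ`; differentiation is
  -- then the product rule for the constant form `B`.
  have e : (fun y => A.gMetric α B y (V y) (W y)) =ᶠ[𝓝 (Q.proj p)] fun y => H (φ y) := by
    have h1 : ∀ᶠ y in 𝓝 (Q.proj p), φ y ∈ S :=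
      hφd.continuousAt (hσ.isOpen.mem_nhds hσ.mem)
    filter_upwards [h1, extChartAt_source_mem_nhds (I := 𝓘(ℝ, EM)) (Q.proj p)] with y hy hy'
    have h2 : Q.proj (σ (φ y)) = y := by rw [hσ.proj_eq _ hy]; exact φ.left_inv hy'
    refine (A.gMetric_eq hα hB h2 (V y) (W y)).trans ?_
    have h3 : ∀ (W : Π x : M, TangentSpace 𝓘(ℝ, EM) x) z, z = Q.proj (σ (φ y)) →
        α.toE (σ (φ y)) (A.liftE (σ (φ y)) (W z)) = A.fieldFun α W (σ (φ y)) := by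
      rintro W _ rfl
      rfl
    exact congrArg₂ (fun X Y => formE K B X Y) (h3 V _ h2.symm) (h3 W _ h2.symm)
  have hHm : MDifferentiableAt 𝓘(ℝ, EM) 𝓘(ℝ, ℝ) H (φ (Q.proj p)) :=
    hHd.differentiableAt.mdifferentiableAt
  refine ⟨(hHm.comp (Q.proj p) hφd).congr_of_eventuallyEq e, fun u => ?_⟩
  rw [mfd_congr e, mfd_comp_apply (E := EM) (E' := EM) (E'' := ℝ) (Q.proj p) hHm hφd,
    mfd_chart_self, mfd_eq_fderiv, hHf]
  have hR : ∀ X Y : EM, A.gMetric α B (Q.proj p) X Y =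
    formE K B (A.isoE hα hiso p X) (A.isoE hα hiso p Y) := A.gMetric_eq hα hB rfl
  refine Eq.trans ?_ (congrArg₂ (· + ·) (hR _ _) (hR _ _)).symm
  rw [A.isoE_covE_center hα hiso hσ hdV,
    A.isoE_covE_center hα hiso hσ hdW]
  have h4 : ∀ W : Π x : M, TangentSpace 𝓘(ℝ, EM) x, 
      A.fieldFun α W (σ (extChartAt 𝓘(ℝ, EM) (Q.proj p) (Q.proj p))) =
        A.isoE hα hiso p (W (Q.proj p)) := fun W => by rw [hσ.apply_center]; rfl
  simp only [add_apply, ContinuousLinearMap.comp_apply, ContinuousLinearMap.flip_apply,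
    Function.comp_apply, h4]
  exact add_comm (G := ℝ) _ _

/-- The curvature of `∇` on smooth vector fields. -/
lemma isoE_curvature
    (hF : ∀ p u v, A.curvatureForm p u v = (1 / 2 : ℝ) • α.bracketWedge α p u v)
    {U V W : Π x : M, TangentSpace 𝓘(ℝ, EM) x}
    (hU : ContMDiffAt 𝓘(ℝ, EM) 𝓘(ℝ, EM).tangent ∞ (T% U) (Q.proj p))
    (hV : ContMDiffAt 𝓘(ℝ, EM) 𝓘(ℝ, EM).tangent ∞ (T% V) (Q.proj p))
    (hW : ContMDiffAt 𝓘(ℝ, EM) 𝓘(ℝ, EM).tangent ∞ (T% W) (Q.proj p)) :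
    A.isoE hα hiso p (curvatureOfFields (A.covariantDerivative hα hiso) U V W (Q.proj p)) =
      br K (br K (A.isoE hα hiso p (U (Q.proj p))) (A.isoE hα hiso p (V (Q.proj p))))
        (A.isoE hα hiso p (W (Q.proj p))) := by
  obtain ⟨S, σ, hσ⟩ := A.exists_isHorizontalSection p
  set y₀ := extChartAt 𝓘(ℝ, EM) (Q.proj p) (Q.proj p) with hy₀
  set w : EM → EK := fun y => A.fieldFun α W (σ y) with hw
  have hws : ContDiffAt ℝ ∞ w y₀ := A.contDiffAt_fieldFun hσ.toIsChartSection hα hσ.mem hW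
  have hwd : DifferentiableAt ℝ w y₀ := hws.differentiableAt (by simp)
  have hw2 : HasFDerivAt (fderiv ℝ w) (fderiv ℝ (fderiv ℝ w) y₀) y₀ :=
    ((hws.fderiv_right (m := 1) (by norm_cast)).differentiableAt (by simp)).hasFDerivAt
  have hsymm : ∀ u v, fderiv ℝ (fderiv ℝ w) y₀ u v = fderiv ℝ (fderiv ℝ w) y₀ v u := fun u v =>
    (hws.isSymmSndFDerivAt (by simpa using ENat.LEInfty.out)) u v
  have hwe : ∀ᶠ z in 𝓝 y₀, DifferentiableAt ℝ w z := by
    have h1 : ContDiffAt ℝ 1 w y₀ := hws.of_le (by norm_cast)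
    filter_upwards [h1.eventually (by simp)] with z hz
    exact hz.differentiableAt (by simp)
  set a := A.form.pull σ with ha
  have had : HasFDerivAt a (fderiv ℝ a y₀) y₀ :=
    (((OneForm.contDiffOn_pull A.smooth hσ.isOpen hσ.smooth).contDiffAt
      (hσ.isOpen.mem_nhds hσ.mem)).differentiableAt (by simp)).hasFDerivAt
  have ha0 : a y₀ = 0 := hσ.horizontal
  have hwy₀ : w y₀ = A.isoE hα hiso p (W (Q.proj p)) := by
    rw [hw]; beta_reduce; rw [hσ.apply_center]; rfl
  -- The inner derivative must be known on a neighbourhood, where it is `dw(c) + [a(c), w]`.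
  -- Differentiating at the centre kills the terms containing `a` undifferentiated but keeps
  -- `[da(u)(v), w]`, the source of curvature.
  have key : ∀ {X : Π x : M, TangentSpace 𝓘(ℝ, EM) x},
      ContMDiffAt 𝓘(ℝ, EM) 𝓘(ℝ, EM).tangent ∞ (T% X) (Q.proj p) →
      ∀ u v : EM, chartField X (Q.proj p) y₀ = v →
      A.isoE hα hiso p (A.covE hα hiso
        (fun y => (A.covE hα hiso W y (X y) : EM)) (Q.proj p) u) =
      fderiv ℝ (fderiv ℝ w) y₀ u v +
        fderiv ℝ w y₀ (fderiv ℝ (chartField X (Q.proj p)) y₀ u) +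
        br K (fderiv ℝ a y₀ u v) (A.isoE hα hiso p (W (Q.proj p))) := by
    intro X hX u v hcy₀
    set c := chartField X (Q.proj p) with hc
    have hcd : HasFDerivAt c (fderiv ℝ c y₀) y₀ :=
      ((contDiffAt_chartField hX).differentiableAt (by simp)).hasFDerivAt
    have e : (fun z => A.fieldFun α (fun y => (A.covE hα hiso W y (X y) : EM)) (σ z)) =ᶠ[𝓝 y₀]
        fun z => fderiv ℝ w z (c z) + brL EK K (a z (c z)) (w z) := by
      filter_upwards [hσ.isOpen.mem_nhds hσ.mem, hwe] with z hz hwz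
      have h1 := A.isoE_covE hσ.toIsChartSection hα hiso hz hwz (c z)
      refine Eq.trans ?_ h1
      have h2 : ∀ q, q = (extChartAt 𝓘(ℝ, EM) (Q.proj p)).symm z →
          A.isoE hα hiso (σ z) (A.covE hα hiso W q (X q)) =
          A.isoE hα hiso (σ z) (A.covE hα hiso W ((extChartAt 𝓘(ℝ, EM) (Q.proj p)).symm z)
            ((mfd (extChartAt 𝓘(ℝ, EM) (Q.proj p)).symm z : EM →L[ℝ] EM) (c z))) := by
        rintro _ rfl
        have h3 := mfd_symm_comp_chart (Q.proj p) (hσ.subset_target hz)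
          (X ((extChartAt 𝓘(ℝ, EM) (Q.proj p)).symm z))
        exact congrArg (fun v => A.isoE hα hiso (σ z) (A.covE hα hiso W _ v)) h3.symm
      exact h2 _ (hσ.proj_eq z hz)
    have hD := (hw2.clm_apply hcd).add
      (((brL EK K).hasFDerivAt.comp y₀ (had.clm_apply hcd)).clm_apply hwd.hasFDerivAt)
    have hD' := hD.congr_of_eventuallyEq e
    rw [A.isoE_covE_center hα hiso hσ hD'.differentiableAt, hD'.fderiv]
    simp only [add_apply, ContinuousLinearMap.comp_apply, ContinuousLinearMap.flip_apply,
      Function.comp_apply, ha0, hcy₀, hwy₀, zero_apply, map_zero, zero_add]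
    rw [add_comm (fderiv ℝ w y₀ _), brL_apply]
  have h1 := key hV (U (Q.proj p)) (V (Q.proj p)) (chartField_self V (Q.proj p))
  have h2 := key hU (V (Q.proj p)) (U (Q.proj p)) (chartField_self U (Q.proj p))
  have h3 := A.isoE_covE_center hα hiso hσ hwd
    (VectorField.mlieBracket 𝓘(ℝ, EM) U V (Q.proj p))
  have h4 : fderiv ℝ w y₀ (VectorField.mlieBracket 𝓘(ℝ, EM) U V (Q.proj p)) =
      fderiv ℝ w y₀ (fderiv ℝ (chartField V (Q.proj p)) y₀ (U (Q.proj p))) -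
      fderiv ℝ w y₀ (fderiv ℝ (chartField U (Q.proj p)) y₀ (V (Q.proj p))) := by
    rw [← map_sub]
    refine congrArg (fderiv ℝ w y₀) ((mlieBracket_eq_chart U V (Q.proj p)).trans ?_)
    rw [VectorField.lieBracket, chartField_self, chartField_self]
  have h5 := A.fderiv_pull_form hα hiso hσ hF (U (Q.proj p)) (V (Q.proj p))
  have h6 : A.isoE hα hiso p
      (curvatureOfFields (A.covariantDerivative hα hiso) U V W (Q.proj p)) =
      A.isoE hα hiso p (A.covE hα hiso
        (fun y => (A.covE hα hiso W y (V y) : EM)) (Q.proj p) (U (Q.proj p))) -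
      A.isoE hα hiso p (A.covE hα hiso
        (fun y => (A.covE hα hiso W y (U y) : EM)) (Q.proj p) (V (Q.proj p))) -
      A.isoE hα hiso p (A.covE hα hiso W (Q.proj p)
        (VectorField.mlieBracket 𝓘(ℝ, EM) U V (Q.proj p))) :=
    (map_sub (A.isoE hα hiso p) _ _).trans
      (congrArg (· - _) (map_sub (A.isoE hα hiso p) _ _))
  refine h6.trans ?_
  rw [← h5]
  refine (congrArg₂ (· - ·) (congrArg₂ (· - ·) h1 h2) (h3.trans h4)).trans ?_
  -- The second derivatives of `w` cancel by symmetry and the first derivatives against the Lie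
  -- bracket term, leaving the bracket of `da(U, V)` with `w`.
  rw [hsymm (U (Q.proj p)) (V (Q.proj p))]
  have h7 : ∀ X Y Z : EK, br K (X - Y) Z = br K X Z - br K Y Z := fun X Y Z => by
    rw [← brL_apply, ← brL_apply, ← brL_apply, map_sub, sub_apply]
  rw [h7]
  abel

end Connection
end PrincipalBundle
end Geometry

/-! ### Sectional curvature -/

section Sectional

variable {EK : Type*} [NormedAddCommGroup EK] [NormedSpace ℝ EK] [FiniteDimensional ℝ EK]
  {K : Type*} [TopologicalSpace K] [ChartedSpace EK K] [Group K] [LieGroup 𝓘(ℝ, EK) ∞ K]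
  {EP : Type*} [NormedAddCommGroup EP] [NormedSpace ℝ EP] [FiniteDimensional ℝ EP]
  {P : Type*} [TopologicalSpace P] [ChartedSpace EP P] [IsManifold 𝓘(ℝ, EP) ∞ P]
  {EM : Type*} [NormedAddCommGroup EM] [NormedSpace ℝ EM] [FiniteDimensional ℝ EM]
  {M : Type*} [TopologicalSpace M] [ChartedSpace EM M] [IsManifold 𝓘(ℝ, EM) ∞ M]

namespace IsAdInvariantInner

variable {B : LinearMap.BilinForm ℝ (GroupLieAlgebra 𝓘(ℝ, EK) K)} (hB : IsAdInvariantInner B)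
include hB

/-- One use of the skewness of `ad Y`: `B(X, [[X,Y],Y]) = -B(X, [Y,[X,Y]]) = B([Y,X], [X,Y])`. This
is the source of the sign of the curvature. -/
lemma formE_br_br (X Y : EK) :
    formE K B X (br K (br K X Y) Y) = - formE K B (br K X Y) (br K X Y) := by
  have h1 := hB.formE_br Y X (br K X Y)
  rw [br_skew Y X, map_neg, neg_apply, neg_inj] at h1
  rw [br_skew (br K X Y) Y, map_neg, ← h1]

lemma formE_self_nonneg (X : EK) : 0 ≤ formE K B X X := by
  by_cases hX : X = 0
  · simp [hX]
  · exact (hB.formE_pos hX).le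

/-- The strict Cauchy–Schwarz inequality. -/
lemma formE_gram_pos {X Y : EK} (hXY : LinearIndependent ℝ ![X, Y]) :
    0 < formE K B X X * formE K B Y Y - formE K B X Y ^ 2 := by
  rw [LinearIndependent.pair_iff] at hXY
  have hY : Y ≠ 0 := fun h => one_ne_zero (hXY 0 1 (by rw [h]; simp)).2
  have hYY := hB.formE_pos hY
  -- This vector is `B(Y, Y)` times the component of `X` orthogonal to `Y`; its square norm is `B(Y,
  -- Y)` times the Gram determinant.
  have hZ : formE K B Y Y • X - formE K B X Y • Y ≠ 0 := fun h => hYY.ne'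
    (hXY (formE K B Y Y) (- formE K B X Y) (by rw [neg_smul, ← sub_eq_add_neg]; exact h)).1
  have h := hB.formE_pos hZ
  simp only [map_sub, map_smul, sub_apply, smul_apply, smul_eq_mul, hB.formE_symm Y X] at h
  have h2 : 0 < formE K B Y Y * (formE K B X X * formE K B Y Y - formE K B X Y ^ 2) := by
    linarith [h]
  exact (mul_pos_iff_of_pos_left hYY).mp h2

end IsAdInvariantInner

namespace PrincipalBundle.Connection

variable {Q : PrincipalBundle EK K EP P EM M} (A : Q.Connection)
  {α : OneForm EK K EP P} (hα : Q.IsTensorial α)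
  (hiso : ∀ p : P, Function.Bijective
    (fun v : {v : TangentSpace 𝓘(ℝ, EP) p // A.form p v = 0} => α p v.1))
  (hF : ∀ p u v, A.curvatureForm p u v = (1 / 2 : ℝ) • α.bracketWedge α p u v)

lemma linearIndependent_isoE (p : P) {u v : EM} (h : LinearIndependent ℝ ![u, v]) :
    LinearIndependent ℝ ![A.isoE hα hiso p u, A.isoE hα hiso p v] := by
  rw [LinearIndependent.pair_iff] at h ⊢
  intro s t hst
  refine h s t ((A.isoE hα hiso p).injective ?_)
  rw [map_add, map_smul, map_smul, hst, map_zero]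

include hF

/-- The standard extensions are smooth at the base point and take the prescribed values there, so
the formula for fields applies. -/
lemma isoE_curvature_apply (p : P) (u v w : EM) :
    A.isoE hα hiso p (curvature (A.covariantDerivative hα hiso) (Q.proj p) u v w) =
      br K (br K (A.isoE hα hiso p u) (A.isoE hα hiso p v)) (A.isoE hα hiso p w) := by
  have h : ∀ u : TangentSpace 𝓘(ℝ, EM) (Q.proj p),
      ContMDiffAt 𝓘(ℝ, EM) 𝓘(ℝ, EM).tangent ∞ (T% (FiberBundle.extend EM u)) (Q.proj p) :=
    fun u => FiberBundle.contMDiffAt_extend 𝓘(ℝ, EM) EM u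
  have h2 := A.isoE_curvature hα hiso hF (h u) (h v) (h w)
  have e : ∀ u : TangentSpace 𝓘(ℝ, EM) (Q.proj p),
      FiberBundle.extend EM u (Q.proj p) = u := fun u => FiberBundle.extend_apply_self EM u
  exact h2.trans (congrArg₂ (br K) (congrArg₂ (br K) (congrArg (A.isoE hα hiso p) (e u))
    (congrArg (A.isoE hα hiso p) (e v))) (congrArg (A.isoE hα hiso p) (e w)))

lemma sectionalCurvature_eq {B : LinearMap.BilinForm ℝ (GroupLieAlgebra 𝓘(ℝ, EK) K)}
    (hB : IsAdInvariantInner B) (p : P) (u v : EM) :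
    sectionalCurvature (A.covariantDerivative hα hiso) (A.gMetric α B) (Q.proj p) u v =
      - formE K B (br K (A.isoE hα hiso p u) (A.isoE hα hiso p v))
        (br K (A.isoE hα hiso p u) (A.isoE hα hiso p v)) /
      (formE K B (A.isoE hα hiso p u) (A.isoE hα hiso p u) *
        formE K B (A.isoE hα hiso p v) (A.isoE hα hiso p v) -
        formE K B (A.isoE hα hiso p u) (A.isoE hα hiso p v) ^ 2) := by
  have hR : ∀ X Y : EM, A.gMetric α B (Q.proj p) X Y =
    formE K B (A.isoE hα hiso p X) (A.isoE hα hiso p Y) := A.gMetric_eq hα hB rfl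
  have h1 := hR u (curvature (A.covariantDerivative hα hiso) (Q.proj p) u v v)
  rw [A.isoE_curvature_apply hα hiso hF, hB.formE_br_br] at h1
  unfold sectionalCurvature
  rw [← hR u u, ← hR v v, ← hR u v, ← h1]

lemma sectionalCurvature_of_orthonormal
    {B : LinearMap.BilinForm ℝ (GroupLieAlgebra 𝓘(ℝ, EK) K)} (hB : IsAdInvariantInner B) (p : P)
    {u v : EM} (hu : A.gMetric α B (Q.proj p) u u = 1) (hv : A.gMetric α B (Q.proj p) v v = 1)
    (huv : A.gMetric α B (Q.proj p) u v = 0) :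
    sectionalCurvature (A.covariantDerivative hα hiso) (A.gMetric α B) (Q.proj p) u v =
      - formE K B (br K (A.isoE hα hiso p u) (A.isoE hα hiso p v))
        (br K (A.isoE hα hiso p u) (A.isoE hα hiso p v)) := by
  have hR : ∀ X Y : EM, A.gMetric α B (Q.proj p) X Y =
    formE K B (A.isoE hα hiso p X) (A.isoE hα hiso p Y) := A.gMetric_eq hα hB rfl
  refine (A.sectionalCurvature_eq hα hiso hF hB p u v).trans ?_
  rw [(hR u u).symm.trans hu, (hR v v).symm.trans hv, (hR u v).symm.trans huv]
  norm_num

end PrincipalBundle.Connection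

end Sectional

end AdBundleGeometry

end

/-! ### The theorem -/

open AdBundleGeometry in
theorem proposition2p2
    {EK : Type*} [NormedAddCommGroup EK] [NormedSpace ℝ EK] [FiniteDimensional ℝ EK]
    {K : Type*} [TopologicalSpace K] [ChartedSpace EK K] [Group K] [LieGroup 𝓘(ℝ, EK) ∞ K]
    [T2Space K]
    {EP : Type*} [NormedAddCommGroup EP] [NormedSpace ℝ EP] [FiniteDimensional ℝ EP]
    {P : Type*} [TopologicalSpace P] [ChartedSpace EP P] [IsManifold 𝓘(ℝ, EP) ∞ P] [T2Space P]
    {EM : Type*} [NormedAddCommGroup EM] [NormedSpace ℝ EM] [FiniteDimensional ℝ EM]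
    {M : Type*} [TopologicalSpace M] [ChartedSpace EM M] [IsManifold 𝓘(ℝ, EM) ∞ M] [T2Space M]
    (Q : PrincipalBundle EK K EP P EM M) (A : Q.Connection)
    (B : LinearMap.BilinForm ℝ (GroupLieAlgebra 𝓘(ℝ, EK) K)) (hB : IsAdInvariantInner B)
    (α : OneForm EK K EP P) (hα : Q.IsTensorial α)
    (hiso : ∀ p : P, Function.Bijective
      (fun v : {v : TangentSpace 𝓘(ℝ, EP) p // A.form p v = 0} => α p v.1))
    (hdα : ∀ p u v, A.dA α p u v = 0)
    (hF : ∀ p u v, A.curvatureForm p u v = (1 / 2 : ℝ) • α.bracketWedge α p u v) :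
    ∃ cov : CovariantDerivative 𝓘(ℝ, EM) EM (TangentSpace 𝓘(ℝ, EM) : M → Type _),
      -- `cov` is the connection `∇` obtained by pulling back `∇^A`
      (∀ (W : Π x : M, TangentSpace 𝓘(ℝ, EM) x) (x : M) (u : TangentSpace 𝓘(ℝ, EM) x),
        cov W x u = A.nabla α W x u) ∧
      -- `∇` is the Levi-Civita connection of `g_α`
      IsLeviCivita cov (A.gMetric α B) ∧
      -- the curvature formula, for all vector fields that are smooth around the point in question
      (∀ (p : P) (U V W : Π x : M, TangentSpace 𝓘(ℝ, EM) x),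
        ContMDiffAt 𝓘(ℝ, EM) 𝓘(ℝ, EM).tangent ∞ (T% U) (Q.proj p) →
        ContMDiffAt 𝓘(ℝ, EM) 𝓘(ℝ, EM).tangent ∞ (T% V) (Q.proj p) →
        ContMDiffAt 𝓘(ℝ, EM) 𝓘(ℝ, EM).tangent ∞ (T% W) (Q.proj p) →
        curvatureOfFields cov U V W (Q.proj p) =
          A.checkInv α (Q.proj p) (Q.cls p
            ⁅⁅α p (A.lift p (U (Q.proj p))), α p (A.lift p (V (Q.proj p)))⁆,
              α p (A.lift p (W (Q.proj p)))⁆)) ∧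
      -- the curvature formula for tangent vectors
      (∀ (p : P) (u v w : TangentSpace 𝓘(ℝ, EM) (Q.proj p)),
        curvature cov (Q.proj p) u v w =
          A.checkInv α (Q.proj p) (Q.cls p
            ⁅⁅α p (A.lift p u), α p (A.lift p v)⁆, α p (A.lift p w)⁆)) ∧
      -- the sectional curvature of the plane spanned by two orthonormal vectors
      (∀ (p : P) (u v : TangentSpace 𝓘(ℝ, EM) (Q.proj p)),
        A.gMetric α B (Q.proj p) u u = 1 → A.gMetric α B (Q.proj p) v v = 1 →
        A.gMetric α B (Q.proj p) u v = 0 →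
        sectionalCurvature cov (A.gMetric α B) (Q.proj p) u v =
          - B ⁅α p (A.lift p u), α p (A.lift p v)⁆ ⁅α p (A.lift p u), α p (A.lift p v)⁆) ∧
      -- the sectional curvature is non-positive
      (∀ (x : M) (u v : TangentSpace 𝓘(ℝ, EM) x), LinearIndependent ℝ ![u, v] →
        sectionalCurvature cov (A.gMetric α B) x u v ≤ 0) ∧
      -- it is negative if `K` is compact and its maximal torus has dimension one
      (CompactSpace K → (∃ T : Subgroup K, IsMaximalTorus T ∧ HasTorusDim EK T 1) →
        ∀ (x : M) (u v : TangentSpace 𝓘(ℝ, EM) x), LinearIndependent ℝ ![u, v] →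
          sectionalCurvature cov (A.gMetric α B) x u v < 0) := by
  refine ⟨A.covariantDerivative hα hiso, fun W x u => (A.nabla_eq_covE hα hiso W x u).symm,
    ⟨fun U V x hU hV => A.covE_torsion hα hiso hdα hU hV, fun V W x u hV hW => ?_⟩,
    fun p U V W hU hV hW => ?_, fun p u v w => ?_, fun p u v hu hv huv => ?_,
    fun x u v huv => ?_, fun _ ⟨T, hT, hT1⟩ x u v huv => ?_⟩
  · obtain ⟨h1, h2⟩ := A.gMetric_covE hα hiso hB hV hW
    exact ⟨h1, h2 u⟩
  -- On classes `[p; X]` the map `checkInv` is the inverse of `isoE` at `p`, so the identity can be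
  -- checked after applying `isoE`.
  · refine Eq.trans ?_ (A.checkInv_cls hα hiso (p := p) rfl _).symm
    exact (A.isoE hα hiso p).eq_symm_apply.mpr (A.isoE_curvature hα hiso hF hU hV hW)
  · refine Eq.trans ?_ (A.checkInv_cls hα hiso (p := p) rfl _).symm
    exact (A.isoE hα hiso p).eq_symm_apply.mpr (A.isoE_curvature_apply hα hiso hF p u v w)
  · exact A.sectionalCurvature_of_orthonormal hα hiso hF hB p hu hv huv
  · obtain ⟨p, rfl⟩ := Q.exists_proj_eq x
    refine (A.sectionalCurvature_eq hα hiso hF hB p u v).trans_le ?_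
    exact div_nonpos_of_nonpos_of_nonneg (neg_nonpos.mpr (hB.formE_self_nonneg _))
      (hB.formE_gram_pos (A.linearIndependent_isoE hα hiso p huv)).le
  · obtain ⟨p, rfl⟩ := Q.exists_proj_eq x
    refine (A.sectionalCurvature_eq hα hiso hF hB p u v).trans_lt ?_
    have hli := A.linearIndependent_isoE hα hiso p huv
    exact div_neg_of_neg_of_pos
      (neg_neg_of_pos (hB.formE_pos (br_ne_zero_of_torusDim_one hB hT hT1 hli)))
      (hB.formE_gram_pos hli)
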